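/- Let $W$ be the Coxeter group of type $H_4$, with simple reflections $S=\{1,2,3,4\}$ and Coxeter diagram $1\overset{5}{-}2-3-4$, and length function $\ell$. Then $W$ is finite and its longest element is central. **Notation.** Write $J^x=x^{-1}Jx$. For $J\subseteq S$ let $W_J=\langle J\rangle$, let $w_J$ be its longest element, $X_J=\{x\in W:\ell(sx)>\ell(x)\ \forall s\in J\}$, $X_J^\sharp=\{x\in X_J: J^x\subseteq S\}$, $[J]=\{J^x:x\in X_J^\sharp\}$, and $x_J=\sum_{x\in X_J}x^{-1}\in\mathbb{Q}W$. The descent algebra $\Sigma(W)$ is the linear span of the $x_J$, $J\subseteq S$; it is a subalgebra of $\mathbb{Q}W$. For $K,L\subseteq S$ let $m_{KL}=|X_K\cap X_L^\sharp|$ if $L\subseteq K$ and $m_{KL}=0$ otherwise; the matrix $(m_{KL})$ is invertible, and elements $e_L\in\Sigma(W)$ are defined by $x_K=\sum_L m_{KL}e_L$. For a class $\lambda=[J]$ put $e_\lambda=\sum_{L\in\lambda}e_L$; call $\lambda$ even or odd according to the parity of $|J|$. A sequence $(L;s_1,\dots,s_n)$ with distinct $s_i\in L\subseteq S$ is called a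 path of length $n$. For $r\in S$ put $(L;s_1,\dots,s_n).r=(L^d;s_1^d,\dots,s_n^d)$ with $d=w_Lw_{L\cup\{r\}}$ and $s^d=d^{-1}sd$. The street $[L;s_1,\dots,s_n]$ is the orbit of $(L;s_1,\dots,s_n)$ under these operations, identified with the sum of its elements. The linear map $\Delta$ from combinations of paths to $\Sigma(W)$ is given recursively by $\Delta(L;\,)=e_L$ and $$\Delta(L;s_1,\dots,s_n)=\Delta(L\setminus\{s_1\};s_2,\dots,s_n)-\Delta\bigl((L\setminus\{s_1\};s_2,\dots,s_n).s_1\bigr).$$ **Vertices.** There are exactly $10$ classes $\lambda=[J]$. They are listed here with the type of $W_J$, that is, the type of the Coxeter diagram restricted to $J$. Even classes: $\emptyset:[\emptyset]$, $A_{11}:[13]$, $A_2:[23]$, $H_2:[12]$, $H_4:[S]$. Odd classes: $A_1:[1]$, $A_{21}:[134]$, $H_{21}:[124]$, $A_3:[234]$, $H_3:[123]$. (Here $X_{jk\dots}$ stands for $X_j\times A_k\times\cdots$.) **Edges.** Let $Q$ be the quiver with these $10$ vertices and the following $6$ edges, each labelled by a street: in the even part, two edges $A_{11}\to H_4$, labelled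 $[S;2,3]$ and $[S;3,1]$, and one edge $A_2\to H_4$, labelled $[S;1,2]$; in the odd part, one edge $A_1\to A_3$, labelled $[234;2,3]$, and two edges $A_1\to H_3$, labelled $[123;1,2]$ and $[123;3,1]$. The even part of $Q$ is dual (isomorphic to the opposite quiver) to the odd part. Then the following hold. 1. $Q$ is the quiver of $\Sigma(W)$: for all vertices $\lambda,\mu$ the number of edges $\lambda\to\mu$ in $Q$ is $\dim_{\mathbb Q} e_\lambda(\operatorname{rad}\Sigma(W)/\operatorname{rad}^2\Sigma(W))e_\mu$. 2. There are no relations: there is an isomorphism of $\mathbb{Q}$-algebras from the path algebra $\mathbb{Q}Q$ (paths multiplied by concatenation from left to right) onto $\Sigma(W)$ that sends each vertex $\lambda$ to $e_\lambda$ and each edge with label $\alpha$ to $\Delta(\alpha)$. 3. $\Sigma(W)=\bigoplus_\lambda\Sigma(W)e_\lambda$; the left modules $P_\lambda=\Sigma(W)e_\lambda$ are indecomposable, and their heads $S_\lambda=P_\lambda/\operatorname{rad}P_\lambda$ are simple and pairwise non-isomorphic. For all $\lambda$, $\operatorname{rad}(\operatorname{rad}P_\lambda)=0$, and the radical of $P_\lambda$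 is $$\operatorname{rad}P_{A_3}\cong S_{A_1},\qquad \operatorname{rad}P_{H_3}\cong S_{A_1}^{2},\qquad \operatorname{rad}P_{H_4}\cong S_{A_{11}}^{2}\oplus S_{A_2},$$ and $\operatorname{rad}P_\lambda=0$ for the other seven vertices $\lambda$. 4. The Cartan matrix, with entry $\dim_{\mathbb Q}e_\mu\Sigma(W)e_\lambda$ in row $\lambda$ and column $\mu$, has entry $1$ on the diagonal, entry $1$ at $(A_3,A_1)$, $2$ at $(H_3,A_1)$, $2$ at $(H_4,A_{11})$, $1$ at $(H_4,A_2)$, and $0$ elsewhere. -/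

import Mathlib

/-! ## Path algebras of quivers -/

/-- The path algebra `k[Q]` of a quiver: the free `k`-module on the paths of the quiver (each
path with its source and target, the paths of length `0` being the vertices). -/
def PathAlgebra (k V : Type*) [CommRing k] [Quiver V] : Type _ :=
  (Σ a b : V, Quiver.Path a b) →₀ k

namespace PathAlgebra

variable {k V : Type*} [CommRing k] [Quiver V]

noncomputable instance : AddCommGroup (PathAlgebra k V) :=
  inferInstanceAs (AddCommGroup ((Σ a b : V, Quiver.Path a b) →₀ k))

noncomputable instance : Module k (PathAlgebra k V) :=
  inferInstanceAs (Module k ((Σ a b : V, Quiver.Path a b) →₀ k))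

/-- The basis element of the path algebra given by a path. -/
noncomputable def ofPath (k : Type*) {V : Type*} [CommRing k] [Quiver V] {a b : V}
    (p : Quiver.Path a b) : PathAlgebra k V :=
  Finsupp.single (⟨a, b, p⟩ : Σ a b : V, Quiver.Path a b) (1 : k)

open Classical in
/-- The product of two paths: `p` followed by `q` if `p` ends where `q` starts, else `0`. -/
noncomputable def compOrZero (k : Type*) {V : Type*} [CommRing k] [Quiver V]
    (p q : Σ a b : V, Quiver.Path a b) : PathAlgebra k V :=
  if h : p.2.1 = q.1 then ofPath k (p.2.2.comp (q.2.2.cast h.symm rfl)) else 0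

/-- The multiplication of the path algebra: the bilinear extension of `compOrZero`. -/
noncomputable def mulLinear (k V : Type*) [CommRing k] [Quiver V] :
    PathAlgebra k V →ₗ[k] PathAlgebra k V →ₗ[k] PathAlgebra k V :=
  Finsupp.linearCombination k fun p => Finsupp.linearCombination k fun q => compOrZero k p q

noncomputable instance : Mul (PathAlgebra k V) := ⟨fun x y => mulLinear k V x y⟩

/-- The unit of the path algebra of a quiver with finitely many vertices is the sum of the
paths of length `0`. -/
noncomputable instance [Fintype V] : One (PathAlgebra k V) :=
  ⟨∑ v : V, ofPath k (Quiver.Path.nil : Quiver.Path v v)⟩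

theorem mul_eq (x y : PathAlgebra k V) : x * y = mulLinear k V x y := rfl

theorem one_eq [Fintype V] :
    (1 : PathAlgebra k V) = ∑ v : V, ofPath k (Quiver.Path.nil : Quiver.Path v v) := rfl

theorem ofPath_mul {a b c d : V} (p : Quiver.Path a b) (q : Quiver.Path c d) :
    ofPath k p * ofPath k q = compOrZero k ⟨a, b, p⟩ ⟨c, d, q⟩ := by
  rw [mul_eq]
  unfold mulLinear ofPath
  erw [Finsupp.linearCombination_single, one_smul, Finsupp.linearCombination_single, one_smul]

theorem ofPath_mul_comp {a b c : V} (p : Quiver.Path a b) (q : Quiver.Path b c) :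
    ofPath k p * ofPath k q = ofPath k (p.comp q) := by
  rw [ofPath_mul]
  simp [compOrZero]

theorem ofPath_mul_ne {a b c d : V} (p : Quiver.Path a b) (q : Quiver.Path c d) (h : b ≠ c) :
    ofPath k p * ofPath k q = 0 := by
  rw [ofPath_mul]
  simp [compOrZero, h]

@[elab_as_elim]
theorem induction_on {P : PathAlgebra k V → Prop} (x : PathAlgebra k V) (h0 : P 0)
    (hadd : ∀ x y, P x → P y → P (x + y))
    (hsmul : ∀ (r : k) (a b : V) (p : Quiver.Path a b), P (r • ofPath k p)) : P x := by
  refine Finsupp.induction_linear (motive := P) x h0 hadd ?_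
  rintro ⟨a, b, p⟩ r
  have h := hsmul r a b p
  unfold ofPath at h
  erw [Finsupp.smul_single, smul_eq_mul, mul_one] at h
  exact h

theorem add_mul' (x y z : PathAlgebra k V) : (x + y) * z = x * z + y * z := by
  simp only [mul_eq, map_add, LinearMap.add_apply]

theorem mul_add' (x y z : PathAlgebra k V) : x * (y + z) = x * y + x * z := by
  simp only [mul_eq, map_add]

theorem zero_mul' (x : PathAlgebra k V) : 0 * x = 0 := by
  simp only [mul_eq, map_zero, LinearMap.zero_apply]

theorem mul_zero' (x : PathAlgebra k V) : x * 0 = 0 := by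
  simp only [mul_eq, map_zero]

theorem smul_mul' (r : k) (x y : PathAlgebra k V) : (r • x) * y = r • (x * y) := by
  simp only [mul_eq, map_smul, LinearMap.smul_apply]

theorem mul_smul' (r : k) (x y : PathAlgebra k V) : x * (r • y) = r • (x * y) := by
  simp only [mul_eq, map_smul]

theorem mul_assoc' (x y z : PathAlgebra k V) : x * y * z = x * (y * z) := by
  induction x using induction_on with
  | h0 => simp only [zero_mul']
  | hadd x x' hx hx' => simp only [add_mul', hx, hx']
  | hsmul r a b p =>
    induction y using induction_on with
    | h0 => simp only [zero_mul', mul_zero']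
    | hadd y y' hy hy' => simp only [add_mul', mul_add', hy, hy']
    | hsmul r' c d q =>
      induction z using induction_on with
      | h0 => simp only [mul_zero']
      | hadd z z' hz hz' => simp only [mul_add', hz, hz']
      | hsmul r'' e f t =>
        simp only [smul_mul', mul_smul']
        congr 3
        by_cases h : b = c
        · subst h
          by_cases h' : d = e
          · subst h'
            simp only [ofPath_mul_comp, Quiver.Path.comp_assoc]
          · rw [ofPath_mul_comp, ofPath_mul_ne _ _ h', ofPath_mul_ne _ _ h', mul_zero']
        · rw [ofPath_mul_ne _ _ h, zero_mul']
          by_cases h' : d = e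
          · subst h'
            rw [ofPath_mul_comp, ofPath_mul_ne _ _ h]
          · rw [ofPath_mul_ne _ _ h', mul_zero']

theorem finset_sum_mul' {ι : Type*} (s : Finset ι) (f : ι → PathAlgebra k V)
    (x : PathAlgebra k V) : (∑ i ∈ s, f i) * x = ∑ i ∈ s, f i * x := by
  simp only [mul_eq, map_sum, LinearMap.sum_apply]

theorem mul_finset_sum' {ι : Type*} (s : Finset ι) (f : ι → PathAlgebra k V)
    (x : PathAlgebra k V) : x * (∑ i ∈ s, f i) = ∑ i ∈ s, x * f i := by
  simp only [mul_eq, map_sum]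

theorem one_mul' [Fintype V] (x : PathAlgebra k V) : 1 * x = x := by
  induction x using induction_on with
  | h0 => exact mul_zero' _
  | hadd x y hx hy => rw [mul_add', hx, hy]
  | hsmul r a b p =>
    rw [mul_smul', one_eq, finset_sum_mul', Finset.sum_eq_single a]
    · rw [ofPath_mul_comp, Quiver.Path.nil_comp]
    · intro v _ hv
      exact ofPath_mul_ne _ _ hv
    · intro h
      exact absurd (Finset.mem_univ a) h

theorem mul_one' [Fintype V] (x : PathAlgebra k V) : x * 1 = x := by
  induction x using induction_on with
  | h0 => exact zero_mul' _
  | hadd x y hx hy => rw [add_mul', hx, hy]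
  | hsmul r a b p =>
    rw [smul_mul', one_eq, mul_finset_sum', Finset.sum_eq_single b]
    · rw [ofPath_mul_comp, Quiver.Path.comp_nil]
    · intro v _ hv
      exact ofPath_mul_ne _ _ hv.symm
    · intro h
      exact absurd (Finset.mem_univ b) h

noncomputable instance [Fintype V] : Ring (PathAlgebra k V) :=
  { (inferInstance : AddCommGroup (PathAlgebra k V)),
    (inferInstance : Mul (PathAlgebra k V)),
    (inferInstance : One (PathAlgebra k V)) with
    left_distrib := mul_add'
    right_distrib := add_mul'
    zero_mul := zero_mul'
    mul_zero := mul_zero'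
    mul_assoc := mul_assoc'
    one_mul := one_mul'
    mul_one := mul_one' }

noncomputable instance [Fintype V] : Algebra k (PathAlgebra k V) :=
  Algebra.ofModule smul_mul' mul_smul'

end PathAlgebra

/-! ## Radical series of modules, corners of algebras -/

/-- The radical series `M ⊇ rad M ⊇ rad (rad M) ⊇ …` of a module. -/
def radicalSeries (R M : Type*) [Ring R] [AddCommGroup M] [Module R M] : ℕ → Submodule R M
  | 0 => ⊤
  | n + 1 => (Module.jacobson R (radicalSeries R M n)).map (radicalSeries R M n).subtype

/-- The `n`-th Loewy layer of a module, `n = 0, 1, 2, …`: the quotient of the `n`-th term of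
the radical series by its radical. -/
abbrev LoewyLayer (R M : Type*) [Ring R] [AddCommGroup M] [Module R M] (n : ℕ) : Type _ :=
  radicalSeries R M n ⧸ Module.jacobson R (radicalSeries R M n)

/-- The head `M / rad M` of a module. -/
abbrev ModuleHead (R M : Type*) [Ring R] [AddCommGroup M] [Module R M] : Type _ :=
  M ⧸ Module.jacobson R M

/-- The left ideal `A a`. -/
def principalLeftIdeal {A : Type*} [Ring A] (a : A) : Submodule A A :=
  Submodule.span A {a}

/-- A module is indecomposable if it is nonzero and not the direct sum of two nonzero
submodules. -/
def IsIndecomposableModule (R M : Type*) [Ring R] [AddCommGroup M] [Module R M] : Prop :=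
  Nontrivial M ∧ ∀ N N' : Submodule R M, IsCompl N N' → N = ⊥ ∨ N' = ⊥

/-- The subspace `e U f` of an algebra, for elements `e`, `f` and a subspace `U`. -/
def cornerSpace {k A : Type*} [CommRing k] [Ring A] [Algebra k A] (e f : A)
    (U : Submodule k A) : Submodule k A :=
  U.map (LinearMap.mulLeft k e ∘ₗ LinearMap.mulRight k f)

/-- The dimension of `e (rad A / rad² A) f`, the number of arrows from `e` to `f` in
the (ordinary, or Gabriel) quiver of a basic algebra `A` if `e`, `f` belong to a complete set of
primitive orthogonal idempotents. -/
noncomputable def gabrielArrows (k : Type*) {A : Type*} [CommRing k] [Ring A] [Algebra k A]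
    (e f : A) : ℕ :=
  let J : Submodule k A := (Ring.jacobson A).restrictScalars k
  Module.finrank k
    (↥(cornerSpace e f J) ⧸ (cornerSpace e f (J * J)).submoduleOf (cornerSpace e f J))

/-! ## The descent algebra of a Coxeter group -/

namespace CoxeterMatrix

/-- The disjoint union of two Coxeter diagrams (with no bond between the two parts). -/
def disjointUnion {B C : Type*} (M : CoxeterMatrix B) (N : CoxeterMatrix C) :
    CoxeterMatrix (B ⊕ C) where
  M := Matrix.fromBlocks M.M (Matrix.of fun _ _ => 2) (Matrix.of fun _ _ => 2) N.M
  isSymm := Matrix.IsSymm.fromBlocks M.isSymm rfl N.isSymm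
  diagonal i := by
    cases i with
    | inl i => exact M.diagonal i
    | inr i => exact N.diagonal i
  off_diagonal i j h := by
    cases i with
    | inl i =>
      cases j with
      | inl j => exact M.off_diagonal i j fun e => h (congrArg Sum.inl e)
      | inr j => simp
    | inr i =>
      cases j with
      | inl j => simp
      | inr j => exact N.off_diagonal i j fun e => h (congrArg Sum.inr e)

/-- The subdiagram of `M` on `J` is the Coxeter diagram `N`: the parabolic subgroup `W_J` is of
type `N`. -/
def HasType {B C : Type*} (M : CoxeterMatrix B) (J : Finset B) (N : CoxeterMatrix C) : Prop :=
  ∃ f : C ≃ J, ∀ c c' : C, N c c' = M (f c) (f c')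

end CoxeterMatrix

namespace CoxeterSystem

variable {B : Type*} {M : CoxeterMatrix B} {W : Type*} [Group W] (cs : CoxeterSystem M W)

/-- `X_J = {x : ℓ(s x) > ℓ(x) for all s ∈ J}`, the minimal length right coset representatives
of `W_J`. -/
def minReps (J : Finset B) : Set W :=
  {x | ∀ i ∈ J, cs.length x < cs.length (cs.simple i * x)}

/-- `x_J`, the sum in `ℚ W` of the elements of `X_J⁻¹` (for finite `W`). -/
noncomputable def xSum (J : Finset B) : MonoidAlgebra ℚ W :=
  ∑ᶠ w ∈ {w : W | w⁻¹ ∈ cs.minReps J}, MonoidAlgebra.of ℚ W w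

/-- The descent algebra `Σ(W)`, as the subalgebra of `ℚ W` generated by the elements `x_J`. (For
finite `W` it is the linear span of the `x_J`.) -/
noncomputable def descentAlgebra : Subalgebra ℚ (MonoidAlgebra ℚ W) :=
  Algebra.adjoin ℚ (Set.range cs.xSum)

/-- `x_J` as an element of the descent algebra. -/
noncomputable def x (J : Finset B) : cs.descentAlgebra :=
  ⟨cs.xSum J, Algebra.subset_adjoin (Set.mem_range_self J)⟩

/-- `X_J^♯ = {x ∈ X_J : J^x ⊆ S}`, where `J^x = x⁻¹ J x`. -/
def minRepsSharp (J : Finset B) : Set W :=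
  {x | x ∈ cs.minReps J ∧ ∀ i ∈ J, ∃ j, x⁻¹ * cs.simple i * x = cs.simple j}

open Classical in
/-- `w_J`, the longest element of the parabolic subgroup `W_J` (for finite `W_J`). -/
noncomputable def longestElement (J : Finset B) : W :=
  if h : ∃ w ∈ Subgroup.closure (cs.simple '' (J : Set B)),
      ∀ v ∈ Subgroup.closure (cs.simple '' (J : Set B)), cs.length v ≤ cs.length w
  then h.choose else 1

open Classical in
/-- `s ↦ s^d = d⁻¹ s d` for a simple reflection `s` such that `s^d` is a simple reflection. -/
noncomputable def conjSimple (d : W) (i : B) : B :=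
  if h : ∃ j, d⁻¹ * cs.simple i * d = cs.simple j then h.choose else i

variable [Fintype B]

open Classical in
/-- `J^d ∩ S`, which is `J^d` if `J^d ⊆ S`, where `J^d = d⁻¹ J d`. -/
noncomputable def conjSubset (d : W) (J : Finset B) : Finset B :=
  Finset.univ.filter fun j => ∃ i ∈ J, d⁻¹ * cs.simple i * d = cs.simple j

/-- The class `[J] = {J^x : x ∈ X_J^♯}`. -/
def parabolicClass (J : Finset B) : Set (Finset B) :=
  (fun x => cs.conjSubset x J) '' cs.minRepsSharp J

open Classical in
/-- The matrix `(m_{KL})`: `m_{KL} = |X_K ∩ X_L^♯|` if `L ⊆ K` and `0` otherwise. -/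
noncomputable def mMatrix : Matrix (Finset B) (Finset B) ℚ :=
  Matrix.of fun K L => if L ⊆ K then ((cs.minReps K ∩ cs.minRepsSharp L).ncard : ℚ) else 0

variable [DecidableEq B]

/-- The elements `e_L` of the descent algebra, determined by `x_K = ∑_L m_{KL} e_L`. -/
noncomputable def e (L : Finset B) : cs.descentAlgebra :=
  ∑ K : Finset B, (cs.mMatrix⁻¹) L K • cs.x K

open Classical in
/-- `e_λ = ∑_{L ∈ λ} e_L` for the class `λ = [J]`. -/
noncomputable def eClass (J : Finset B) : cs.descentAlgebra :=
  ∑ L ∈ Finset.univ.filter fun L => L ∈ cs.parabolicClass J, cs.e L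

/-- The action `(L; s, t, …).r = (L^d; s^d, t^d, …)`, where `d = w_L w_M` and
`M = L ∪ {r}`, of `r ∈ S` on the paths `(L; s, t, …)` of length `n` (the path
`L → L \ {s} → L \ {s, t} → …`). -/
noncomputable def pathAct {n : ℕ} (r : B) (p : Finset B × (Fin n → B)) :
    Finset B × (Fin n → B) :=
  let d := cs.longestElement p.1 * cs.longestElement (insert r p.1)
  (cs.conjSubset d p.1, fun k => cs.conjSimple d (p.2 k))

/-- The street `[L; s, t, …]`: the orbit of the path `(L; s, t, …)` under the free monoid on
`S`. -/
def street {n : ℕ} (p : Finset B × (Fin n → B)) : Set (Finset B × (Fin n → B)) :=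
  {q | Relation.ReflTransGen (fun a b => ∃ r : B, b = cs.pathAct r a) p q}

/-- `Δ(L; s, t, …)`, obtained by iterating the difference operator
`δ(L; s, t, …) = (L \ {s}; t, …) - (L \ {s}; t, …).s` down to paths of length `0`, which are
identified with elements of the descent algebra by `(L; ∅) ↦ e_L`. -/
noncomputable def Delta : (n : ℕ) → Finset B × (Fin n → B) → cs.descentAlgebra
  | 0, p => cs.e p.1
  | n + 1, p =>
    let q : Finset B × (Fin n → B) := (p.1.erase (p.2 0), Fin.tail p.2)
    Delta n q - Delta n (cs.pathAct (p.2 0) q)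

open Classical in
/-- `Δ[L; s, t, …]`, the street being read as the sum of the paths that it contains. -/
noncomputable def DeltaStreet {n : ℕ} (p : Finset B × (Fin n → B)) : cs.descentAlgebra :=
  ∑ q ∈ Finset.univ.filter fun q => q ∈ cs.street p, cs.Delta n q

/-- The left ideal `Σ(W) e_λ`, `λ = [J]`, as a left module over the descent algebra. -/
noncomputable abbrev projective (J : Finset B) : Submodule cs.descentAlgebra cs.descentAlgebra :=
  principalLeftIdeal (cs.eClass J)

/-- The head `Σ(W) e_λ / rad (Σ(W) e_λ)` of `Σ(W) e_λ`. -/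
abbrev simpleHead (J : Finset B) : Type _ :=
  ModuleHead cs.descentAlgebra (cs.projective J)

end CoxeterSystem

/-! ## The tables for type `H₄` -/

/-- The Coxeter matrix of type `H₄`, with diagram `0 -5- 1 -3- 2 -3- 3`. -/
abbrev coxeterH4 : CoxeterMatrix (Fin 4) := CoxeterMatrix.H₄.reindex Fin.revPerm

/-- The ten vertices of the quiver, in the order of the list. -/
inductive H4Vertex
  | empty | A1 | A11 | A2 | H2 | A21 | H21 | A3 | H3 | H4
  deriving DecidableEq

instance : Fintype H4Vertex where
  elems := {.empty, .A1, .A11, .A2, .H2, .A21, .H21, .A3, .H3, .H4}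
  complete v := by cases v <;> decide

namespace H4Vertex

/-- The subset of `S` that represents the class at a vertex (with `S` labelled `0, 1, 2, 3`). -/
def rep : H4Vertex → Finset (Fin 4)
  | empty => ∅
  | A1 => {0}
  | A11 => {0, 2}
  | A2 => {1, 2}
  | H2 => {0, 1}
  | A21 => {0, 2, 3}
  | H21 => {0, 1, 3}
  | A3 => {1, 2, 3}
  | H3 => {0, 1, 2}
  | H4 => Finset.univ

/-- The Coxeter diagram that names a vertex (`CoxeterMatrix.I 3` has a bond with label `5`). -/
def type : H4Vertex → Σ C : Type, CoxeterMatrix C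
  | empty => ⟨_, CoxeterMatrix.A 0⟩
  | A1 => ⟨_, CoxeterMatrix.A 1⟩
  | A11 => ⟨_, (CoxeterMatrix.A 1).disjointUnion (CoxeterMatrix.A 1)⟩
  | A2 => ⟨_, CoxeterMatrix.A 2⟩
  | H2 => ⟨_, CoxeterMatrix.I 3⟩
  | A21 => ⟨_, (CoxeterMatrix.A 2).disjointUnion (CoxeterMatrix.A 1)⟩
  | H21 => ⟨_, (CoxeterMatrix.I 3).disjointUnion (CoxeterMatrix.A 1)⟩
  | A3 => ⟨_, CoxeterMatrix.A 3⟩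
  | H3 => ⟨_, CoxeterMatrix.H₃⟩
  | H4 => ⟨_, CoxeterMatrix.H₄⟩

/-- The even vertices are those `λ = [J]` with `|J|` even. -/
def IsEven (v : H4Vertex) : Prop := Even v.rep.card

end H4Vertex

/-- The six edges of the quiver. -/
inductive H4Edge : H4Vertex → H4Vertex → Type
  | A11_H4_a : H4Edge .A11 .H4
  | A11_H4_b : H4Edge .A11 .H4
  | A2_H4 : H4Edge .A2 .H4
  | A1_A3 : H4Edge .A1 .A3
  | A1_H3_a : H4Edge .A1 .H3
  | A1_H3_b : H4Edge .A1 .H3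

instance : Quiver H4Vertex := ⟨H4Edge⟩

/-- The paths whose streets label the edges: `[S;23]`, `[S;31]`, `[S;12]`, `[234;23]`,
`[123;12]`, `[123;31]` if `S` is labelled `1, 2, 3, 4` instead of `0, 1, 2, 3`. -/
def H4Edge.path : {v w : H4Vertex} → H4Edge v w → Finset (Fin 4) × (Fin 2 → Fin 4)
  | _, _, A11_H4_a => (Finset.univ, ![1, 2])
  | _, _, A11_H4_b => (Finset.univ, ![2, 0])
  | _, _, A2_H4 => (Finset.univ, ![0, 1])
  | _, _, A1_A3 => ({1, 2, 3}, ![1, 2])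
  | _, _, A1_H3_a => ({0, 1, 2}, ![0, 1])
  | _, _, A1_H3_b => ({0, 1, 2}, ![2, 0])

/-- The Cartan matrix (row, column). -/
def H4cartan : H4Vertex → H4Vertex → ℕ
  | .A3, .A1 => 1
  | .H3, .A1 => 2
  | .H4, .A11 => 2
  | .H4, .A2 => 1
  | v, w => if v = w then 1 else 0

/-- The Loewy series of the projective at `v`: the multiplicity in the `n`-th layer (counted from
the head, `n = 0`) of the simple module at `w`. -/
def H4loewy : ℕ → H4Vertex → H4Vertex → ℕ
  | 0, v, w => if v = w then 1 else 0
  | 1, .A3, .A1 => 1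
  | 1, .H3, .A1 => 2
  | 1, .H4, .A11 => 2
  | 1, .H4, .A2 => 1
  | _, _, _ => 0

/-! The group acts faithfully on `ℤ[φ]⁴`, and lengths are governed by signs: `ℓ(ws) > ℓ(w)` exactly
if `w` maps the simple root of `s` to a positive vector (`length_lt_mul_simple_iff`). Coset
representatives, conjugation of simple reflections and longest elements thereby become statements
about the images of simple roots.

The Mackey decomposition of `X_J × X_K` (`sum_mackey`) gives Solomon's product formula. Applied to
the indicator of `M^y = N`, it also gives an identity between the numbers `c_J(M, P)` of `x ∈ X_J`
with `M^x = P`, where `M ⊆ J`. Since `(m_{KL})` is triangular with nonzero diagonal, this identity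
yields `e_P x_J = ∑_M c_J(M, P) e_M` (`e_mul_x`), so the descent algebra is known as soon as these
integers are.

The integers are counted. Walks along the chain `1 ⊂ H₂ ⊂ H₃ ⊂ H₄` visit each of the `10 · 12 · 120
= 14400` elements once. Of each element only its signature is recorded: which simple roots have
negative images, which have simple images and which ones. The multiplicities of the signatures
determine every `c_J(M, P)` (`count_eq`).

No two edges of the quiver can be composed, so the path algebra has dimension `10 + 6 = 16`, the
number of subsets of `S`; and the `x_J` are linearly independent. The linear map that sends vertices
to `e_λ` and edges to `Δ` of their streets is onto, because each `x_K` is an explicit combination of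
these generators (`coeff_xCombo`); hence it is bijective. It is multiplicative because the products
of generators with the `x_K`, computed by `e_mul_x`, agree with those in the path algebra
(`coeff_mul`).

The remaining statements hold in every algebra with a basis of orthogonal idempotents and arrows
without composition (`ArrowBasis`): the arrows span the radical, whose square is zero, and each
projective has a one-dimensional head and a semisimple radical. -/

/-! ## The reflection representation of a Coxeter group of type `H₄` over `ℤ[φ]` -/

/-- The ring `ℤ[φ]`, where `φ² = 1 + φ`. -/
abbrev GoldenInt := QuadraticAlgebra ℤ 1 1

namespace GoldenInt

/-- The numbers `a + b φ` with `a, b ≥ 0`. -/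
def Nonneg (x : GoldenInt) : Prop := 0 ≤ x.re ∧ 0 ≤ x.im

instance (x : GoldenInt) : Decidable x.Nonneg := inferInstanceAs (Decidable (_ ∧ _))

theorem nonneg_zero : Nonneg 0 := ⟨le_rfl, le_rfl⟩

theorem Nonneg.add {x y : GoldenInt} (hx : x.Nonneg) (hy : y.Nonneg) : (x + y).Nonneg :=
  ⟨add_nonneg hx.1 hy.1, add_nonneg hx.2 hy.2⟩

/-- Since `φ² = 1 + φ` has nonnegative coefficients, the cone is closed under products. It is
smaller than the set of nonnegative reals in `ℤ[φ]` and decidable by integers alone, yet it contains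
the coordinates of all positive roots of `H₄`. -/
theorem Nonneg.mul {x y : GoldenInt} (hx : x.Nonneg) (hy : y.Nonneg) : (x * y).Nonneg := by
  obtain ⟨hx1, hx2⟩ := hx
  obtain ⟨hy1, hy2⟩ := hy
  refine ⟨?_, ?_⟩
  · rw [QuadraticAlgebra.re_mul]; positivity
  · rw [QuadraticAlgebra.im_mul]; positivity

theorem Nonneg.sum {ι : Type*} {s : Finset ι} {f : ι → GoldenInt}
    (h : ∀ i ∈ s, (f i).Nonneg) : (∑ i ∈ s, f i).Nonneg :=
  Finset.sum_induction f Nonneg (fun _ _ => Nonneg.add) nonneg_zero h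

theorem Nonneg.eq_zero {x : GoldenInt} (hx : x.Nonneg) (hx' : (-x).Nonneg) : x = 0 := by
  obtain ⟨h1, h2⟩ := hx
  obtain ⟨h3, h4⟩ := hx'
  rw [QuadraticAlgebra.re_neg] at h3
  rw [QuadraticAlgebra.im_neg] at h4
  ext
  · rw [QuadraticAlgebra.re_zero]; omega
  · rw [QuadraticAlgebra.im_zero]; omega

theorem Nonneg.eq_zero_of_sum {ι : Type*} {s : Finset ι} {f : ι → GoldenInt}
    (h : ∀ i ∈ s, (f i).Nonneg) (h0 : ∑ i ∈ s, f i = 0) {i : ι} (hi : i ∈ s) : f i = 0 := by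
  classical
  refine (h i hi).eq_zero ?_
  rw [← Finset.add_sum_erase s f hi] at h0
  rw [neg_eq_of_add_eq_zero_right h0]
  exact Nonneg.sum fun j hj => h j (Finset.mem_of_mem_erase hj)

/-- The cone contains the unit `φ` but not its inverse `φ - 1`. This is what forces a root that is a
positive multiple of a simple root to be that simple root. -/
theorem Nonneg.eq_one_of_mul_eq_one {x y : GoldenInt} (hx : x.Nonneg) (hy : y.Nonneg)
    (h : x * y = 1) : x = 1 := by
  obtain ⟨a, b⟩ := x
  obtain ⟨c, d⟩ := y
  obtain ⟨hx1, hx2⟩ := hx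
  obtain ⟨hy1, hy2⟩ := hy
  have h1 := congrArg QuadraticAlgebra.re h
  have h2 := congrArg QuadraticAlgebra.im h
  simp only [QuadraticAlgebra.re_mul, QuadraticAlgebra.im_mul, one_mul] at h1 h2 hx1 hx2 hy1 hy2
  change a * c + b * d = 1 at h1
  change a * d + b * c + b * d = 0 at h2
  have hbd : b * d = 0 := by nlinarith [mul_nonneg hx1 hy2, mul_nonneg hx2 hy1, mul_nonneg hx2 hy2]
  have hac : a * c = 1 := by linarith
  have ha : a = 1 := Int.eq_one_of_mul_eq_one_right hx1 hac
  have hc : c = 1 := Int.eq_one_of_mul_eq_one_left hy1 hac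
  subst ha hc
  have hb : b = 0 := by nlinarith
  subst hb
  rfl

theorem Nonneg.eq_zero_or_of_mul {x y : GoldenInt} (hx : x.Nonneg) (hy : y.Nonneg)
    (h : x * y = 0) : x = 0 ∨ y = 0 := by
  obtain ⟨a, b⟩ := x
  obtain ⟨c, d⟩ := y
  obtain ⟨hx1, hx2⟩ := hx
  obtain ⟨hy1, hy2⟩ := hy
  have h1 := congrArg QuadraticAlgebra.re h
  have h2 := congrArg QuadraticAlgebra.im h
  simp only [QuadraticAlgebra.re_mul, QuadraticAlgebra.im_mul, one_mul,
    QuadraticAlgebra.re_zero, QuadraticAlgebra.im_zero] at h1 h2 hx1 hx2 hy1 hy2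
  have hac : a * c = 0 := by nlinarith [mul_nonneg hx1 hy1, mul_nonneg hx2 hy2]
  have hbd : b * d = 0 := by nlinarith [mul_nonneg hx1 hy1, mul_nonneg hx2 hy2]
  have had : a * d = 0 := by nlinarith [mul_nonneg hx1 hy2, mul_nonneg hx2 hy1]
  have hbc : b * c = 0 := by nlinarith [mul_nonneg hx1 hy2, mul_nonneg hx2 hy1]
  by_cases ha : a = 0
  · by_cases hb : b = 0
    · left; subst ha hb; rfl
    · right
      rw [(mul_eq_zero.1 hbc).resolve_left hb, (mul_eq_zero.1 hbd).resolve_left hb]; rfl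
  · right
    rw [(mul_eq_zero.1 hac).resolve_left ha, (mul_eq_zero.1 had).resolve_left ha]; rfl

end GoldenInt

namespace TypeH4

open Matrix

/-- The root space, with the simple roots as standard basis. -/
abbrev RootSpace := Fin 4 → GoldenInt

/-- A vector is positive if its coordinates are. -/
def Pos (v : RootSpace) : Prop := ∀ j, (v j).Nonneg

instance (v : RootSpace) : Decidable (Pos v) := inferInstanceAs (Decidable (∀ _, _))

/-- The simple roots. -/
def simpleRoot (i : Fin 4) : RootSpace := Pi.single i 1

/-- The Gram matrix of the simple roots (twice the standard bilinear form). -/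
def gram : Matrix (Fin 4) (Fin 4) GoldenInt :=
  !![2, -⟨0, 1⟩, 0, 0; -⟨0, 1⟩, 2, -1, 0; 0, -1, 2, -1; 0, 0, -1, 2]

/-- The matrix of a simple reflection. -/
def reflMatrix (i : Fin 4) : Matrix (Fin 4) (Fin 4) GoldenInt :=
  Matrix.of fun j k => (1 : Matrix (Fin 4) (Fin 4) GoldenInt) j k - if j = i then gram i k else 0

theorem reflMatrix_isLiftable : coxeterH4.IsLiftable reflMatrix := by
  unfold CoxeterMatrix.IsLiftable
  decide +kernel

theorem reflMatrix_gram (i : Fin 4) : (reflMatrix i)ᵀ * gram * reflMatrix i = gram := by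
  revert i
  decide +kernel

/-- The product of an alternating word in two generators applied to a simple root is a
nonnegative combination of the two simple roots, if the word is short enough. -/
theorem pos_alternating : ∀ s t : Fin 4, s ≠ t → ∀ k : Fin 5, (k : ℕ) < coxeterH4 s t → ∀ j,
    ((((CoxeterSystem.alternatingWord s t k).map reflMatrix).prod) j s).Nonneg ∧
    (j ≠ s → j ≠ t →
      (((CoxeterSystem.alternatingWord s t k).map reflMatrix).prod) j s = 0) := by
  decide +kernel

end TypeH4

theorem GoldenInt.eq_zero_of_neg_eq {x : GoldenInt} (h : x = -x) : x = 0 := by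
  have h1 := congrArg QuadraticAlgebra.re h
  have h2 := congrArg QuadraticAlgebra.im h
  rw [QuadraticAlgebra.re_neg] at h1
  rw [QuadraticAlgebra.im_neg] at h2
  ext
  · rw [QuadraticAlgebra.re_zero]; omega
  · rw [QuadraticAlgebra.im_zero]; omega

theorem GoldenInt.eq_one_of_mul_two {x : GoldenInt} (h : x * 2 = 2) : x = 1 := by
  rw [mul_two, ← one_add_one_eq_two] at h
  have h1 := congrArg QuadraticAlgebra.re h
  have h2 := congrArg QuadraticAlgebra.im h
  rw [QuadraticAlgebra.re_add, QuadraticAlgebra.re_add] at h1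
  rw [QuadraticAlgebra.im_add, QuadraticAlgebra.im_add] at h2
  ext <;> omega

/-! ### Lengths and signs of roots -/

namespace TypeH4

open Matrix GoldenInt

theorem Pos.smul {a : GoldenInt} {v : RootSpace} (ha : a.Nonneg) (hv : Pos v) : Pos (a • v) :=
  fun j => ha.mul (hv j)

theorem Pos.sum {ι : Type*} {s : Finset ι} {f : ι → RootSpace} (h : ∀ i ∈ s, Pos (f i)) :
    Pos (∑ i ∈ s, f i) :=
  fun j => by
    rw [Finset.sum_apply]
    exact Nonneg.sum fun i hi => h i hi j

theorem Pos.eq_zero {v : RootSpace} (hv : Pos v) (hv' : Pos (-v)) : v = 0 :=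
  funext fun j => (hv j).eq_zero (hv' j)

theorem pos_simpleRoot (i : Fin 4) : Pos (simpleRoot i) := by
  revert i
  decide

theorem simpleRoot_ne_zero (i : Fin 4) : simpleRoot i ≠ 0 := by
  revert i
  decide

theorem not_pos_neg_simpleRoot (i : Fin 4) : ¬ Pos (-simpleRoot i) :=
  fun h => simpleRoot_ne_zero i ((pos_simpleRoot i).eq_zero h)

theorem simpleRoot_injective : Function.Injective simpleRoot := by
  unfold Function.Injective
  decide

theorem sum_smul_simpleRoot (v : RootSpace) : ∑ i, v i • simpleRoot i = v := by
  ext1 j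
  simp [simpleRoot, Finset.sum_apply, Pi.single_apply]

variable {W : Type*} [Group W] (cs : CoxeterSystem coxeterH4 W)

/-- The reflection representation. -/
def rep : W →* Matrix (Fin 4) (Fin 4) GoldenInt :=
  cs.lift ⟨reflMatrix, reflMatrix_isLiftable⟩

theorem rep_simple (i : Fin 4) : rep cs (cs.simple i) = reflMatrix i :=
  cs.lift_apply_simple reflMatrix_isLiftable i

/-- The action of the group on the root space. -/
def act (w : W) (v : RootSpace) : RootSpace := rep cs w *ᵥ v

@[simp] theorem act_one (v : RootSpace) : act cs 1 v = v := by simp [act]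

theorem act_mul (w w' : W) (v : RootSpace) : act cs (w * w') v = act cs w (act cs w' v) := by
  simp [act]

@[simp] theorem act_inv_act (w : W) (v : RootSpace) : act cs w⁻¹ (act cs w v) = v := by
  rw [← act_mul, inv_mul_cancel, act_one]

@[simp] theorem act_act_inv (w : W) (v : RootSpace) : act cs w (act cs w⁻¹ v) = v := by
  rw [← act_mul, mul_inv_cancel, act_one]

theorem act_injective (w : W) : Function.Injective (act cs w) :=
  Function.LeftInverse.injective (act_inv_act cs w)

theorem act_add (w : W) (v v' : RootSpace) : act cs w (v + v') = act cs w v + act cs w v' :=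
  Matrix.mulVec_add _ _ _

theorem act_neg (w : W) (v : RootSpace) : act cs w (-v) = -act cs w v :=
  Matrix.mulVec_neg _ _

theorem act_smul (w : W) (a : GoldenInt) (v : RootSpace) : act cs w (a • v) = a • act cs w v :=
  Matrix.mulVec_smul _ _ _

theorem act_sum {ι : Type*} (s : Finset ι) (w : W) (f : ι → RootSpace) :
    act cs w (∑ i ∈ s, f i) = ∑ i ∈ s, act cs w (f i) :=
  Matrix.mulVec_sum _ _ _

theorem act_eq_sum (w : W) (v : RootSpace) :
    act cs w v = ∑ i, v i • act cs w (simpleRoot i) := by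
  conv_lhs => rw [← sum_smul_simpleRoot v]
  simp only [act_sum, act_smul]

theorem act_simpleRoot_apply (w : W) (i j : Fin 4) : act cs w (simpleRoot i) j = rep cs w j i := by
  simp [act, simpleRoot]

theorem act_simple_apply (i : Fin 4) (v : RootSpace) (j : Fin 4) :
    act cs (cs.simple i) v j = v j - if j = i then (gram *ᵥ v) i else 0 := by
  unfold act
  rw [rep_simple]
  simp only [Matrix.mulVec, dotProduct, reflMatrix, Matrix.of_apply, sub_mul,
    Finset.sum_sub_distrib]
  congr 1
  · simp [Matrix.one_apply]
  · split_ifs <;> simp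

theorem act_simple (i : Fin 4) (v : RootSpace) :
    act cs (cs.simple i) v = v - (gram *ᵥ v) i • simpleRoot i := by
  ext1 j
  rw [act_simple_apply]
  simp [simpleRoot, Pi.single_apply]

theorem act_simple_of_ne {i j : Fin 4} (h : j ≠ i) (v : RootSpace) :
    act cs (cs.simple i) v j = v j := by
  rw [act_simple_apply, if_neg h, sub_zero]

theorem act_simple_simpleRoot (i : Fin 4) :
    act cs (cs.simple i) (simpleRoot i) = -simpleRoot i := by
  unfold act
  rw [rep_simple]
  revert i
  decide +kernel

theorem coxeterH4_bounds (s t : Fin 4) : 0 < coxeterH4 s t ∧ coxeterH4 s t ≤ 5 := by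
  have h : ∀ s t : Fin 4, Nat.ble 1 (coxeterH4 s t) && Nat.ble (coxeterH4 s t) 5 := by
    decide +kernel
  simpa [Nat.succ_le_iff] using h s t

theorem coxeterH4_ne_zero (s t : Fin 4) : coxeterH4 s t ≠ 0 :=
  (coxeterH4_bounds s t).1.ne'

theorem act_alternating {s t : Fin 4} (h : s ≠ t) {k : ℕ} (hk : k < coxeterH4 s t) (j : Fin 4) :
    (act cs (cs.wordProd (CoxeterSystem.alternatingWord s t k)) (simpleRoot s) j).Nonneg ∧
    (j ≠ s → j ≠ t →
      act cs (cs.wordProd (CoxeterSystem.alternatingWord s t k)) (simpleRoot s) j = 0) := by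
  have hk5 : k < 5 := by
    refine hk.trans_le ?_
    exact (coxeterH4_bounds s t).2
  have e : rep cs (cs.wordProd (CoxeterSystem.alternatingWord s t k)) =
      ((CoxeterSystem.alternatingWord s t k).map reflMatrix).prod := by
    rw [CoxeterSystem.wordProd, map_list_prod, List.map_map]
    congr 1
    exact List.map_congr_left fun i _ => rep_simple cs i
  rw [act_simpleRoot_apply, e]
  exact pos_alternating s t h ⟨k, hk5⟩ hk j

/-- An element maps a simple root to a positive root if the simple reflection is not a right
descent. -/
theorem pos_act_of_length_lt : ∀ (n : ℕ) (w : W), cs.length w = n → ∀ s : Fin 4,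
    cs.length w < cs.length (w * cs.simple s) → Pos (act cs w (simpleRoot s)) := by
  intro n
  induction n using Nat.strong_induction_on with
  | _ n ih =>
    intro w hw s hs
    by_cases h1 : w = 1
    · rw [h1, act_one]; exact pos_simpleRoot s
    obtain ⟨t, ht⟩ := cs.exists_rightDescent_of_ne_one h1
    have hst : s ≠ t := by
      rintro rfl
      exact absurd ht (not_lt.2 hs.le)
    -- Splits off from `w` on the right an alternating word of length `k` that ends in `t`, with
    -- lengths adding. A `k ≥ 1` with `P k` but not `P (k + 1)` leaves a left factor `u` with
    -- neither `s` nor `t` as a right descent.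
    let P : ℕ → Prop := fun k => ∃ u, w = u * cs.wordProd (CoxeterSystem.alternatingWord s t k) ∧
      cs.length w = cs.length u + k
    have hP1 : P 1 := by
      refine ⟨w * cs.simple t, ?_, ?_⟩
      · simp [CoxeterSystem.alternatingWord]
      · exact ((cs.isRightDescent_iff).1 ht).symm
    -- For `k = m(s, t)` the braid relation rewrites the word so that it ends in `s`; then `s` would
    -- be a right descent of `w`.
    have hPm : ¬ P (coxeterH4 s t) := by
      rintro ⟨u, hu, hl⟩
      have hb := cs.wordProd_braidWord_eq s t
      rw [CoxeterSystem.braidWord, CoxeterSystem.braidWord, coxeterH4.symmetric t s] at hb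
      rw [hb] at hu
      obtain ⟨m, hm⟩ := Nat.exists_eq_succ_of_ne_zero (coxeterH4_ne_zero s t)
      rw [hm] at hu hl
      rw [CoxeterSystem.alternatingWord_succ, cs.wordProd_concat, ← mul_assoc] at hu
      have h2 : w * cs.simple s = u * cs.wordProd (CoxeterSystem.alternatingWord s t m) := by
        rw [hu, mul_assoc, cs.simple_mul_simple_self, mul_one]
      have h3 := cs.length_mul_le u (cs.wordProd (CoxeterSystem.alternatingWord s t m))
      have h4 := cs.length_wordProd_le (CoxeterSystem.alternatingWord s t m)
      rw [CoxeterSystem.length_alternatingWord] at h4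
      rw [← h2] at h3
      omega
    obtain ⟨k, hk1, hkm, hPk, hPk'⟩ : ∃ k, 1 ≤ k ∧ k < coxeterH4 s t ∧ P k ∧ ¬ P (k + 1) := by
      by_contra! hc
      have : ∀ k, 1 ≤ k → k ≤ coxeterH4 s t → P k := by
        intro k hk
        induction k, hk using Nat.le_induction with
        | base => exact fun _ => hP1
        | succ k hk ih' => exact fun h => hc k hk (by omega) (ih' (by omega))
      exact hPm (this _ (Nat.one_le_iff_ne_zero.2 (coxeterH4_ne_zero s t)) le_rfl)
    obtain ⟨u, hu, hl⟩ := hPk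
    -- A descent of `u` at the letter that prolongs the word to the left would give `P (k + 1)`.
    have key : ∀ a b : Fin 4, CoxeterSystem.alternatingWord s t (k + 1) =
        a :: CoxeterSystem.alternatingWord s t k → 
        cs.length u < cs.length (u * cs.simple a) := by
      intro a b h
      by_contra hc
      have hd := (cs.length_mul_simple u a).resolve_left (by omega)
      refine hPk' ⟨u * cs.simple a, ?_, by omega⟩
      rw [h, cs.wordProd_cons, ← mul_assoc, cs.simple_mul_simple_cancel_right, hu]
    -- A descent of `u` at the first letter of the word would cancel against it and make `w` too
    -- short.
    have key' : ∀ a : Fin 4, (∃ l, CoxeterSystem.alternatingWord s t k = a :: l) → 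
        cs.length u < cs.length (u * cs.simple a) := by
      rintro a ⟨l, h⟩
      by_contra hc
      have hd := (cs.length_mul_simple u a).resolve_left (by omega)
      have h2 : w = (u * cs.simple a) * cs.wordProd l := by
        rw [hu, h, cs.wordProd_cons, mul_assoc]
      have h3 := cs.length_mul_le (u * cs.simple a) (cs.wordProd l)
      have h4 := cs.length_wordProd_le l
      have h5 := CoxeterSystem.length_alternatingWord s t k
      rw [h, List.length_cons] at h5
      rw [← h2] at h3
      omega
    have hboth : cs.length u < cs.length (u * cs.simple s) ∧
        cs.length u < cs.length (u * cs.simple t) := by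
      obtain ⟨m, rfl⟩ : ∃ m, k = m + 1 := ⟨k - 1, by omega⟩
      have e1 := CoxeterSystem.alternatingWord_succ' s t (m + 1)
      have e2 := CoxeterSystem.alternatingWord_succ' s t m
      by_cases hm : Even m
      · rw [if_neg (by simpa using Nat.even_add_one.not.2 (not_not.2 hm))] at e1
        rw [if_pos hm] at e2
        exact ⟨key s s e1, key' t ⟨_, e2⟩⟩
      · rw [if_pos (Nat.even_add_one.2 hm)] at e1
        rw [if_neg hm] at e2
        exact ⟨key' s ⟨_, e2⟩, key t t e1⟩
    have hus := ih (cs.length u) (by omega) u rfl s hboth.1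
    have hut := ih (cs.length u) (by omega) u rfl t hboth.2
    -- For `k < m(s, t)` the word maps the simple root of `s` to a nonnegative combination of the
    -- two simple roots, and `u` maps both of these to positive vectors by induction.
    have halt := act_alternating cs hst hkm
    rw [hu, act_mul, act_eq_sum cs u]
    refine Pos.sum fun j _ => ?_
    by_cases hjs : j = s
    · subst hjs; exact Pos.smul (halt _).1 hus
    by_cases hjt : j = t
    · subst hjt; exact Pos.smul (halt _).1 hut
    rw [(halt j).2 hjs hjt, zero_smul]
    exact fun _ => nonneg_zero

theorem act_mul_simple_simpleRoot (w : W) (i : Fin 4) :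
    act cs (w * cs.simple i) (simpleRoot i) = -act cs w (simpleRoot i) := by
  rw [act_mul, act_simple_simpleRoot, act_neg]

theorem act_simpleRoot_ne_zero (w : W) (i : Fin 4) : act cs w (simpleRoot i) ≠ 0 := by
  intro h
  have := act_inv_act cs w (simpleRoot i)
  rw [h] at this
  exact simpleRoot_ne_zero i (by rw [← this]; simp [act])

/-- The elements `w` and `w s_i` map the simple root to opposite nonzero vectors, and just one of
them is the longer one. Hence the implication already proved, applied to both, becomes an
equivalence. -/
theorem length_lt_mul_simple_iff (w : W) (i : Fin 4) :
    cs.length w < cs.length (w * cs.simple i) ↔ Pos (act cs w (simpleRoot i)) := by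
  refine ⟨pos_act_of_length_lt cs _ w rfl i, fun h => ?_⟩
  by_contra hc
  have hd := (cs.length_mul_simple w i).resolve_left (by omega)
  have h2 := pos_act_of_length_lt cs _ (w * cs.simple i) rfl i (by
    rw [cs.simple_mul_simple_cancel_right]; omega)
  rw [act_mul_simple_simpleRoot] at h2
  exact act_simpleRoot_ne_zero cs w i (h.eq_zero h2)

/-- Every root is positive or negative. -/
theorem pos_or_neg (w : W) (i : Fin 4) :
    Pos (act cs w (simpleRoot i)) ∨ Pos (-act cs w (simpleRoot i)) := by
  rw [← act_mul_simple_simpleRoot, ← length_lt_mul_simple_iff, ← length_lt_mul_simple_iff,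
    cs.simple_mul_simple_cancel_right]
  exact lt_or_gt_of_ne (cs.length_mul_simple_ne w i).symm

theorem mul_simple_length_lt_iff (w : W) (i : Fin 4) :
    cs.length (w * cs.simple i) < cs.length w ↔ Pos (-act cs w (simpleRoot i)) := by
  rw [← act_mul_simple_simpleRoot, ← length_lt_mul_simple_iff, 
    cs.simple_mul_simple_cancel_right]

theorem length_lt_simple_mul_iff (w : W) (i : Fin 4) :
    cs.length w < cs.length (cs.simple i * w) ↔ Pos (act cs w⁻¹ (simpleRoot i)) := by
  rw [← length_lt_mul_simple_iff, cs.length_inv, ← cs.length_inv (cs.simple i * w), _root_.mul_inv_rev,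
    cs.inv_simple]

theorem mem_minReps_iff (J : Finset (Fin 4)) (x : W) :
    x ∈ cs.minReps J ↔ ∀ i ∈ J, Pos (act cs x⁻¹ (simpleRoot i)) := by
  simp only [CoxeterSystem.minReps, Set.mem_ofPred_eq, length_lt_simple_mul_iff]

/-- A nontrivial element has a right descent, hence a simple root whose image is not positive.
Faithfulness of the representation follows, and identities in the group are proved through it. -/
theorem eq_one_of_pos {w : W} (h : ∀ i, Pos (act cs w (simpleRoot i))) : w = 1 := by
  by_contra hw
  obtain ⟨i, hi⟩ := cs.exists_rightDescent_of_ne_one hw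
  exact absurd ((length_lt_mul_simple_iff cs w i).2 (h i)) (not_lt.2 hi.le)

theorem eq_of_act_eq {w w' : W} (h : ∀ i, act cs w (simpleRoot i) = act cs w' (simpleRoot i)) :
    w = w' := by
  rw [← inv_mul_eq_one]
  refine eq_one_of_pos cs fun i => ?_
  rw [act_mul, ← h, act_inv_act]
  exact pos_simpleRoot i

theorem rep_gram (w : W) : (rep cs w)ᵀ * gram * rep cs w = gram := by
  induction w using cs.simple_induction_left with
  | one => simp
  | mul_simple_left w i hw =>
    rw [map_mul, rep_simple, Matrix.transpose_mul]
    calc _ = (rep cs w)ᵀ * ((reflMatrix i)ᵀ * gram * reflMatrix i) * rep cs w := by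
          simp only [Matrix.mul_assoc]
      _ = _ := by rw [reflMatrix_gram, hw]

theorem dotProduct_gram_act (w : W) (u v : RootSpace) :
    act cs w u ⬝ᵥ gram *ᵥ act cs w v = u ⬝ᵥ gram *ᵥ v := by
  conv_rhs => rw [← rep_gram cs w, ← Matrix.mulVec_mulVec, ← Matrix.mulVec_mulVec,
    Matrix.dotProduct_mulVec u, Matrix.vecMul_transpose]
  rfl

/-- If `w` maps a simple root to a simple root, then it conjugates the simple reflections. -/
theorem mul_simple_eq_of_act_eq {w : W} {i j : Fin 4}
    (h : act cs w (simpleRoot i) = simpleRoot j) : w * cs.simple i = cs.simple j * w := by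
  refine eq_of_act_eq cs fun k => ?_
  have e : ∀ (v : RootSpace) (l : Fin 4), (gram *ᵥ v) l = simpleRoot l ⬝ᵥ gram *ᵥ v := by
    intro v l
    simp [simpleRoot]
  rw [act_mul, act_mul, act_simple, act_simple, sub_eq_add_neg, sub_eq_add_neg, act_add, act_neg,
    act_smul, h, e, e, ← h, dotProduct_gram_act]

/-- Conjugation of simple reflections in terms of roots. -/
theorem inv_mul_simple_mul_eq_iff {w : W} {i j : Fin 4} :
    w⁻¹ * cs.simple i * w = cs.simple j ↔
      act cs w⁻¹ (simpleRoot i) = simpleRoot j ∨ act cs w⁻¹ (simpleRoot i) = -simpleRoot j := by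
  constructor
  · intro h
    have h2 : w⁻¹ * cs.simple i = cs.simple j * w⁻¹ := by rw [← h, mul_assoc, mul_assoc]; simp
    -- The image `v` of the root satisfies `s_j v = -v`. As `s_j` changes only the `j`-th
    -- coordinate, all others vanish.
    have h3 := congrArg (fun x => act cs x (simpleRoot i)) h2
    simp only [act_mul, act_simple_simpleRoot, act_neg] at h3
    rw [act_simple] at h3
    set v := act cs w⁻¹ (simpleRoot i) with hv
    have h4 : ∀ l, l ≠ j → v l = 0 := by
      intro l hl
      have h5 := congrFun h3 l
      simp only [Pi.neg_apply, Pi.sub_apply, Pi.smul_apply, simpleRoot, Pi.single_eq_of_ne hl,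
        smul_zero, sub_zero] at h5
      exact GoldenInt.eq_zero_of_neg_eq h5.symm
    have h6 : v = v j • simpleRoot j := by
      conv_lhs => rw [← sum_smul_simpleRoot v]
      refine Finset.sum_eq_single j (fun l _ hl => ?_) (fun h => absurd (Finset.mem_univ j) h)
      rw [h4 l hl, zero_smul]
    -- The invariant form gives all simple roots the same norm 2.
    have h7 : v j * v j = 1 := by
      have h8 : ∀ l, simpleRoot l ⬝ᵥ gram *ᵥ simpleRoot l = 2 := by decide +kernel
      have h9 := dotProduct_gram_act cs w⁻¹ (simpleRoot i) (simpleRoot i)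
      rw [← hv, h6, Matrix.mulVec_smul, smul_dotProduct, dotProduct_smul, h8, h8, smul_eq_mul,
        smul_eq_mul, ← mul_assoc] at h9
      exact GoldenInt.eq_one_of_mul_two h9
    rcases pos_or_neg cs w⁻¹ i with hp | hp
    · left
      have h10 : v j = 1 := Nonneg.eq_one_of_mul_eq_one (hp j) (hp j) h7
      rw [h6, h10, one_smul]
    · right
      have h10 : -v j = 1 :=
        Nonneg.eq_one_of_mul_eq_one (hp j) (hp j) (by simpa using h7)
      rw [h6, ← neg_smul_neg, h10, one_smul]
  · rintro (h | h)
    · rw [mul_simple_eq_of_act_eq cs h, inv_mul_cancel_right]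
    · have h2 : act cs (cs.simple j * w⁻¹) (simpleRoot i) = simpleRoot j := by
        rw [act_mul, h, act_neg, act_simple_simpleRoot, neg_neg]
      have h3 := mul_simple_eq_of_act_eq cs h2
      rw [mul_assoc] at h3
      rw [mul_left_cancel h3, inv_mul_cancel_right]

end TypeH4

/-! ## Parabolic subgroups and the Mackey formula -/

namespace TypeH4

open Matrix GoldenInt

variable {W : Type*} [Group W] (cs : CoxeterSystem coxeterH4 W)

/-- The parabolic subgroup `W_K`. -/
abbrev par (K : Finset (Fin 4)) : Subgroup W :=
  Subgroup.closure (cs.simple '' (K : Set (Fin 4)))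

/-- A vector is supported on `K` if its coordinates outside `K` vanish. -/
def SuppIn (K : Finset (Fin 4)) (v : RootSpace) : Prop := ∀ j, j ∉ K → v j = 0

instance (K : Finset (Fin 4)) (v : RootSpace) : Decidable (SuppIn K v) :=
  inferInstanceAs (Decidable (∀ _, _))

theorem simple_mem_par {K : Finset (Fin 4)} {i : Fin 4} (h : i ∈ K) : cs.simple i ∈ par cs K :=
  Subgroup.subset_closure ⟨i, h, rfl⟩

theorem act_apply_of_mem_par {K : Finset (Fin 4)} {t : W} (ht : t ∈ par cs K) {j : Fin 4}
    (hj : j ∉ K) (v : RootSpace) : act cs t v j = v j := by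
  induction ht using Subgroup.closure_induction generalizing v with
  | mem x hx =>
    obtain ⟨i, hi, rfl⟩ := hx
    exact act_simple_of_ne cs (by rintro rfl; exact hj hi) v
  | one => rw [act_one]
  | mul x y _ _ hx hy => rw [act_mul, hx, hy]
  | inv x _ hx => rw [← hx (act cs x⁻¹ v), act_act_inv]

theorem suppIn_act_iff {K : Finset (Fin 4)} {t : W} (ht : t ∈ par cs K) (v : RootSpace) :
    SuppIn K (act cs t v) ↔ SuppIn K v :=
  forall₂_congr fun j hj => by rw [act_apply_of_mem_par cs ht hj]

theorem suppIn_simpleRoot {K : Finset (Fin 4)} {i : Fin 4} (h : i ∈ K) :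
    SuppIn K (simpleRoot i) :=
  fun j hj => Pi.single_eq_of_ne (by rintro rfl; exact hj h) _

theorem SuppIn.neg {K : Finset (Fin 4)} {v : RootSpace} (h : SuppIn K v) : SuppIn K (-v) :=
  fun j hj => by rw [Pi.neg_apply, h j hj, neg_zero]

/-- Elements of `W_K` preserve the sign of a root that is not supported on `K`. -/
theorem pos_act_of_mem_par {K : Finset (Fin 4)} {t : W} (ht : t ∈ par cs K) {w : W} {i : Fin 4}
    (hs : ¬ SuppIn K (act cs w (simpleRoot i))) :
    Pos (act cs t (act cs w (simpleRoot i))) ↔ Pos (act cs w (simpleRoot i)) := by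
  simp only [SuppIn, not_forall] at hs
  obtain ⟨j, hj, h0⟩ := hs
  have e := act_apply_of_mem_par cs ht hj (act cs w (simpleRoot i))
  constructor
  · intro h
    refine (pos_or_neg cs w i).resolve_right fun h' => h0 ?_
    exact Nonneg.eq_zero (e ▸ h j) (h' j)
  · intro h
    rw [← act_mul] at e ⊢
    refine (pos_or_neg cs (t * w) i).resolve_right fun h' => h0 ?_
    refine Nonneg.eq_zero (h j) ?_
    rw [← e]
    exact h' j

/-- Minimal coset representatives preserve positivity of vectors supported on `K`. -/
theorem pos_act_inv_of_mem_minReps {K : Finset (Fin 4)} {x : W} (hx : x ∈ cs.minReps K)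
    {v : RootSpace} (hv : Pos v) (hs : SuppIn K v) : Pos (act cs x⁻¹ v) := by
  rw [act_eq_sum]
  refine Pos.sum fun i _ => ?_
  by_cases hi : i ∈ K
  · exact Pos.smul (hv i) ((mem_minReps_iff cs K x).1 hx i hi)
  · rw [hs i hi, zero_smul]; exact fun _ => nonneg_zero

theorem pos_act_inv_iff_of_mem_minReps {K : Finset (Fin 4)} {x : W} (hx : x ∈ cs.minReps K)
    {w : W} {i : Fin 4} (hs : SuppIn K (act cs w (simpleRoot i))) :
    Pos (act cs x⁻¹ (act cs w (simpleRoot i))) ↔ Pos (act cs w (simpleRoot i)) := by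
  refine ⟨fun h => (pos_or_neg cs w i).resolve_right fun h' => ?_,
    fun h => pos_act_inv_of_mem_minReps cs hx h hs⟩
  have h2 := pos_act_inv_of_mem_minReps cs hx h' hs.neg
  rw [act_neg] at h2
  rw [← act_mul] at h h2
  exact act_simpleRoot_ne_zero cs _ _ (h.eq_zero h2)

/-- Left descents in `K` are stripped off until none is left. -/
theorem exists_mul_mem_minReps (K : Finset (Fin 4)) (w : W) :
    ∃ t ∈ par cs K, ∃ v ∈ cs.minReps K, w = t * v := by
  induction h : cs.length w using Nat.strong_induction_on generalizing w with
  | _ n ih =>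
    by_cases hw : w ∈ cs.minReps K
    · exact ⟨1, one_mem _, w, hw, (one_mul w).symm⟩
    · simp only [CoxeterSystem.minReps, Set.mem_ofPred_eq, not_forall, not_lt] at hw
      obtain ⟨i, hi, hl⟩ := hw
      have hl' := lt_of_le_of_ne hl (cs.length_simple_mul_ne w i)
      obtain ⟨t, ht, v, hv, e⟩ := ih _ (h ▸ hl') (cs.simple i * w) rfl
      refine ⟨cs.simple i * t, mul_mem (simple_mem_par cs hi) ht, v, hv, ?_⟩
      rw [mul_assoc, ← e, cs.simple_mul_simple_cancel_left]

/-- No simple root becomes negative under `t⁻¹`: for `i ∈ K` because both `v` and `t v` are in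
`X_K`, for `i ∉ K` because `W_K` does not change the `i`-th coordinate. Uniqueness in `W = W_K X_K`
rests on this. -/
theorem eq_one_of_mul_mem_minReps {K : Finset (Fin 4)} {t v : W} (ht : t ∈ par cs K)
    (hv : v ∈ cs.minReps K) (h : t * v ∈ cs.minReps K) : t = 1 := by
  rw [← inv_eq_one]
  refine eq_one_of_pos cs fun i => ?_
  by_cases hi : i ∈ K
  · have h1 := (mem_minReps_iff cs K _).1 h i hi
    rw [_root_.mul_inv_rev, act_mul] at h1
    refine (pos_act_inv_iff_of_mem_minReps cs hv ?_).1 h1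
    exact (suppIn_act_iff cs (inv_mem ht) _).2 (suppIn_simpleRoot hi)
  · refine (pos_or_neg cs t⁻¹ i).resolve_right fun h' => ?_
    have h2 := h' i
    rw [Pi.neg_apply, act_apply_of_mem_par cs (inv_mem ht) hi] at h2
    clear h' hi
    revert i
    decide

theorem mul_minReps_unique {K : Finset (Fin 4)} {t t' v v' : W} (ht : t ∈ par cs K)
    (ht' : t' ∈ par cs K) (hv : v ∈ cs.minReps K) (hv' : v' ∈ cs.minReps K)
    (h : t * v = t' * v') : t = t' ∧ v = v' := by
  have e : v' = t'⁻¹ * t * v := by rw [mul_assoc, h, inv_mul_cancel_left]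
  have h1 : t'⁻¹ * t = 1 :=
    eq_one_of_mul_mem_minReps cs (mul_mem (inv_mem ht') ht) hv (e ▸ hv')
  refine ⟨(inv_mul_eq_one.1 h1).symm, ?_⟩
  rw [e, h1, one_mul]

/-- The component in `W_K` of `w ∈ W = W_K X_K`. -/
noncomputable def parPart (K : Finset (Fin 4)) (w : W) : W :=
  (exists_mul_mem_minReps cs K w).choose

/-- The component in `X_K` of `w ∈ W = W_K X_K`. -/
noncomputable def repPart (K : Finset (Fin 4)) (w : W) : W :=
  (exists_mul_mem_minReps cs K w).choose_spec.2.choose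

theorem parPart_mem (K : Finset (Fin 4)) (w : W) : parPart cs K w ∈ par cs K :=
  (exists_mul_mem_minReps cs K w).choose_spec.1

theorem repPart_mem (K : Finset (Fin 4)) (w : W) : repPart cs K w ∈ cs.minReps K :=
  (exists_mul_mem_minReps cs K w).choose_spec.2.choose_spec.1

theorem parPart_mul_repPart (K : Finset (Fin 4)) (w : W) :
    parPart cs K w * repPart cs K w = w :=
  (exists_mul_mem_minReps cs K w).choose_spec.2.choose_spec.2.symm

theorem parPart_mul {K : Finset (Fin 4)} {t v : W} (ht : t ∈ par cs K) (hv : v ∈ cs.minReps K) :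
    parPart cs K (t * v) = t :=
  (mul_minReps_unique cs (parPart_mem cs K _) ht (repPart_mem cs K _) hv
    (parPart_mul_repPart cs K _)).1

theorem repPart_mul {K : Finset (Fin 4)} {t v : W} (ht : t ∈ par cs K) (hv : v ∈ cs.minReps K) :
    repPart cs K (t * v) = v :=
  (mul_minReps_unique cs (parPart_mem cs K _) ht (repPart_mem cs K _) hv
    (parPart_mul_repPart cs K _)).2

/-- The minimal element of the left coset `x W_K`. -/
noncomputable def cosetMin (K : Finset (Fin 4)) (x : W) : W := (repPart cs K x⁻¹)⁻¹

theorem cosetMin_inv_mul_mem (K : Finset (Fin 4)) (x : W) :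
    (cosetMin cs K x)⁻¹ * x ∈ par cs K := by
  have h : (cosetMin cs K x)⁻¹ * x = (parPart cs K x⁻¹)⁻¹ := by
    rw [cosetMin, inv_inv, eq_inv_iff_mul_eq_one]
    have := parPart_mul_repPart cs K x⁻¹
    rw [eq_inv_of_mul_eq_one_left (a := parPart cs K x⁻¹ * repPart cs K x⁻¹) (b := x)
      (by rw [this, inv_mul_cancel])] at this
    have h2 : parPart cs K x⁻¹ * repPart cs K x⁻¹ * x = 1 := by
      rw [parPart_mul_repPart, inv_mul_cancel]
    have h3 := congrArg (fun z => (parPart cs K x⁻¹)⁻¹ * z * parPart cs K x⁻¹) h2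
    simpa [mul_assoc] using h3
  rw [h]
  exact inv_mem (parPart_mem cs K _)

theorem cosetMin_mul {K : Finset (Fin 4)} {d t : W} (hd : d⁻¹ ∈ cs.minReps K)
    (ht : t ∈ par cs K) : cosetMin cs K (d * t) = d := by
  rw [cosetMin, _root_.mul_inv_rev, repPart_mul cs (inv_mem ht) hd, inv_inv]

/-- The set of `s ∈ J` such that `s^x ∈ W_K`. -/
def meet (J K : Finset (Fin 4)) (x : W) : Finset (Fin 4) :=
  J.filter fun s => SuppIn K (act cs x⁻¹ (simpleRoot s))

theorem meet_mul {J K : Finset (Fin 4)} {d t : W} (ht : t ∈ par cs K) :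
    meet cs J K (d * t) = meet cs J K d := by
  unfold meet
  refine Finset.filter_congr fun s _ => ?_
  rw [_root_.mul_inv_rev, act_mul, suppIn_act_iff cs (inv_mem ht)]

/-- `W_K` preserves the sign of a root that is not supported on `K`, so for `s` outside `meet cs J K
d` the condition is inherited from `d`. -/
theorem mem_minReps_mul_iff {J K : Finset (Fin 4)} {d t : W} (hdJ : d ∈ cs.minReps J)
    (ht : t ∈ par cs K) : d * t ∈ cs.minReps J ↔
      ∀ s ∈ meet cs J K d, Pos (act cs t⁻¹ (act cs d⁻¹ (simpleRoot s))) := by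
  rw [mem_minReps_iff]
  simp only [_root_.mul_inv_rev, act_mul, meet, Finset.mem_filter]
  refine ⟨fun h s hs => h s hs.1, fun h s hs => ?_⟩
  by_cases hK : SuppIn K (act cs d⁻¹ (simpleRoot s))
  · exact h s ⟨hs, hK⟩
  · exact (pos_act_of_mem_par cs (inv_mem ht) hK).2 ((mem_minReps_iff cs J d).1 hdJ s hs)

/-- If the root `d⁻¹ α_s` is supported on `K`, it has the same sign as its image `α_s` under `d`,
because `d⁻¹ ∈ X_K`; otherwise it has the sign of `t⁻¹ d⁻¹ α_s`. -/
theorem mem_minReps_of_mul {J K : Finset (Fin 4)} {d t : W} (hdK : d⁻¹ ∈ cs.minReps K)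
    (ht : t ∈ par cs K) (h : d * t ∈ cs.minReps J) : d ∈ cs.minReps J := by
  rw [mem_minReps_iff] at h ⊢
  intro s hs
  have h1 := h s hs
  rw [_root_.mul_inv_rev, act_mul] at h1
  by_cases hK : SuppIn K (act cs d⁻¹ (simpleRoot s))
  · rw [← pos_act_inv_iff_of_mem_minReps cs hdK hK, ← act_mul, inv_inv, mul_inv_cancel, act_one]
    exact pos_simpleRoot s
  · exact (pos_act_of_mem_par cs (inv_mem ht) hK).1 h1

/-- Multiplication by `v ∈ X_K` does not affect the signs of roots supported on `K`. The resulting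
condition on `t` is that of `mem_minReps_mul_iff`, and this coincidence makes the Mackey bijection
well defined in both directions. -/
theorem mul_mem_minReps_meet_iff {J K : Finset (Fin 4)} {d t v : W} (ht : t ∈ par cs K)
    (hv : v ∈ cs.minReps K) : d * (t * v) ∈ cs.minReps (meet cs J K d) ↔
      ∀ s ∈ meet cs J K d, Pos (act cs t⁻¹ (act cs d⁻¹ (simpleRoot s))) := by
  rw [mem_minReps_iff]
  refine forall₂_congr fun s hs => ?_
  rw [_root_.mul_inv_rev, _root_.mul_inv_rev, act_mul, act_mul, ← act_mul cs t⁻¹]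
  refine pos_act_inv_iff_of_mem_minReps cs hv ?_
  rw [act_mul, suppIn_act_iff cs (inv_mem ht)]
  exact (Finset.mem_filter.1 hs).2

section Finite

variable [Fintype W]

open Classical in
/-- `X_J` as a finite set. -/
noncomputable def reps (J : Finset (Fin 4)) : Finset W :=
  Finset.univ.filter fun x => x ∈ cs.minReps J

open Classical in
/-- The minimal double coset representatives `X_J ∩ X_K⁻¹`. -/
noncomputable def doubleReps (J K : Finset (Fin 4)) : Finset W :=
  Finset.univ.filter fun x => x ∈ cs.minReps J ∧ x⁻¹ ∈ cs.minReps K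

theorem mem_reps {J : Finset (Fin 4)} {x : W} : x ∈ reps cs J ↔ x ∈ cs.minReps J := by
  simp [reps]

theorem mem_doubleReps {J K : Finset (Fin 4)} {x : W} :
    x ∈ doubleReps cs J K ↔ x ∈ cs.minReps J ∧ x⁻¹ ∈ cs.minReps K := by
  simp [doubleReps]

/-- The Mackey decomposition of `X_J × X_K`. -/
theorem sum_mackey {A : Type*} [AddCommMonoid A] (J K : Finset (Fin 4)) (f : W → W → A) :
    ∑ p ∈ reps cs J ×ˢ reps cs K, f (cosetMin cs K p.1) (p.1 * p.2) =
      ∑ d ∈ doubleReps cs J K, ∑ y ∈ reps cs (meet cs J K d), f d y := by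
  rw [Finset.sum_sigma']
  -- The pair `(x, v)` corresponds to `(d, x v)` with `d` the minimal element of `x W_K`; the
  -- inverse splits `d⁻¹ y` into its parts in `W_K` and `X_K`.
  refine Finset.sum_nbij' (fun p => ⟨cosetMin cs K p.1, p.1 * p.2⟩)
    (fun q => (q.1 * parPart cs K (q.1⁻¹ * q.2), repPart cs K (q.1⁻¹ * q.2))) ?_ ?_ ?_ ?_ ?_
  · rintro ⟨x, v⟩ h
    rw [Finset.mem_product, mem_reps, mem_reps] at h
    obtain ⟨hx, hv⟩ := h
    set d := cosetMin cs K x with hd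
    have hdK : d⁻¹ ∈ cs.minReps K := by rw [hd, cosetMin, inv_inv]; exact repPart_mem cs K _
    have ht := cosetMin_inv_mul_mem cs K x
    rw [← hd] at ht
    have e : x = d * (d⁻¹ * x) := by rw [mul_inv_cancel_left]
    have hdJ : d ∈ cs.minReps J := mem_minReps_of_mul cs hdK ht (e ▸ hx)
    rw [Finset.mem_sigma, mem_doubleReps, mem_reps]
    refine ⟨⟨hdJ, hdK⟩, ?_⟩
    change x * v ∈ cs.minReps (meet cs J K d)
    rw [e, mul_assoc, mul_mem_minReps_meet_iff cs ht hv, ← mem_minReps_mul_iff cs hdJ ht, ← e]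
    exact hx
  · rintro ⟨d, y⟩ h
    rw [Finset.mem_sigma, mem_doubleReps, mem_reps] at h
    obtain ⟨⟨hdJ, hdK⟩, hy⟩ := h
    rw [Finset.mem_product, mem_reps, mem_reps]
    refine ⟨?_, repPart_mem cs K _⟩
    change y ∈ cs.minReps (meet cs J K d) at hy
    change d * parPart cs K (d⁻¹ * y) ∈ cs.minReps J
    rw [mem_minReps_mul_iff cs hdJ (parPart_mem cs K _),
      ← mul_mem_minReps_meet_iff cs (parPart_mem cs K _) (repPart_mem cs K (d⁻¹ * y)),
      parPart_mul_repPart, mul_inv_cancel_left]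
    exact hy
  · rintro ⟨x, v⟩ h
    rw [Finset.mem_product, mem_reps, mem_reps] at h
    obtain ⟨hx, hv⟩ := h
    have ht := cosetMin_inv_mul_mem cs K x
    change (cosetMin cs K x * parPart cs K ((cosetMin cs K x)⁻¹ * (x * v)),
      repPart cs K ((cosetMin cs K x)⁻¹ * (x * v))) = (x, v)
    rw [← mul_assoc, parPart_mul cs ht hv, repPart_mul cs ht hv, mul_inv_cancel_left]
  · rintro ⟨d, y⟩ h
    rw [Finset.mem_sigma, mem_doubleReps, mem_reps] at h
    obtain ⟨⟨hdJ, hdK⟩, hy⟩ := h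
    change (⟨cosetMin cs K (d * parPart cs K (d⁻¹ * y)),
      d * parPart cs K (d⁻¹ * y) * repPart cs K (d⁻¹ * y)⟩ : (_ : W) × W) = ⟨d, y⟩
    rw [cosetMin_mul cs hdK (parPart_mem cs K _), mul_assoc, parPart_mul_repPart,
      mul_inv_cancel_left]
  · intro p _
    rfl

end Finite

end TypeH4

/-! ## The products `e_P x_J` in the descent algebra -/

namespace TypeH4

open Matrix GoldenInt

variable {W : Type*} [Group W] (cs : CoxeterSystem coxeterH4 W)

/-- The relation `M^x = N` between sets of simple roots. -/
def Conj (x : W) (M N : Finset (Fin 4)) : Prop :=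
  M.image (fun i => act cs x⁻¹ (simpleRoot i)) = N.image simpleRoot

instance (x : W) (M N : Finset (Fin 4)) : Decidable (Conj cs x M N) :=
  inferInstanceAs (Decidable (_ = _))

variable {cs}

theorem Conj.exists {x : W} {M N : Finset (Fin 4)} (h : Conj cs x M N) {i : Fin 4} (hi : i ∈ M) :
    ∃ j ∈ N, act cs x⁻¹ (simpleRoot i) = simpleRoot j := by
  have h1 : act cs x⁻¹ (simpleRoot i) ∈ N.image simpleRoot :=
    h ▸ Finset.mem_image_of_mem (fun i => act cs x⁻¹ (simpleRoot i)) hi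
  obtain ⟨j, hj, e⟩ := Finset.mem_image.1 h1
  exact ⟨j, hj, e.symm⟩

theorem Conj.exists' {x : W} {M N : Finset (Fin 4)} (h : Conj cs x M N) {j : Fin 4} (hj : j ∈ N) :
    ∃ i ∈ M, act cs x⁻¹ (simpleRoot i) = simpleRoot j := by
  have h1 : simpleRoot j ∈ M.image (fun i => act cs x⁻¹ (simpleRoot i)) :=
    h ▸ Finset.mem_image_of_mem simpleRoot hj
  exact Finset.mem_image.1 h1

theorem Conj.unique {x : W} {M N N' : Finset (Fin 4)} (h : Conj cs x M N) (h' : Conj cs x M N') :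
    N = N' :=
  Finset.image_injective simpleRoot_injective (h.symm.trans h')

theorem exists_conj {x : W} {M : Finset (Fin 4)}
    (h : ∀ i ∈ M, ∃ j, act cs x⁻¹ (simpleRoot i) = simpleRoot j) : ∃ N, Conj cs x M N := by
  choose! f hf using h
  refine ⟨M.image f, ?_⟩
  rw [Conj, Finset.image_image]
  exact Finset.image_congr fun i hi => hf i hi

theorem conj_mul_iff {x v : W} {M P N : Finset (Fin 4)} (h : Conj cs x M P) :
    Conj cs (x * v) M N ↔ Conj cs v P N := by
  have e : M.image (fun i => act cs (x * v)⁻¹ (simpleRoot i)) =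
      P.image (fun i => act cs v⁻¹ (simpleRoot i)) := by
    have h1 := congrArg (Finset.image (act cs v⁻¹)) h
    rw [Finset.image_image, Finset.image_image] at h1
    simpa only [Function.comp_def, ← act_mul, ← _root_.mul_inv_rev] using h1
  rw [Conj, e, Conj]

variable (cs)

/-- A positive root supported on `K` that an element of `X_K⁻¹` maps to a simple root is
simple. -/
theorem eq_simpleRoot_of_act_eq {K : Finset (Fin 4)} {v w : W} {i j : Fin 4}
    (hv : v ∈ cs.minReps K) (hp : Pos (act cs w (simpleRoot i)))
    (hs : SuppIn K (act cs w (simpleRoot i)))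
    (h : act cs v⁻¹ (act cs w (simpleRoot i)) = simpleRoot j) :
    ∃ k ∈ K, act cs w (simpleRoot i) = simpleRoot k := by
  set γ := act cs w (simpleRoot i) with hγ
  have hterm : ∀ k l, (γ k * act cs v⁻¹ (simpleRoot k) l).Nonneg := by
    intro k l
    by_cases hk : k ∈ K
    · exact (hp k).mul ((mem_minReps_iff cs K v).1 hv k hk l)
    · rw [hs k hk, zero_mul]; exact nonneg_zero
  have hsum : ∀ l, ∑ k, γ k * act cs v⁻¹ (simpleRoot k) l = simpleRoot j l := by
    intro l
    rw [← h, act_eq_sum, Finset.sum_apply]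
    simp
  -- Nonnegative terms cannot cancel, so every `v⁻¹ α_k` that occurs in the sum is a multiple of
  -- `α_j`.
  have hzero : ∀ k, γ k ≠ 0 → ∀ l, l ≠ j → act cs v⁻¹ (simpleRoot k) l = 0 := by
    intro k hk l hl
    have hkK : k ∈ K := by
      by_contra hc
      exact hk (hs k hc)
    have h1 := Nonneg.eq_zero_of_sum (s := Finset.univ) (fun k _ => hterm k l)
      ((hsum l).trans (Pi.single_eq_of_ne hl _)) (Finset.mem_univ k)
    exact (Nonneg.eq_zero_or_of_mul (hp k) ((mem_minReps_iff cs K v).1 hv k hkK l) h1).resolve_left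
      hk
  have hmul : ∀ k, γ k ≠ 0 → act cs v⁻¹ (simpleRoot k) =
      act cs v⁻¹ (simpleRoot k) j • simpleRoot j := by
    intro k hk
    ext1 l
    by_cases hl : l = j
    · subst hl; simp [simpleRoot]
    · rw [hzero k hk l hl, Pi.smul_apply, show simpleRoot j l = 0 from Pi.single_eq_of_ne hl _,
        smul_zero]
  obtain ⟨k, hk⟩ : ∃ k, γ k ≠ 0 := by
    by_contra! hc
    exact act_simpleRoot_ne_zero cs w i (funext hc)
  -- Two such indices would give independent simple roots proportional images under an injective
  -- map.
  have hother : ∀ l, l ≠ k → γ l = 0 := by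
    intro l hl
    by_contra hc
    have e : act cs v⁻¹ (act cs v⁻¹ (simpleRoot l) j • simpleRoot k) =
        act cs v⁻¹ (act cs v⁻¹ (simpleRoot k) j • simpleRoot l) := by
      rw [act_smul, act_smul, hmul k hk, hmul l hc]
      simp only [smul_smul]
      congr 1
      simp [simpleRoot, mul_comm]
    have e2 : act cs v⁻¹ (simpleRoot l) j = 0 := by
      have e3 := congrFun (act_injective cs _ e) k
      rw [Pi.smul_apply, Pi.smul_apply] at e3
      simpa [simpleRoot, Pi.single_eq_of_ne hl.symm] using e3
    refine act_simpleRoot_ne_zero cs v⁻¹ l ?_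
    rw [hmul l hc, e2, zero_smul]
  have hγk : γ = γ k • simpleRoot k := by
    conv_lhs => rw [← sum_smul_simpleRoot γ]
    refine Finset.sum_eq_single k (fun l _ hl => ?_) (fun h => absurd (Finset.mem_univ k) h)
    rw [hother l hl, zero_smul]
  have hkK : k ∈ K := by
    by_contra hc
    exact hk (hs k hc)
  refine ⟨k, hkK, ?_⟩
  have h1 := hsum j
  rw [Finset.sum_eq_single k (fun l _ hl => by rw [hother l hl, zero_mul])
    (fun h => absurd (Finset.mem_univ k) h), show simpleRoot j j = 1 from Pi.single_eq_same _ _] at h1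
  have h2 := Nonneg.eq_one_of_mul_eq_one (hp k) ((mem_minReps_iff cs K v).1 hv k hkK j) h1
  rw [hγk, h2, one_smul]

theorem meet_cosetMin (J K : Finset (Fin 4)) (x : W) :
    meet cs J K (cosetMin cs K x) = meet cs J K x := by
  conv_rhs => rw [← mul_inv_cancel_left (cosetMin cs K x) x]
  rw [meet_mul cs (cosetMin_inv_mul_mem cs K x)]

theorem minReps_univ : cs.minReps Finset.univ = {1} := by
  ext x
  rw [mem_minReps_iff, Set.mem_singleton_iff]
  constructor
  · intro h
    exact inv_eq_one.1 (eq_one_of_pos cs fun i => h i (Finset.mem_univ i))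
  · rintro rfl i -
    rw [inv_one, act_one]
    exact pos_simpleRoot i

theorem mem_minRepsSharp_iff {M : Finset (Fin 4)} {x : W} :
    x ∈ cs.minRepsSharp M ↔ x ∈ cs.minReps M ∧ ∃ N, Conj cs x M N := by
  refine and_congr_right fun hx => ⟨fun h => exists_conj fun i hi => ?_, fun h i hi => ?_⟩
  · obtain ⟨j, hj⟩ := h i hi
    refine ⟨j, ((inv_mul_simple_mul_eq_iff cs).1 hj).resolve_right fun h' => ?_⟩
    exact not_pos_neg_simpleRoot j (h' ▸ (mem_minReps_iff cs M x).1 hx i hi)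
  · obtain ⟨N, hN⟩ := h
    obtain ⟨j, -, hj⟩ := hN.exists hi
    exact ⟨j, (inv_mul_simple_mul_eq_iff cs).2 (Or.inl hj)⟩

theorem conjSubset_eq {M N : Finset (Fin 4)} {x : W} (h : Conj cs x M N) :
    cs.conjSubset x M = N := by
  ext j
  simp only [CoxeterSystem.conjSubset, Finset.mem_filter, Finset.mem_univ, true_and]
  constructor
  · rintro ⟨i, hi, e⟩
    obtain ⟨k, hk, e'⟩ := h.exists hi
    have : cs.simple k = cs.simple j :=
      ((inv_mul_simple_mul_eq_iff cs).2 (Or.inl e')).symm.trans e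
    have h2 := inv_mul_simple_mul_eq_iff cs (w := 1) (i := k) (j := j)
    rw [inv_one, one_mul, mul_one, act_one] at h2
    rcases h2.1 this with h3 | h3
    · rwa [← simpleRoot_injective h3]
    · exact absurd (h3 ▸ pos_simpleRoot k) (not_pos_neg_simpleRoot j)
  · intro hj
    obtain ⟨i, hi, e⟩ := h.exists' hj
    exact ⟨i, hi, (inv_mul_simple_mul_eq_iff cs).2 (Or.inl e)⟩

theorem minReps_anti {J K : Finset (Fin 4)} (h : J ⊆ K) : cs.minReps K ⊆ cs.minReps J :=
  fun _ hx i hi => hx i (h hi)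

theorem mMatrix_of_not_subset {K L : Finset (Fin 4)} (h : ¬ L ⊆ K) : cs.mMatrix K L = 0 := by
  unfold CoxeterSystem.mMatrix
  rw [Matrix.of_apply, if_neg h]

/-! ### Numbers of conjugations, Solomon's theorem and the elements `e_L` -/

section Finite

variable [Fintype W]

/-- The number of `x ∈ X_J` with `M^x = N`, if `M ⊆ J`. -/
noncomputable def count (J M N : Finset (Fin 4)) : ℕ :=
  if M ⊆ J then ((reps cs J).filter fun x => Conj cs x M N).card else 0

theorem count_eq_sum (J M N : Finset (Fin 4)) :
    count cs J M N = ∑ x ∈ reps cs J, if M ⊆ J ∧ Conj cs x M N then 1 else 0 := by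
  unfold count
  split_ifs with h
  · simp [h]
  · simp [h]

/-- The Mackey decomposition is applied to the indicator of `M ⊆ meet cs J K d` and `M^y = N`. For
`y = x v` this holds if and only if `M ⊆ J` and `M^x` is a set `P` of simple roots in `K` with `P^v
= N`; that `M^x` then consists of simple roots is `eq_simpleRoot_of_act_eq`. -/
theorem sum_count_meet (J K M N : Finset (Fin 4)) :
    ∑ d ∈ doubleReps cs J K, count cs (meet cs J K d) M N =
      ∑ P, count cs J M P * count cs K P N := by
  simp only [count_eq_sum]
  rw [← sum_mackey cs J K fun d y => if M ⊆ meet cs J K d ∧ Conj cs y M N then 1 else 0]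
  simp only [Finset.sum_mul_sum]
  rw [Finset.sum_product, Finset.sum_comm (s := Finset.univ)]
  refine Finset.sum_congr rfl fun x hx => ?_
  rw [Finset.sum_comm (s := Finset.univ)]
  refine Finset.sum_congr rfl fun v hv => ?_
  rw [mem_reps] at hx hv
  simp only [meet_cosetMin, ite_mul, one_mul, zero_mul]
  simp only [← ite_and]
  by_cases h : M ⊆ meet cs J K x ∧ Conj cs (x * v) M N
  · rw [if_pos h]
    obtain ⟨hM, hc⟩ := h
    have hMJ : M ⊆ J := hM.trans (Finset.filter_subset _ _)
    have hs : ∀ i ∈ M, ∃ k ∈ K, act cs x⁻¹ (simpleRoot i) = simpleRoot k := by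
      intro i hi
      obtain ⟨j, -, hj⟩ := hc.exists hi
      rw [_root_.mul_inv_rev, act_mul] at hj
      exact eq_simpleRoot_of_act_eq cs hv ((mem_minReps_iff cs J x).1 hx i (hMJ hi))
        (Finset.mem_filter.1 (hM hi)).2 hj
    obtain ⟨P, hP⟩ := exists_conj (fun i hi => (hs i hi).imp fun _ h => h.2)
    have hPK : P ⊆ K := by
      intro j hj
      obtain ⟨i, hi, e⟩ := hP.exists' hj
      obtain ⟨k, hk, e'⟩ := hs i hi
      rwa [simpleRoot_injective (e.symm.trans e')]
    rw [Finset.sum_eq_single P]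
    · rw [if_pos ⟨⟨hMJ, hP⟩, hPK, (conj_mul_iff hP).1 hc⟩]
    · intro Q _ hQ
      rw [if_neg]
      rintro ⟨⟨-, h1⟩, -⟩
      exact hQ (h1.unique hP)
    · intro h; exact absurd (Finset.mem_univ P) h
  · rw [if_neg h]
    symm
    refine Finset.sum_eq_zero fun P _ => if_neg ?_
    rintro ⟨⟨hMJ, hP⟩, hPK, hPN⟩
    refine h ⟨fun i hi => ?_, (conj_mul_iff hP).2 hPN⟩
    obtain ⟨j, hj, e⟩ := hP.exists hi
    refine Finset.mem_filter.2 ⟨hMJ hi, ?_⟩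
    rw [e]
    exact suppIn_simpleRoot (hPK hj)

theorem xSum_eq_sum (J : Finset (Fin 4)) :
    cs.xSum J = ∑ x ∈ reps cs J, MonoidAlgebra.of ℚ W x⁻¹ := by
  classical
  unfold CoxeterSystem.xSum
  rw [finsum_mem_eq_finite_toFinset_sum _ (Set.toFinite _)]
  refine Finset.sum_nbij' (fun w => w⁻¹) (fun w => w⁻¹) ?_ ?_ ?_ ?_ ?_ <;>
    simp [mem_reps]

/-- Solomon's theorem. -/
theorem xSum_mul_xSum (J K : Finset (Fin 4)) :
    cs.xSum K * cs.xSum J = ∑ d ∈ doubleReps cs J K, cs.xSum (meet cs J K d) := by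
  simp only [xSum_eq_sum]
  rw [← sum_mackey cs J K fun _ y => MonoidAlgebra.of ℚ W y⁻¹, Finset.sum_mul_sum,
    Finset.sum_comm, ← Finset.sum_product']
  refine Finset.sum_congr rfl fun p _ => ?_
  rw [_root_.mul_inv_rev, map_mul]

theorem xSum_univ : cs.xSum Finset.univ = 1 := by
  rw [xSum_eq_sum]
  have : reps cs Finset.univ = {1} := by
    ext x
    rw [mem_reps, minReps_univ]
    simp
  rw [this]
  simp [MonoidAlgebra.one_def]

theorem toSubmodule_descentAlgebra :
    Subalgebra.toSubmodule cs.descentAlgebra = Submodule.span ℚ (Set.range cs.xSum) := by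
  refine Algebra.adjoin_eq_span_of_subset _ ?_
  intro y hy
  induction hy using Submonoid.closure_induction with
  | mem x hx => exact Submodule.subset_span hx
  | one => rw [← xSum_univ cs]; exact Submodule.subset_span ⟨_, rfl⟩
  | mul x y _ _ hx hy =>
    have h := Submodule.mul_mem_mul hx hy
    rw [Submodule.span_mul_span] at h
    refine Submodule.span_le.2 ?_ h
    rintro _ ⟨_, ⟨K, rfl⟩, _, ⟨J, rfl⟩, rfl⟩
    change cs.xSum K * cs.xSum J ∈ Submodule.span ℚ (Set.range cs.xSum)
    rw [xSum_mul_xSum]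
    exact Submodule.sum_mem _ fun d _ => Submodule.subset_span ⟨_, rfl⟩

/-- The elements of `X_K ∩ X_L^♯` are sorted by `N = L^x`. -/
theorem mMatrix_eq (K L : Finset (Fin 4)) : cs.mMatrix K L = ∑ N, (count cs K L N : ℚ) := by
  classical
  unfold CoxeterSystem.mMatrix count
  rw [Matrix.of_apply]
  split_ifs with h
  · rw [← Nat.cast_sum]
    congr 1
    have e : cs.minReps K ∩ cs.minRepsSharp L =
        ((Finset.univ.biUnion fun N => (reps cs K).filter fun x => Conj cs x L N : Finset W) :
          Set W) := by
      ext x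
      simp only [Set.mem_inter_iff, mem_minRepsSharp_iff, Finset.coe_biUnion, Set.mem_iUnion,
        Finset.coe_filter, Set.mem_ofPred_eq, mem_reps, Finset.mem_coe, Finset.mem_univ,
        exists_prop, true_and, exists_and_left]
      exact ⟨fun h => ⟨h.1, h.2.2⟩, fun h' => ⟨h'.1, minReps_anti cs h h'.1, h'.2⟩⟩
    rw [e, Set.ncard_coe_finset, Finset.card_biUnion]
    intro N _ N' _ hN
    refine Finset.disjoint_left.2 fun x hx hx' => hN ?_
    exact (Finset.mem_filter.1 hx).2.unique (Finset.mem_filter.1 hx').2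
  · simp

theorem mem_parabolicClass_iff {M N : Finset (Fin 4)} :
    N ∈ cs.parabolicClass M ↔ count cs M M N ≠ 0 := by
  unfold CoxeterSystem.parabolicClass count
  rw [if_pos le_rfl, ← Nat.pos_iff_ne_zero, Finset.card_pos]
  constructor
  · rintro ⟨x, hx, rfl⟩
    obtain ⟨hx, N, hN⟩ := (mem_minRepsSharp_iff cs).1 hx
    refine ⟨x, Finset.mem_filter.2 ⟨(mem_reps cs).2 hx, ?_⟩⟩
    change Conj cs x M (cs.conjSubset x M)
    rwa [conjSubset_eq cs hN]
  · rintro ⟨x, hx⟩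
    obtain ⟨hx, hc⟩ := Finset.mem_filter.1 hx
    exact ⟨x, (mem_minRepsSharp_iff cs).2 ⟨(mem_reps cs).1 hx, N, hc⟩, conjSubset_eq cs hc⟩

theorem count_self_ne_zero (M : Finset (Fin 4)) : count cs M M M ≠ 0 := by
  unfold count
  rw [if_pos le_rfl, ← Nat.pos_iff_ne_zero, Finset.card_pos]
  refine ⟨1, Finset.mem_filter.2 ⟨(mem_reps cs).2 ?_, ?_⟩⟩
  · rw [mem_minReps_iff]
    intro i _
    rw [inv_one, act_one]
    exact pos_simpleRoot i
  · simp [Conj]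

theorem mMatrix_self_ne_zero (K : Finset (Fin 4)) : cs.mMatrix K K ≠ 0 := by
  rw [mMatrix_eq, ← Nat.cast_sum, Nat.cast_ne_zero]
  intro h
  exact count_self_ne_zero cs K ((Finset.sum_eq_zero_iff.1 h) K (Finset.mem_univ K))

/-- A system of linear equations with the triangular matrix `(m_{KL})` determines its
solution. -/
theorem eq_zero_of_sum_mMatrix {A : Type*} [AddCommGroup A] [Module ℚ A]
    {v : Finset (Fin 4) → A} (h : ∀ K, ∑ L, cs.mMatrix K L • v L = 0) : v = 0 := by
  funext K
  induction K using Finset.strongInduction with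
  | H K ih =>
    have h1 := h K
    rw [Finset.sum_eq_single K] at h1
    · exact (smul_eq_zero.1 h1).resolve_left (mMatrix_self_ne_zero cs K)
    · intro L _ hL
      by_cases hLK : L ⊆ K
      · rw [ih L (hLK.ssubset_of_ne hL), Pi.zero_apply, smul_zero]
      · rw [mMatrix_of_not_subset cs hLK, zero_smul]
    · intro h; exact absurd (Finset.mem_univ K) h

theorem isUnit_det_mMatrix : IsUnit cs.mMatrix.det := by
  rw [isUnit_iff_ne_zero]
  intro h
  obtain ⟨v, hv, h0⟩ := Matrix.exists_mulVec_eq_zero_iff.2 h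
  exact hv (eq_zero_of_sum_mMatrix cs fun K => congrFun h0 K)

theorem x_eq_sum (K : Finset (Fin 4)) : cs.x K = ∑ L, cs.mMatrix K L • cs.e L := by
  unfold CoxeterSystem.e
  simp only [Finset.smul_sum, smul_smul]
  rw [Finset.sum_comm]
  simp only [← Finset.sum_smul]
  have h : ∀ J, ∑ L, cs.mMatrix K L * cs.mMatrix⁻¹ L J = if K = J then 1 else 0 := by
    intro J
    rw [← Matrix.mul_apply, Matrix.mul_nonsing_inv _ (isUnit_det_mMatrix cs), Matrix.one_apply]
  simp [h]

theorem x_mul_x (J K : Finset (Fin 4)) :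
    cs.x K * cs.x J = ∑ d ∈ doubleReps cs J K, cs.x (meet cs J K d) := by
  apply Subtype.ext
  rw [AddSubmonoidClass.coe_finsetSum]
  exact xSum_mul_xSum cs J K

/-- Both sides, as families in `P`, solve the same linear system. Summed against `m_{KP}`, the left
one gives `x_K x_J`, a sum of elements `x_{meet}` by Solomon's theorem; expanded in the `e_M`, its
coefficients factor by `sum_count_meet` into those of the right side. The matrix is triangular, so
the solutions agree. -/
theorem e_mul_x (J P : Finset (Fin 4)) :
    cs.e P * cs.x J = ∑ M, (count cs J M P : ℚ) • cs.e M := by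
  have h := eq_zero_of_sum_mMatrix cs
    (v := fun P => cs.e P * cs.x J - ∑ M, (count cs J M P : ℚ) • cs.e M) fun K => by
      simp only [smul_sub, Finset.sum_sub_distrib, Finset.smul_sum, smul_smul]
      rw [sub_eq_zero, Finset.sum_comm]
      simp only [← Finset.sum_smul, ← smul_mul_assoc, ← Finset.sum_mul]
      rw [← x_eq_sum, x_mul_x]
      simp only [x_eq_sum cs (meet cs J K _)]
      rw [Finset.sum_comm]
      refine Finset.sum_congr rfl fun M _ => ?_
      rw [← Finset.sum_smul]
      congr 1
      simp only [mMatrix_eq]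
      rw [Finset.sum_comm]
      simp only [← Nat.cast_sum, sum_count_meet]
      push_cast
      rw [Finset.sum_comm]
      refine Finset.sum_congr rfl fun Q _ => ?_
      rw [Finset.sum_mul]
      exact Finset.sum_congr rfl fun _ _ => mul_comm _ _
  exact sub_eq_zero.1 (congrFun h P)

end Finite

end TypeH4

/-! ## Enumeration of the group by the action on the roots

The roots are numbered from `0` to `119`, the simple roots being `0, 1, 2, 3`, the positive roots
`0, …, 59`, and `r + 60` being the negative of `r`. An element `w` is represented by its state,
the number whose digits in base `256` are the numbers of the images of the simple roots. -/

namespace TypeH4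

open Matrix

/-- The permutations of the roots by the simple reflections, with one byte for each root. -/
def permTable : ℕ → ℕ
  | 0 => 
    0x777675737471726f706c6b6e6d68696a6466656763625e605c615a5f5b5d565853595154574f554c524a4950474e4d454b42484043463d443f3e41003b3a39373835363334302f32312c2d2e282a292b2726222420251e231f211a1c171d15181b131910160e0d140b1211090f060c04070a01080302053c
  | 1 => 
    0x77767475727371706d6e6f6a696c6b6567666861635f645d625b60595e575c555a56585053524d544b4e51484f46494c434a4541473e443c3f4201403b3a3839363735343132332e2d302f292b2a2c2527232821261f241d221b20191e1a1c14171611180f12150c130a0d10070e09050b02080003063d04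
  | 2 => 
    0x7775767473706f72716e6d6c6b6766646a69626860655f63615c5d5e585a555b525159544f57564e53504d4a4b4c4944474140483f3d46454302423c3b393a3837343336353231302f2b2a282e2d262c24292327252021221c1e191f16151d18131b1a121714110e0f100d080b05040c03010a09073e0600
  | _ => 
    0x767775747372716e6c706a6f686d656b67636964666061625d5e5f5a5b5c575459535058564e4c554a524851464f454d424b49443e47414003433d3c3a3b39383736353230342e332c31292f2b272d282a2425262122231e1f201b181d17141c1a1210190e160c150a130911060f0d08020b05043f070100

/-- The coordinates of the positive roots, with 32 bits for each root. -/
def rootTable : ℕ :=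
  0x203142321131423211224232112233321122333111223231112232221121323111213222102132311121312210213222112131211021312211212221102131211020312211122221102122211020312101122221101122211020212101112221101121211020211101112121101121111020201101112111101111111010201101111111101111101010111100102011011111100101111110101110001011110101111000011111101010100010111001010110000111101010100100101010010101000001011000101001000010100101000000010100000001100000100101000000000100000000010000000001

/-- A walk through the parabolic subgroup of type `H₂`. A letter `i < 4` is a step to a new
element, a letter `i + 4` is a step to an element visited before. -/
def walkH2 : List ℕ :=
  [0, 1, 0, 1, 0, 1, 0, 1, 0]

/-- A walk through the minimal representatives of the cosets of `H₂` in `H₃`. -/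
def walkH3 : List ℕ :=
  [2, 1, 0, 1, 0, 2, 0, 4, 1, 0, 1, 2]

/-- A walk through the minimal representatives of the cosets of `H₃` in `H₄`. -/
def walkH4 : List ℕ :=
  [3, 2, 1, 0, 1, 0, 2, 0, 3, 0, 1, 2, 0, 1, 0, 1, 2, 3, 1, 2, 3, 0, 1, 0, 1, 2, 3, 2, 1, 0, 1,
  0, 3, 0, 1, 0, 1, 2, 1, 0, 1, 2, 1, 0, 3, 0, 1, 0, 2, 0, 3, 0, 1, 3, 0, 3, 1, 2, 3, 2, 1, 0,
  4, 3, 1, 2, 5, 4, 5, 4, 6, 5, 7, 2, 0, 1, 0, 1, 0, 1, 0, 1, 0, 4, 5, 4, 5, 2, 0, 3, 0, 1, 3,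
  0, 1, 3, 1, 2, 0, 3, 0, 1, 0, 1, 2, 3, 2, 1, 0, 1, 2, 0, 1, 0, 1, 2, 3, 7, 6, 5, 4, 5, 2, 3,
  0, 1, 2, 0, 2, 1, 2, 1, 0, 2, 0, 4, 1]

/-- The signatures of the elements of the group and their multiplicities. -/
def signatureTable : List (ℕ × ℕ) :=
  [(161,2), (167,2), (173,14), (176,2), (177,2), (178,26), (179,12), (196,2), (202,2), (206,2),
  (207,2), (208,4), (209,30), (214,18), (311,1), (317,2), (322,3), (383,1), (389,14), (393,2),
  (394,25), (395,12), (418,2), (423,2), (424,8), (425,30), (430,18), (497,3), (502,3), (569,2),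
  (570,1), (574,2), (575,1), (581,2), (605,11), (606,1), (610,23), (611,11), (616,2), (636,2),
  (640,8), (641,30), (646,18), (726,1), (749,3), (754,2), (797,2), (803,1), (821,13), (822,1),
  (823,2), (826,24), (827,11), (829,1), (832,1), (838,1), (839,1), (852,1), (853,1), (856,6),
  (857,28), (858,1), (862,18), (863,1), (893,24), (896,2), (897,2), (898,26), (899,6), (917,3),
  (929,18), (933,2), (934,25), (935,6), (947,2), (959,3), (965,12), (966,1), (970,23), (971,7),
  (989,2), (1001,16), (1002,1), (1003,2), (1006,24), (1007,9), (1013,14), (1019,14), (1025,11),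
  (1031,13), (1037,394), (1038,14), (1039,16), (1040,16), (1041,12), (1042,914), (1043,526),
  (1045,4), (1048,22), (1049,12), (1050,4), (1054,24), (1055,12), (1060,28), (1061,12),
  (1066,26), (1067,10), (1068,22), (1069,24), (1070,28), (1071,26), (1072,464), (1073,2116),
  (1074,10), (1075,10), (1076,10), (1077,10), (1078,1568), (1079,118), (1106,2), (1107,2),
  (1108,2), (1109,30), (1114,24), (1132,2), (1133,1), (1143,2), (1144,2), (1145,29), (1150,24),
  (1158,1), (1162,2), (1174,2), (1180,2), (1181,29), (1182,1), (1186,22), (1187,1), (1204,4),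
  (1212,2), (1213,2), (1216,2), (1217,30), (1222,20), (1225,4), (1228,8), (1229,30), (1230,4),
  (1234,6), (1235,29), (1240,6), (1241,29), (1246,8), (1247,30), (1248,4), (1249,4), (1250,8),
  (1251,6), (1252,32), (1253,1444), (1254,28), (1255,30), (1256,30), (1257,30), (1258,2072),
  (1259,718), (1261,1), (1264,17), (1270,17), (1271,1), (1276,18), (1282,20), (1284,19),
  (1285,19), (1286,20), (1287,20), (1288,450), (1289,1198), (1290,1), (1294,598), (1295,1)]

/-- The root with number `r`. -/
def root (r : ℕ) : RootSpace :=
  if r < 60 then fun j => ⟨((rootTable >>> (32 * r + 8 * j)) % 16 : ℕ),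
    ((rootTable >>> (32 * r + 8 * j + 4)) % 16 : ℕ)⟩
  else fun j => ⟨-((rootTable >>> (32 * (r - 60) + 8 * j)) % 16 : ℕ),
    -((rootTable >>> (32 * (r - 60) + 8 * j + 4)) % 16 : ℕ)⟩

/-- The image of the root `r` under the simple reflection `i`. -/
def lookup (i r : ℕ) : ℕ := (permTable i >>> (8 * r)) % 256

/-- The `k`-th byte of a number. -/
def byte (st k : ℕ) : ℕ := (st >>> (8 * k)) % 256

/-- The action of the simple reflection `i` on states. -/
def stepState (i st : ℕ) : ℕ :=
  lookup i (byte st 0) + 256 * lookup i (byte st 1) + 65536 * lookup i (byte st 2) +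
    16777216 * lookup i (byte st 3)

/-- The elements that a walk visits for the first time, the starting point excluded. -/
def walkList {α : Type*} (g : ℕ → α → α) : List ℕ → α → List α
  | [], _ => []
  | i :: l, a => bif Nat.blt i 4 then g i a :: walkList g l (g i a)
      else walkList g l (g (i - 4) a)

/-- The elements that a walk visits. -/
def walk {α : Type*} (g : ℕ → α → α) (l : List ℕ) (a : α) : List α := a :: walkList g l a

/-- The sum of a function over the elements of `walkList`. -/
def walkListSum (f : ℕ → ℕ) : List ℕ → ℕ → ℕ
  | [], _ => 0
  | i :: l, st => bif Nat.blt i 4 then f (stepState i st) + walkListSum f l (stepState i st)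
      else walkListSum f l (stepState (i - 4) st)

/-- The sum of a function over the elements of a walk. -/
def walkSum (l : List ℕ) (f : ℕ → ℕ) (st : ℕ) : ℕ := f st + walkListSum f l st

/-- Simple roots have the classes `0, 1, 2, 3`, the other positive roots `4`, the negative
roots `5`. -/
def rootClass (r : ℕ) : ℕ := bif Nat.blt r 4 then r else bif Nat.blt r 60 then 4 else 5

/-- The classes of the images of the simple roots. -/
def signature (st : ℕ) : ℕ :=
  rootClass (byte st 0) + 6 * rootClass (byte st 1) + 36 * rootClass (byte st 2) +
    216 * rootClass (byte st 3)

/-- The state of the identity. -/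
def start : ℕ := 0x03020100

/-- The sum of `2 ^ (16 · signature)` over the group has the multiplicities of the signatures as its
digits in base `2 ^ 16`. It is evaluated along the walks, without forming the list of all states. -/
theorem tally_eq : walkSum walkH2 (walkSum walkH3 (walkSum walkH4
    fun st => 1 <<< (16 * signature st))) start =
      (signatureTable.map fun p => p.2 <<< (16 * p.1)).sum :=
  Nat.eq_of_beq_eq_true (by decide +kernel)

/-- This ties the tables to the reflection matrices, so that group elements can be followed on the
numbers of roots alone. -/
theorem root_lookup : ∀ i : Fin 4, ∀ r : Fin 120, reflMatrix i *ᵥ root r = root (lookup i r) := by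
  decide +kernel

theorem lookup_lt : ∀ i : Fin 4, ∀ r : Fin 120, lookup i r < 120 := by
  decide +kernel

theorem pos_root : ∀ r : Fin 120, Pos (root r) ↔ (r : ℕ) < 60 := by
  decide +kernel

/-- An injective linear function on the roots. -/
def rootHash (v : RootSpace) : ℤ :=
  (v 0).re + 17 * (v 0).im + 289 * ((v 1).re + 17 * (v 1).im) +
    83521 * ((v 2).re + 17 * (v 2).im + 289 * ((v 3).re + 17 * (v 3).im))

/-- Comparing integers instead of vectors keeps the check of all pairs cheap. -/
theorem rootHash_root : ∀ r s : Fin 120, rootHash (root r) = rootHash (root s) → r = s := by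
  decide +kernel

theorem root_simple : ∀ k : Fin 4, root k = simpleRoot k := by
  decide +kernel

theorem byte_start : ∀ k : Fin 4, byte start k = k := by
  decide +kernel

/-- The states of minimal representatives stay in the list under simple reflections, unless they
cease to be minimal. -/
def IsClosedWalk (l : List ℕ) (K K' : Finset (Fin 4)) : Prop :=
  (walk stepState l start).Nodup ∧ (∀ i ∈ l, i < 8 ∧ Fin.ofNat 4 i ∈ K') ∧
    (∀ st ∈ walk stepState l start, ∀ s ∈ K, byte st s < 60) ∧
    ∀ st ∈ walk stepState l start, ∀ i ∈ K',
      stepState i st ∈ walk stepState l start ∨ ∃ s ∈ K, 60 ≤ byte (stepState i st) s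

instance (l : List ℕ) (K K' : Finset (Fin 4)) : Decidable (IsClosedWalk l K K') :=
  inferInstanceAs (Decidable (_ ∧ _))

/-- The three walks visit 10, 12 and 120 elements, the indices in the chain `1 ⊂ H₂ ⊂ H₃ ⊂ H₄`. -/
theorem isClosedWalk_walkH2 : IsClosedWalk walkH2 ∅ {0, 1} := by decide +kernel
theorem isClosedWalk_walkH3 : IsClosedWalk walkH3 {0, 1} {0, 1, 2} := by decide +kernel
theorem isClosedWalk_walkH4 : IsClosedWalk walkH4 {0, 1, 2} Finset.univ := by decide +kernel

end TypeH4

/-! ### States of group elements and the enumeration of the group -/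

namespace TypeH4

open Matrix

variable {W : Type*} [Group W] (cs : CoxeterSystem coxeterH4 W)

theorem exists_mem_of_forall₂ {α β : Type*} {R : α → β → Prop} {l : List α} {l' : List β}
    (h : List.Forall₂ R l l') {a : α} (ha : a ∈ l) : ∃ b ∈ l', R a b := by
  induction h with
  | nil => simp at ha
  | cons h _ ih =>
    rcases List.mem_cons.1 ha with rfl | ha
    · exact ⟨_, List.mem_cons_self, h⟩
    · obtain ⟨b, hb, hR⟩ := ih ha
      exact ⟨b, List.mem_cons_of_mem _ hb, hR⟩

/-- The number `st` is the state of `w`. -/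
def IsState (w : W) (st : ℕ) : Prop :=
  st < 4294967296 ∧ ∀ k : Fin 4, byte st k < 120 ∧ act cs w (simpleRoot k) = root (byte st k)

theorem isState_one : IsState cs 1 start := by
  refine ⟨by decide, fun k => ?_⟩
  rw [byte_start, act_one, root_simple]
  exact ⟨by omega, rfl⟩

theorem byte_stepState (i : Fin 4) (st : ℕ) (k : Fin 4) :
    byte (stepState i st) k = lookup i (byte st k) := by
  have h : ∀ r, lookup i r < 256 := fun r => Nat.mod_lt _ (by norm_num)
  have h0 := h (byte st 0)
  have h1 := h (byte st 1)
  have h2 := h (byte st 2)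
  have h3 := h (byte st 3)
  unfold stepState
  fin_cases k <;> simp only [byte, Nat.shiftRight_eq_div_pow] at * <;> norm_num at * <;> omega

theorem stepState_lt (i : Fin 4) (st : ℕ) : stepState i st < 4294967296 := by
  have h : ∀ r, lookup i r < 256 := fun r => Nat.mod_lt _ (by norm_num)
  have h0 := h (byte st 0)
  have h1 := h (byte st 1)
  have h2 := h (byte st 2)
  have h3 := h (byte st 3)
  unfold stepState
  omega

variable {cs}

theorem IsState.step {w : W} {st : ℕ} (h : IsState cs w st) (i : Fin 4) :
    IsState cs (cs.simple i * w) (stepState i st) := by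
  refine ⟨stepState_lt i st, fun k => ?_⟩
  obtain ⟨hk, e⟩ := h.2 k
  rw [byte_stepState, act_mul, e]
  refine ⟨lookup_lt i ⟨_, hk⟩, ?_⟩
  unfold act
  rw [rep_simple]
  exact root_lookup i ⟨_, hk⟩

theorem root_injective {r s : ℕ} (hr : r < 120) (hs : s < 120) (h : root r = root s) : r = s :=
  congrArg Fin.val (rootHash_root ⟨r, hr⟩ ⟨s, hs⟩ (congrArg rootHash h))

theorem IsState.unique {w : W} {st st' : ℕ} (h : IsState cs w st) (h' : IsState cs w st') :
    st = st' := by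
  have hb : ∀ k : Fin 4, byte st k = byte st' k := fun k =>
    root_injective (h.2 k).1 (h'.2 k).1 ((h.2 k).2.symm.trans (h'.2 k).2)
  have e : ∀ n : ℕ, n < 4294967296 →
      n = byte n 0 + 256 * byte n 1 + 65536 * byte n 2 + 16777216 * byte n 3 := by
    intro n hn
    simp only [byte, Nat.shiftRight_eq_div_pow]
    norm_num
    omega
  rw [e st h.1, e st' h'.1]
  have h0 := hb 0
  have h1 := hb 1
  have h2 := hb 2
  have h3 := hb 3
  simp only [Fin.isValue, Fin.val_zero, Fin.val_one, Fin.val_two] at h0 h1 h2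
  rw [h0, h1, h2, show byte st 3 = byte st' 3 from h3]

theorem IsState.eq {w w' : W} {st : ℕ} (h : IsState cs w st) (h' : IsState cs w' st) : w = w' :=
  eq_of_act_eq cs fun k => (h.2 k).2.trans (h'.2 k).2.symm

theorem IsState.pos_iff {w : W} {st : ℕ} (h : IsState cs w st) (k : Fin 4) :
    Pos (act cs w (simpleRoot k)) ↔ byte st k < 60 := by
  rw [(h.2 k).2]
  exact pos_root ⟨_, (h.2 k).1⟩

theorem IsState.eq_simpleRoot_iff {w : W} {st : ℕ} (h : IsState cs w st) (k j : Fin 4) :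
    act cs w (simpleRoot k) = simpleRoot j ↔ byte st k = j := by
  rw [(h.2 k).2, ← root_simple]
  refine ⟨fun e => root_injective (h.2 k).1 (by omega) e, fun e => by rw [e]⟩

variable (cs)

/-- Left multiplication by simple reflections. -/
def stepGroup (i : ℕ) (w : W) : W := cs.simple (Fin.ofNat 4 i) * w

/-- Steps are left multiplications, which commute with right translation by `w`. -/
theorem walkList_mul (l : List ℕ) (u w : W) :
    walkList (stepGroup cs) l (u * w) = (walkList (stepGroup cs) l u).map (· * w) := by
  induction l generalizing u with
  | nil => rfl
  | cons i l ih =>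
    unfold walkList
    cases Nat.blt i 4
    · simp only [cond_false]
      rw [← ih]
      simp only [stepGroup, mul_assoc]
    · simp only [cond_true, List.map_cons]
      rw [← ih]
      simp only [stepGroup, mul_assoc]

theorem walk_mul (l : List ℕ) (w : W) :
    walk (stepGroup cs) l w = (walk (stepGroup cs) l 1).map (· * w) := by
  unfold walk
  rw [List.map_cons, ← walkList_mul, one_mul]

variable {cs}

theorem forall₂_walkList {l : List ℕ} (hl : ∀ i ∈ l, i < 8) {w : W} {st : ℕ}
    (h : IsState cs w st) :
    List.Forall₂ (IsState cs) (walkList (stepGroup cs) l w) (walkList stepState l st) := by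
  induction l generalizing w st with
  | nil => exact List.Forall₂.nil
  | cons i l ih =>
    have hi := hl i List.mem_cons_self
    have ih' := fun {w : W} {st : ℕ} h => ih (fun j hj => hl j (List.mem_cons_of_mem i hj))
      (w := w) (st := st) h
    unfold walkList
    cases hb : Nat.blt i 4
    · simp only [cond_false]
      have h4 : i - 4 < 4 := by omega
      have := h.step (Fin.ofNat 4 (i - 4))
      rw [show ((Fin.ofNat 4 (i - 4) : Fin 4) : ℕ) = i - 4 from Nat.mod_eq_of_lt h4] at this
      exact ih' this
    · simp only [cond_true]
      have h4 : i < 4 := by simpa using hb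
      have := h.step (Fin.ofNat 4 i)
      rw [show ((Fin.ofNat 4 i : Fin 4) : ℕ) = i from Nat.mod_eq_of_lt h4] at this
      exact List.Forall₂.cons this (ih' this)

theorem forall₂_walk {l : List ℕ} (hl : ∀ i ∈ l, i < 8) {w : W} {st : ℕ}
    (h : IsState cs w st) :
    List.Forall₂ (IsState cs) (walk (stepGroup cs) l w) (walk stepState l st) :=
  List.Forall₂.cons h (forall₂_walkList hl h)

variable (cs)

theorem mem_par_of_mem_walkList {l : List ℕ} {K : Finset (Fin 4)}
    (hl : ∀ i ∈ l, i < 8 ∧ Fin.ofNat 4 i ∈ K) {w : W} (hw : w ∈ par cs K) :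
    ∀ u ∈ walkList (stepGroup cs) l w, u ∈ par cs K := by
  induction l generalizing w with
  | nil => intro u hu; simp [walkList] at hu
  | cons i l ih =>
    have hi := hl i List.mem_cons_self
    have ih' := fun {w : W} => ih (fun j hj => hl j (List.mem_cons_of_mem i hj)) (w := w)
    intro u hu
    unfold walkList at hu
    have hg : stepGroup cs i w ∈ par cs K := mul_mem (simple_mem_par cs hi.2) hw
    cases hb : Nat.blt i 4
    · rw [hb] at hu
      simp only [cond_false] at hu
      refine ih' ?_ u hu
      refine mul_mem (simple_mem_par cs ?_) hw
      have : 4 ≤ i := by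
        by_contra hc
        have : Nat.blt i 4 = true := by simpa using hc
        rw [hb] at this
        cases this
      have h4 : Fin.ofNat 4 (i - 4) = Fin.ofNat 4 i := by
        apply Fin.ext
        simp only [Fin.ofNat]
        omega
      rw [h4]
      exact hi.2
    · rw [hb] at hu
      simp only [cond_true, List.mem_cons] at hu
      rcases hu with rfl | hu
      · exact hg
      · exact ih' hg u hu

/-- A left descent of an element of `W_K` belongs to `K`. -/
theorem mem_of_leftDescent {K : Finset (Fin 4)} {u : W} (hu : u ∈ par cs K) {i : Fin 4}
    (hi : cs.length (cs.simple i * u) < cs.length u) : i ∈ K := by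
  by_contra hc
  rw [← cs.length_inv, _root_.mul_inv_rev, cs.inv_simple, ← cs.length_inv u,
    mul_simple_length_lt_iff] at hi
  have h := hi i
  rw [Pi.neg_apply, act_apply_of_mem_par cs (inv_mem hu) hc] at h
  clear hc hi
  revert i
  decide

/-- By induction on the length: removing a left descent `s_i` of `u` leaves a shorter minimal
representative, which the walk contains. Closedness leads back to `u`; its alternative is excluded
because `u` makes no simple root in `K` negative. -/
theorem mem_walk_of_isClosedWalk {l : List ℕ} {K K' : Finset (Fin 4)} (h : IsClosedWalk l K K')
    {u : W} (hu : u ∈ par cs K') (huK : u⁻¹ ∈ cs.minReps K) :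
    u ∈ walk (stepGroup cs) l 1 := by
  have hF := forall₂_walk (fun i hi => (h.2.1 i hi).1) (isState_one cs)
  induction hn : cs.length u using Nat.strong_induction_on generalizing u with
  | _ n ih =>
    by_cases hu1 : u = 1
    · rw [hu1]; exact List.mem_cons_self
    obtain ⟨i, hi⟩ := cs.exists_leftDescent_of_ne_one hu1
    have hiK : i ∈ K' := mem_of_leftDescent cs hu hi
    have hu' : cs.simple i * u ∈ par cs K' := mul_mem (simple_mem_par cs hiK) hu
    have huK' : (cs.simple i * u)⁻¹ ∈ cs.minReps K := by
      intro s hs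
      have h1 := huK s hs
      rw [cs.length_inv, ← cs.length_inv (cs.simple s * _), _root_.mul_inv_rev, inv_inv,
        cs.inv_simple] at h1 ⊢
      have h2 := (cs.isLeftDescent_iff).1 hi
      have h3 := cs.length_simple_mul (u * cs.simple s) i
      rw [mul_assoc]
      omega
    have hmem := ih _ (hn ▸ hi) hu' huK' rfl
    obtain ⟨st, hst, hs⟩ : ∃ st ∈ walk stepState l start, IsState cs (cs.simple i * u) st :=
      exists_mem_of_forall₂ hF hmem
    have hs' := hs.step i
    rw [cs.simple_mul_simple_cancel_left] at hs'
    rcases h.2.2.2 st hst i hiK with h4 | ⟨s, hsK, h4⟩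
    · obtain ⟨v, hv, hv'⟩ : ∃ v ∈ walk (stepGroup cs) l 1, IsState cs v (stepState i st) := by
        exact exists_mem_of_forall₂ hF.flip h4
      rwa [hs'.eq hv']
    · have h5 := (mem_minReps_iff cs K _).1 huK s hsK
      rw [inv_inv, hs'.pos_iff] at h5
      omega

/-- The list `l` enumerates the parabolic subgroup `W_K`. -/
def Enumerates (K : Finset (Fin 4)) (l : List W) : Prop := l.Nodup ∧ ∀ w, w ∈ l ↔ w ∈ par cs K

/-- Each element of `W_{K'}` is uniquely a minimal representative `u` of a left coset of `W_K` times
an element `w` of `W_K`, and the walk that starts at `w` runs through the products `u w`. -/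
theorem Enumerates.flatMap {K K' : Finset (Fin 4)} (hK : K ⊆ K') {l : List ℕ} {L : List W}
    (hL : Enumerates cs K L) (h : IsClosedWalk l K K') :
    Enumerates cs K' (L.flatMap fun w => walk (stepGroup cs) l w) := by
  have hF := forall₂_walk (fun i hi => (h.2.1 i hi).1) (isState_one cs)
  have hpar : ∀ u ∈ walk (stepGroup cs) l 1, u ∈ par cs K' := by
    intro u hu
    rcases List.mem_cons.1 hu with rfl | hu
    · exact one_mem _
    · exact mem_par_of_mem_walkList cs h.2.1 (one_mem _) u hu
  have hrep : ∀ u ∈ walk (stepGroup cs) l 1, u⁻¹ ∈ cs.minReps K := by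
    intro u hu
    obtain ⟨st, hst, hs⟩ : ∃ st ∈ walk stepState l start, IsState cs u st :=
      exists_mem_of_forall₂ hF hu
    rw [mem_minReps_iff]
    intro s hsK
    rw [inv_inv, hs.pos_iff]
    exact h.2.2.1 st hst s hsK
  have hle : par cs K ≤ par cs K' := Subgroup.closure_mono (Set.image_mono (by exact_mod_cast hK))
  have hnodup : (walk (stepGroup cs) l 1).Nodup :=
    (List.rel_nodup ⟨fun _ _ _ h h' => h.eq h', fun _ _ _ h h' => h.unique h'⟩ hF).2 h.1
  have huniq : ∀ u ∈ walk (stepGroup cs) l 1, ∀ u' ∈ walk (stepGroup cs) l 1, ∀ w ∈ L, ∀ w' ∈ L,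
      u * w = u' * w' → w = w' := by
    intro u hu u' hu' w hw w' hw' e
    have e' : w⁻¹ * u⁻¹ = w'⁻¹ * u'⁻¹ := by rw [← _root_.mul_inv_rev, e, _root_.mul_inv_rev]
    exact inv_injective (mul_minReps_unique cs (inv_mem ((hL.2 w).1 hw))
      (inv_mem ((hL.2 w').1 hw')) (hrep u hu) (hrep u' hu') e').1
  constructor
  · rw [List.nodup_flatMap]
    constructor
    · intro w _
      rw [walk_mul]
      exact hnodup.map (mul_left_injective w)
    · refine hL.1.imp_of_mem ?_
      intro w w' hw hw' hne
      rw [Function.onFun, walk_mul cs l w, walk_mul cs l w']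
      intro x hx hx'
      obtain ⟨u, hu, rfl⟩ := List.mem_map.1 hx
      obtain ⟨u', hu', e⟩ := List.mem_map.1 hx'
      exact hne (huniq u hu u' hu' w hw w' hw' e.symm)
  · intro x
    rw [List.mem_flatMap]
    constructor
    · rintro ⟨w, hw, hx⟩
      rw [walk_mul] at hx
      obtain ⟨u, hu, rfl⟩ := List.mem_map.1 hx
      exact mul_mem (hpar u hu) (hle ((hL.2 w).1 hw))
    · intro hx
      obtain ⟨t, ht, v, hv, e⟩ := exists_mul_mem_minReps cs K x⁻¹
      have ex : x = v⁻¹ * t⁻¹ := by rw [← _root_.mul_inv_rev, ← e, inv_inv]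
      refine ⟨t⁻¹, (hL.2 _).2 (inv_mem ht), ?_⟩
      rw [walk_mul, ex]
      refine List.mem_map_of_mem (mem_walk_of_isClosedWalk cs h ?_ (by rwa [inv_inv]))
      have : v⁻¹ = x * t := by rw [ex, inv_mul_cancel_right]
      rw [this]
      exact mul_mem hx (hle ht)

/-- The list of the elements of the group. -/
def elements : List W :=
  ((([1] : List W).flatMap fun w => walk (stepGroup cs) walkH2 w).flatMap fun w =>
    walk (stepGroup cs) walkH3 w).flatMap fun w => walk (stepGroup cs) walkH4 w

theorem enumerates_elements : Enumerates cs Finset.univ (elements cs) := by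
  have h : Enumerates cs ∅ [1] := by
    refine ⟨List.nodup_singleton 1, fun w => ?_⟩
    rw [par, Finset.coe_empty, Set.image_empty, Subgroup.closure_empty, Subgroup.mem_bot,
      List.mem_singleton]
  exact ((h.flatMap cs (by decide) isClosedWalk_walkH2).flatMap cs (by decide)
    isClosedWalk_walkH3).flatMap cs (by decide) isClosedWalk_walkH4

theorem mem_elements (w : W) : w ∈ elements cs := by
  rw [(enumerates_elements cs).2, par, Finset.coe_univ, Set.image_univ,
    cs.subgroup_closure_range_simple]
  exact Subgroup.mem_top w

theorem finite {W : Type*} [Group W] (cs : CoxeterSystem coxeterH4 W) : Finite W :=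
  Set.finite_univ_iff.1 ((elements cs).finite_toSet.subset fun w _ => mem_elements cs w)

/-- The list of the states of the elements of the group. -/
def states : List ℕ :=
  ((([start] : List ℕ).flatMap fun st => walk stepState walkH2 st).flatMap fun st =>
    walk stepState walkH3 st).flatMap fun st => walk stepState walkH4 st

variable {cs} in
theorem forall₂_flatMap {l : List ℕ} (hl : ∀ i ∈ l, i < 8) {L : List W} {L' : List ℕ}
    (h : List.Forall₂ (IsState cs) L L') :
    List.Forall₂ (IsState cs) (L.flatMap fun w => walk (stepGroup cs) l w)
      (L'.flatMap fun st => walk stepState l st) := by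
  induction h with
  | nil => exact List.Forall₂.nil
  | cons h _ ih =>
    rw [List.flatMap_cons, List.flatMap_cons]
    exact List.rel_append (forall₂_walk hl h) ih

theorem forall₂_elements : List.Forall₂ (IsState cs) (elements cs) states :=
  forall₂_flatMap (fun i hi => (isClosedWalk_walkH4.2.1 i hi).1)
    (forall₂_flatMap (fun i hi => (isClosedWalk_walkH3.2.1 i hi).1)
      (forall₂_flatMap (fun i hi => (isClosedWalk_walkH2.2.1 i hi).1)
        (List.Forall₂.cons (isState_one cs) List.Forall₂.nil)))

theorem walkListSum_eq (f : ℕ → ℕ) (l : List ℕ) (st : ℕ) :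
    walkListSum f l st = ((walkList stepState l st).map f).sum := by
  induction l generalizing st with
  | nil => rfl
  | cons i l ih =>
    unfold walkListSum walkList
    cases Nat.blt i 4
    · simp only [cond_false, ih]
    · simp only [cond_true, ih, List.map_cons, List.sum_cons]

theorem walkSum_eq (f : ℕ → ℕ) (l : List ℕ) (st : ℕ) :
    walkSum l f st = ((walk stepState l st).map f).sum := by
  rw [walkSum, walkListSum_eq, walk, List.map_cons, List.sum_cons]

theorem sum_map_flatMap {α β : Type*} (f : β → ℕ) (g : α → List β) (L : List α) :
    ((L.flatMap g).map f).sum = (L.map fun a => ((g a).map f).sum).sum := by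
  induction L with
  | nil => rfl
  | cons a L ih => simp [ih]

/-- Nested sums along the three walks are the form in which the kernel can evaluate a sum over the
group. -/
theorem sum_states (f : ℕ → ℕ) : (states.map f).sum =
    walkSum walkH2 (walkSum walkH3 (walkSum walkH4 f)) start := by
  unfold states
  simp only [sum_map_flatMap, ← walkSum_eq, List.map_cons, List.map_nil, List.sum_singleton]

end TypeH4

/-! ## The numbers of `x ∈ X_J` with `M^x = N` -/

namespace TypeH4

open Matrix

/-- The lowest digits agree modulo `B`; removing them and dividing by `B` reduces `n` by one. -/
theorem eq_of_sum_mul_pow_eq {B : ℕ} (n : ℕ) {f g : ℕ → ℕ} (hf : ∀ k, f k < B)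
    (hg : ∀ k, g k < B)
    (h : ∑ k ∈ Finset.range n, f k * B ^ k = ∑ k ∈ Finset.range n, g k * B ^ k) :
    ∀ k < n, f k = g k := by
  induction n generalizing f g with
  | zero => intro k hk; omega
  | succ n ih =>
    have hB : 0 < B := (Nat.zero_le _).trans_lt (hf 0)
    rw [Finset.sum_range_succ', Finset.sum_range_succ'] at h
    simp only [pow_succ, ← mul_assoc, ← Finset.sum_mul, pow_zero, mul_one] at h
    have h0 : f 0 = g 0 := by
      have h1 := congrArg (· % B) h
      simpa [Nat.add_mod, Nat.mod_eq_of_lt (hf 0), Nat.mod_eq_of_lt (hg 0)] using h1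
    rw [h0, Nat.add_right_cancel_iff] at h
    have h2 := ih (f := fun k => f (k + 1)) (g := fun k => g (k + 1)) (fun k => hf _)
      (fun k => hg _) (Nat.eq_of_mul_eq_mul_right hB h)
    intro k hk
    cases k with
    | zero => exact h0
    | succ k => exact h2 k (by omega)

/-- A list of numbers is determined up to order by its tally. -/
theorem perm_of_sum_pow_eq {B : ℕ} {l l' : List ℕ} (hl : l.length < B) (hl' : l'.length < B)
    (h : (l.map (B ^ ·)).sum = (l'.map (B ^ ·)).sum) : l.Perm l' := by
  obtain ⟨n, hn⟩ : ∃ n, ∀ c ∈ l ++ l', c < n :=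
    ⟨(l ++ l').sum + 1, fun c hc => Nat.lt_succ_of_le (List.le_sum_of_mem hc)⟩
  have key : ∀ L : List ℕ, (∀ c ∈ L, c < n) →
      (L.map (B ^ ·)).sum = ∑ k ∈ Finset.range n, L.count k * B ^ k := by
    intro L hL
    rw [Finset.sum_list_map_count]
    simp only [smul_eq_mul]
    refine Finset.sum_subset (fun c hc => ?_) fun c _ hc => ?_
    · exact Finset.mem_range.2 (hL c (List.mem_toFinset.1 hc))
    · rw [List.count_eq_zero_of_not_mem (fun h => hc (List.mem_toFinset.2 h)), zero_mul]
  rw [key l fun c hc => hn c (List.mem_append_left _ hc),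
    key l' fun c hc => hn c (List.mem_append_right _ hc)] at h
  have h2 := eq_of_sum_mul_pow_eq n (fun k => List.count_le_length.trans_lt hl)
    (fun k => List.count_le_length.trans_lt hl') h
  rw [List.perm_iff_count]
  intro k
  by_cases hk : k < n
  · exact h2 k hk
  · rw [List.count_eq_zero_of_not_mem fun h => hk (hn k (List.mem_append_left _ h)),
      List.count_eq_zero_of_not_mem fun h => hk (hn k (List.mem_append_right _ h))]

/-- The list with the multiplicities of a table. -/
def expand (t : List (ℕ × ℕ)) : List ℕ := t.flatMap fun p => List.replicate p.2 p.1

theorem sum_map_expand (f : ℕ → ℕ) (t : List (ℕ × ℕ)) :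
    ((expand t).map f).sum = (t.map fun p => p.2 * f p.1).sum := by
  unfold expand
  rw [sum_map_flatMap]
  simp

theorem length_states : states.length < 2 ^ 16 := by
  have h : (states.map fun _ => 1).sum < 2 ^ 16 := by
    rw [sum_states]
    exact Nat.le_of_ble_eq_true (by decide +kernel)
  simpa using h

/-- There are fewer than `2 ^ 16` elements, so no carries occur in the tally and it determines all
multiplicities. -/
theorem perm_signatures : (states.map signature).Perm (expand signatureTable) := by
  refine perm_of_sum_pow_eq (B := 2 ^ 16) ?_ ?_ ?_
  · rw [List.length_map]; exact length_states
  · have h := sum_map_expand (fun _ => 1) signatureTable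
    simp only [List.map_const', List.sum_replicate, smul_eq_mul, mul_one] at h
    rw [h]
    decide +kernel
  · rw [sum_map_expand, List.map_map]
    have h := tally_eq
    rw [← sum_states] at h
    simp only [Nat.shiftLeft_eq, one_mul, pow_mul] at h
    exact h

/-- The number of signatures that satisfy a condition. -/
theorem countP_signatures (p : ℕ → Bool) : (states.map signature).countP p =
    (signatureTable.map fun q => bif p q.1 then q.2 else 0).sum := by
  rw [perm_signatures.countP_eq]
  have h := sum_map_expand (fun c => bif p c then 1 else 0) signatureTable
  have h2 : ∀ l : List ℕ, (l.map fun c => bif p c then 1 else 0).sum = l.countP p := by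
    intro l
    induction l with
    | nil => rfl
    | cons c l ih =>
      rw [List.map_cons, List.sum_cons, ih, List.countP_cons]
      cases p c <;> simp [add_comm]
  rw [h2] at h
  rw [h]
  congr 1
  refine List.map_congr_left fun q _ => ?_
  cases p q.1 <;> simp

/-- The number whose binary digits are given by a set. -/
def mask (J : Finset (Fin 4)) : ℕ := ∑ i ∈ J, 2 ^ (i : ℕ)

/-- The condition on the class `d` of the image of the simple root `k` in the definition of
`okSignature`. -/
def okDigit (j m n k d : ℕ) : Bool :=
  (!Nat.testBit j k || Nat.blt d 5) && (!Nat.testBit m k || Nat.testBit n d)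

/-- The simple roots in `j` have positive images, those in `m` have images in `n`. -/
def okSignature (j m n c : ℕ) : Bool :=
  okDigit j m n 0 (c % 6) && okDigit j m n 1 (c / 6 % 6) && okDigit j m n 2 (c / 36 % 6) &&
    okDigit j m n 3 (c / 216)

/-- The number of signatures that satisfy `okSignature`. -/
def tableCount (j m n : ℕ) : ℕ :=
  (signatureTable.map fun q => bif okSignature j m n q.1 then q.2 else 0).sum

theorem testBit_mask : ∀ (J : Finset (Fin 4)) (k : Fin 4),
    Nat.testBit (mask J) k = true ↔ k ∈ J := by
  decide +kernel

/-- The classes 4 and 5 belong to roots that are not simple; no mask has these bits. -/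
theorem testBit_mask_of_le : ∀ (J : Finset (Fin 4)) (k : Fin 6), 4 ≤ (k : ℕ) →
    Nat.testBit (mask J) k = false := by
  decide +kernel

theorem testBit_mask_rootClass (N : Finset (Fin 4)) (r : ℕ) :
    Nat.testBit (mask N) (rootClass r) = true ↔ ∃ j ∈ N, r = (j : ℕ) := by
  unfold rootClass
  cases h : Nat.blt r 4
  · have h4 : 4 ≤ r := by
      by_contra hc
      rw [show Nat.blt r 4 = true by simpa using hc] at h
      cases h
    have h5 : Nat.testBit (mask N) (bif Nat.blt r 60 then 4 else 5) = false := by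
      cases Nat.blt r 60
      · exact testBit_mask_of_le N 5 (by decide)
      · exact testBit_mask_of_le N 4 (by decide)
    rw [cond_false, h5]
    refine iff_of_false (by simp) ?_
    rintro ⟨j, -, rfl⟩
    omega
  · have h4 : r < 4 := by simpa using h
    rw [cond_true]
    refine (testBit_mask N ⟨r, h4⟩).trans ⟨fun h => ⟨_, h, rfl⟩, ?_⟩
    rintro ⟨j, hj, rfl⟩
    exact hj

theorem rootClass_lt (r : ℕ) : rootClass r < 6 := by
  unfold rootClass
  cases h : Nat.blt r 4
  · cases Nat.blt r 60 <;> simp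
  · have h4 : r < 4 := by simpa using h
    rw [cond_true]; omega

theorem rootClass_blt_iff (r : ℕ) : Nat.blt (rootClass r) 5 = true ↔ r < 60 := by
  unfold rootClass
  cases h : Nat.blt r 4
  · cases h' : Nat.blt r 60
    · have : ¬ r < 60 := fun hc => by
        rw [show Nat.blt r 60 = true by simpa using hc] at h'
        cases h'
      simp [this]
    · have : r < 60 := by simpa using h'
      simp [this]
  · have h4 : r < 4 := by simpa using h
    have h5 : r < 60 := by omega
    have h6 : r < 5 := by omega
    simp [h5, h6]

variable {W : Type*} [Group W] {cs : CoxeterSystem coxeterH4 W}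

theorem okSignature_iff {y : W} {st : ℕ} (h : IsState cs y st) (J M N : Finset (Fin 4)) :
    okSignature (mask J) (mask M) (mask N) (signature st) = true ↔
      (∀ i ∈ J, Pos (act cs y (simpleRoot i))) ∧
        ∀ i ∈ M, ∃ j ∈ N, act cs y (simpleRoot i) = simpleRoot j := by
  have h0 := rootClass_lt (byte st 0)
  have h1 := rootClass_lt (byte st 1)
  have h2 := rootClass_lt (byte st 2)
  have h3 := rootClass_lt (byte st 3)
  have e0 : signature st % 6 = rootClass (byte st 0) := by unfold signature; omega
  have e1 : signature st / 6 % 6 = rootClass (byte st 1) := by unfold signature; omega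
  have e2 : signature st / 36 % 6 = rootClass (byte st 2) := by unfold signature; omega
  have e3 : signature st / 216 = rootClass (byte st 3) := by unfold signature; omega
  have key : ∀ k : Fin 4, okDigit (mask J) (mask M) (mask N) k (rootClass (byte st k)) = true ↔
      (k ∈ J → Pos (act cs y (simpleRoot k))) ∧
        (k ∈ M → ∃ j ∈ N, act cs y (simpleRoot k) = simpleRoot j) := by
    intro k
    unfold okDigit
    rw [Bool.and_eq_true, Bool.or_eq_true, Bool.or_eq_true, Bool.not_eq_true', Bool.not_eq_true',
      rootClass_blt_iff, testBit_mask_rootClass, h.pos_iff, ← Bool.not_eq_true,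
      ← Bool.not_eq_true, testBit_mask, testBit_mask, imp_iff_not_or, imp_iff_not_or]
    simp only [h.eq_simpleRoot_iff]
  unfold okSignature
  rw [e0, e1, e2, e3]
  have h4 : ∀ p : Fin 4 → Prop, (∀ k, p k) ↔ ((p 0 ∧ p 1) ∧ p 2) ∧ p 3 := fun p =>
    ⟨fun h => ⟨⟨⟨h 0, h 1⟩, h 2⟩, h 3⟩, fun h k => by
      fin_cases k
      exacts [h.1.1.1, h.1.1.2, h.1.2, h.2]⟩
  rw [← forall_and, h4, ← key 0, ← key 1, ← key 2, ← key 3]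
  simp only [Bool.and_eq_true]
  rfl

/-- Since `y` acts injectively, an inclusion of the image of `M` in the simple roots of `N` is an
equality for sets of equal size. The inclusion is what a signature shows. -/
theorem conj_inv_iff {y : W} {M N : Finset (Fin 4)} : Conj cs y⁻¹ M N ↔
    M.card = N.card ∧ ∀ i ∈ M, ∃ j ∈ N, act cs y (simpleRoot i) = simpleRoot j := by
  have hf : Function.Injective fun i => act cs y (simpleRoot i) :=
    (act_injective cs y).comp simpleRoot_injective
  have hc1 := Finset.card_image_of_injective M hf
  have hc2 := Finset.card_image_of_injective N simpleRoot_injective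
  constructor
  · intro h
    refine ⟨?_, fun i hi => ?_⟩
    · unfold Conj at h
      rw [inv_inv] at h
      rw [← hc1, ← hc2, h]
    · have := h.exists hi
      rwa [inv_inv] at this
  · rintro ⟨hc, h⟩
    unfold Conj
    rw [inv_inv]
    refine Finset.eq_of_subset_of_card_le (fun v hv => ?_) (by rw [hc1, hc2, hc])
    obtain ⟨i, hi, rfl⟩ := Finset.mem_image.1 hv
    obtain ⟨j, hj, e⟩ := h i hi
    rw [e]
    exact Finset.mem_image_of_mem _ hj

theorem countP_congr_forall₂ {α β : Type*} {R : α → β → Prop} {p : α → Bool} {q : β → Bool}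
    {l : List α} {l' : List β} (h : List.Forall₂ R l l') (hR : ∀ a b, R a b → p a = q b) :
    l.countP p = l'.countP q := by
  induction h with
  | nil => rfl
  | cons h _ ih => rw [List.countP_cons, List.countP_cons, ih, hR _ _ h]

variable (cs)

/-- Passing from `x` to `y = x⁻¹` makes all conditions refer to the images of simple roots under
`y`, so one table of signatures serves all `J`, `M`, `N`. -/
theorem count_eq [Fintype W] (J M N : Finset (Fin 4)) : count cs J M N =
    if M ⊆ J ∧ M.card = N.card then tableCount (mask J) (mask M) (mask N) else 0 := by
  classical
  unfold count
  by_cases hMJ : M ⊆ J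
  · rw [if_pos hMJ]
    by_cases hc : M.card = N.card
    · rw [if_pos ⟨hMJ, hc⟩]
      let p : W → Bool := fun y => decide ((∀ i ∈ J, Pos (act cs y (simpleRoot i))) ∧
        ∀ i ∈ M, ∃ j ∈ N, act cs y (simpleRoot i) = simpleRoot j)
      have h1 : ((reps cs J).filter fun x => Conj cs x M N).card =
          (Finset.univ.filter fun y => p y = true).card := by
        refine Finset.card_equiv (Equiv.inv W) fun x => ?_
        have hx := conj_inv_iff (cs := cs) (y := x⁻¹) (M := M) (N := N)
        rw [inv_inv] at hx
        rw [Finset.mem_filter, mem_reps, mem_minReps_iff, hx, Finset.mem_filter]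
        simp [p, hc]
      have h2 : (Finset.univ.filter fun y => p y = true) = ((elements cs).filter p).toFinset := by
        ext y
        simp [mem_elements]
      rw [h1, h2, List.toFinset_card_of_nodup ((enumerates_elements cs).1.filter p),
        ← List.countP_eq_length_filter, tableCount, ← countP_signatures, List.countP_map]
      refine countP_congr_forall₂ (forall₂_elements cs) fun y st hst => ?_
      rw [Function.comp, Bool.eq_iff_iff, okSignature_iff hst, decide_eq_true_iff]
    · rw [if_neg (fun h => hc h.2), Finset.card_eq_zero, Finset.filter_eq_empty_iff]
      intro x _ hx
      rw [← inv_inv x, conj_inv_iff] at hx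
      exact hc hx.1
  · rw [if_neg hMJ, if_neg fun h => hMJ h.1]

end TypeH4

/-! ## Longest elements and streets -/

namespace TypeH4

open Matrix

/-- A reduced word of the longest element of `W_L`. -/
def longestWord (L : Finset (Fin 4)) : List (Fin 4) :=
  match mask L with
  | 0 => []
  | 1 => [0]
  | 2 => [1]
  | 3 => [0, 1, 0, 1, 0]
  | 4 => [2]
  | 5 => [0, 2]
  | 6 => [1, 2, 1]
  -- For `H₃` and `H₄` the longest element is the power `h / 2` of a Coxeter element, with Coxeter
  -- numbers `h = 10` and `h = 30`.
  | 7 => (List.replicate 5 [0, 1, 2]).flatten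
  | 8 => [3]
  | 9 => [0, 3]
  | 10 => [1, 3]
  | 11 => [0, 1, 0, 1, 0, 3]
  | 12 => [2, 3, 2]
  | 13 => [0, 2, 3, 2]
  | 14 => [1, 2, 3, 1, 2, 1]
  | _ => (List.replicate 15 [0, 1, 2, 3]).flatten

/-- The permutation of `L` by the longest element of `W_L`. -/
def opp (L : Finset (Fin 4)) : Fin 4 → Fin 4 :=
  match mask L with
  | 3 | 11 => Equiv.swap 0 1
  | 6 => Equiv.swap 1 2
  | 12 | 13 => Equiv.swap 2 3
  | 14 => Equiv.swap 1 3
  -- The other longest elements act as `-1` on the span of the simple roots in `L`.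
  | _ => id

/-- The state of the product of a word. -/
def wordState (l : List (Fin 4)) : ℕ := l.foldr (fun i st => stepState i st) start

theorem longestWord_spec : ∀ L : Finset (Fin 4), (∀ i ∈ longestWord L, i ∈ L) ∧
    ∀ s ∈ L, opp L s ∈ L ∧ byte (wordState (longestWord L)) s = 60 + opp L s := by
  decide +kernel

theorem root_neg_simple : ∀ k : Fin 4, root (60 + k) = -simpleRoot k := by
  decide +kernel

theorem opp_mem {L : Finset (Fin 4)} {s : Fin 4} (hs : s ∈ L) : opp L s ∈ L :=
  ((longestWord_spec L).2 s hs).1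

variable {W : Type*} [Group W] (cs : CoxeterSystem coxeterH4 W)

theorem isState_wordProd (l : List (Fin 4)) : IsState cs (cs.wordProd l) (wordState l) := by
  induction l with
  | nil => exact isState_one cs
  | cons i l ih => rw [cs.wordProd_cons]; exact ih.step i

/-- An element `v` of maximal length in `W_L` makes every simple root of `L` negative, since
otherwise `v s` would be longer. As `g` maps these roots to negatives of simple roots of `L`, the
product `v g` makes them positive; the other simple roots keep their own coordinate. So `v g = 1`.
-/
theorem longestElement_eq {L : Finset (Fin 4)} {g : W} (hg : g ∈ par cs L) {σ : Fin 4 → Fin 4}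
    (h : ∀ s ∈ L, σ s ∈ L ∧ act cs g (simpleRoot s) = -simpleRoot (σ s)) :
    cs.longestElement L = g⁻¹ := by
  have := finite cs
  have hex : ∃ w ∈ par cs L, ∀ v ∈ par cs L, cs.length v ≤ cs.length w :=
    Set.exists_max_image (par cs L : Set W) cs.length (Set.toFinite _) ⟨1, one_mem _⟩
  unfold CoxeterSystem.longestElement
  rw [dif_pos hex]
  obtain ⟨hv, hmax⟩ := hex.choose_spec
  generalize hex.choose = v at hv hmax
  rw [eq_inv_iff_mul_eq_one]
  refine eq_one_of_pos cs fun i => ?_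
  by_cases hi : i ∈ L
  · obtain ⟨h1, h2⟩ := h i hi
    rw [act_mul, h2, act_neg]
    refine (pos_or_neg cs v (σ i)).resolve_left fun hp => ?_
    have h3 := (length_lt_mul_simple_iff cs v (σ i)).2 hp
    exact absurd (hmax _ (mul_mem hv (simple_mem_par cs h1))) (not_le.2 h3)
  · refine (pos_or_neg cs (v * g) i).resolve_right fun hn => ?_
    have h1 := act_apply_of_mem_par cs (mul_mem hv hg) hi (simpleRoot i)
    have h2 := hn i
    rw [Pi.neg_apply, h1] at h2
    revert h2
    simp only [simpleRoot, Pi.single_eq_same]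
    decide

theorem wordProd_mem_par {L : Finset (Fin 4)} {l : List (Fin 4)} (hl : ∀ i ∈ l, i ∈ L) :
    cs.wordProd l ∈ par cs L := by
  induction l with
  | nil => exact one_mem _
  | cons i l ih =>
    rw [cs.wordProd_cons]
    exact mul_mem (simple_mem_par cs (hl i List.mem_cons_self))
      (ih fun j hj => hl j (List.mem_cons_of_mem _ hj))

theorem longestElement_eq_wordProd (L : Finset (Fin 4)) :
    cs.longestElement L = (cs.wordProd (longestWord L))⁻¹ := by
  refine longestElement_eq cs (σ := opp L) ?_ fun s hs => ?_
  · exact wordProd_mem_par cs (longestWord_spec L).1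
  · obtain ⟨h1, h2⟩ := (longestWord_spec L).2 s hs
    refine ⟨h1, ?_⟩
    rw [((isState_wordProd cs _).2 s).2, h2, root_neg_simple]

theorem longestElement_mem_par (L : Finset (Fin 4)) : cs.longestElement L ∈ par cs L := by
  rw [longestElement_eq_wordProd]
  exact inv_mem (wordProd_mem_par cs (longestWord_spec L).1)

theorem act_longestElement_inv {L : Finset (Fin 4)} {s : Fin 4} (hs : s ∈ L) :
    act cs (cs.longestElement L)⁻¹ (simpleRoot s) = -simpleRoot (opp L s) := by
  rw [longestElement_eq_wordProd, inv_inv, ((isState_wordProd cs _).2 s).2,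
    ((longestWord_spec L).2 s hs).2, root_neg_simple]

theorem length_le_longestElement (w : W) :
    cs.length w ≤ cs.length (cs.longestElement Finset.univ) := by
  have := finite cs
  have htop : ∀ v : W, v ∈ par cs Finset.univ := by
    intro v
    unfold par
    rw [Finset.coe_univ, Set.image_univ, cs.subgroup_closure_range_simple]
    trivial
  have hex : ∃ w ∈ par cs Finset.univ, ∀ v ∈ par cs Finset.univ, cs.length v ≤ cs.length w :=
    Set.exists_max_image (par cs Finset.univ : Set W) cs.length (Set.toFinite _) ⟨1, one_mem _⟩
  unfold CoxeterSystem.longestElement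
  rw [dif_pos hex]
  exact hex.choose_spec.2 w (htop w)

theorem act_longestElement_univ_inv (v : RootSpace) :
    act cs (cs.longestElement Finset.univ)⁻¹ v = -v := by
  rw [act_eq_sum]
  conv_rhs => rw [← act_one cs v, act_eq_sum]
  rw [← Finset.sum_neg_distrib]
  refine Finset.sum_congr rfl fun i _ => ?_
  rw [act_longestElement_inv cs (Finset.mem_univ i), act_one]
  have : ∀ i, opp Finset.univ i = i := by decide
  rw [this, smul_neg]

/-- The inverse of the longest element acts as `-1`, which commutes with everything, and the
representation is faithful. -/
theorem longestElement_mem_center : cs.longestElement Finset.univ ∈ Subgroup.center W := by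
  rw [← inv_mem_iff, Subgroup.mem_center_iff]
  intro g
  refine eq_of_act_eq cs fun i => ?_
  rw [act_mul, act_mul, act_longestElement_univ_inv, act_longestElement_univ_inv, act_neg]

/-- The map `s ↦ s^d` on `L`, where `d = w_L w_M` and `M = L ∪ {r}`. -/
def conjMap (L : Finset (Fin 4)) (r s : Fin 4) : Fin 4 := opp (insert r L) (opp L s)

/-- Each of the two longest elements contributes a sign, and the signs cancel. -/
theorem act_longest_mul_longest {L : Finset (Fin 4)} (r : Fin 4) {s : Fin 4} (hs : s ∈ L) :
    act cs (cs.longestElement L * cs.longestElement (insert r L))⁻¹ (simpleRoot s) =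
      simpleRoot (conjMap L r s) := by
  rw [_root_.mul_inv_rev, act_mul, act_longestElement_inv cs hs, act_neg,
    act_longestElement_inv cs (Finset.mem_insert_of_mem (opp_mem hs)), neg_neg, conjMap]

theorem conjSubset_longest (L : Finset (Fin 4)) (r : Fin 4) :
    cs.conjSubset (cs.longestElement L * cs.longestElement (insert r L)) L =
      L.image (conjMap L r) := by
  refine conjSubset_eq cs ?_
  unfold Conj
  rw [Finset.image_image]
  exact Finset.image_congr fun s hs => act_longest_mul_longest cs r hs

theorem conjSimple_longest {L : Finset (Fin 4)} (r : Fin 4) {s : Fin 4} (hs : s ∈ L) :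
    cs.conjSimple (cs.longestElement L * cs.longestElement (insert r L)) s = conjMap L r s := by
  have h := act_longest_mul_longest cs r hs
  have hex : ∃ j, (cs.longestElement L * cs.longestElement (insert r L))⁻¹ * cs.simple s *
      (cs.longestElement L * cs.longestElement (insert r L)) = cs.simple j :=
    ⟨_, (inv_mul_simple_mul_eq_iff cs).2 (Or.inl h)⟩
  unfold CoxeterSystem.conjSimple
  rw [dif_pos hex]
  have h2 := (inv_mul_simple_mul_eq_iff cs).1 hex.choose_spec
  rw [h] at h2
  rcases h2 with h2 | h2
  · exact (simpleRoot_injective h2).symm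
  · exact absurd (h2 ▸ pos_simpleRoot _) (not_pos_neg_simpleRoot _)

/-- `pathAct` in terms of `conjMap`. -/
def pathStep {n : ℕ} (r : Fin 4) (p : Finset (Fin 4) × (Fin n → Fin 4)) :
    Finset (Fin 4) × (Fin n → Fin 4) :=
  (p.1.image (conjMap p.1 r), fun k => conjMap p.1 r (p.2 k))

/-- `conjMap` describes conjugation by `d` only on `L`, whence the condition on the entries of the
path. -/
theorem pathAct_eq {n : ℕ} (r : Fin 4) {p : Finset (Fin 4) × (Fin n → Fin 4)}
    (hp : ∀ k, p.2 k ∈ p.1) : cs.pathAct r p = pathStep r p :=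
  Prod.ext (conjSubset_longest cs p.1 r) (funext fun k => conjSimple_longest cs r (hp k))

/-- A set of paths that is closed under the action and all of whose elements can be reached in
at most one step is a street. -/
theorem street_eq {n : ℕ} {p : Finset (Fin 4) × (Fin n → Fin 4)}
    {T : Finset (Finset (Fin 4) × (Fin n → Fin 4))} (hp : p ∈ T)
    (hT : ∀ q ∈ T, (∀ k, q.2 k ∈ q.1) ∧ (∀ r, pathStep r q ∈ T) ∧
      (q = p ∨ ∃ r, q = pathStep r p)) : cs.street p = T := by
  ext q
  constructor
  · intro h
    change Relation.ReflTransGen _ _ _ at h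
    induction h with
    | refl => exact hp
    | tail _ hr ih =>
      obtain ⟨r, rfl⟩ := hr
      rw [pathAct_eq cs r (hT _ ih).1]
      exact (hT _ ih).2.1 r
  · intro hq
    rcases (hT q hq).2.2 with rfl | ⟨r, rfl⟩
    · exact Relation.ReflTransGen.refl
    · exact Relation.ReflTransGen.single ⟨r, (pathAct_eq cs r (hT p hp).1).symm⟩

theorem deltaStreet_eq {n : ℕ} {p : Finset (Fin 4) × (Fin n → Fin 4)}
    {T : Finset (Finset (Fin 4) × (Fin n → Fin 4))} (hT : cs.street p = T) :
    cs.DeltaStreet p = ∑ q ∈ T, cs.Delta n q := by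
  classical
  unfold CoxeterSystem.DeltaStreet
  refine Finset.sum_congr (Finset.ext fun q => ?_) fun _ _ => rfl
  rw [Finset.mem_filter, hT]
  simp

/-- `Δ(L; s)` as a linear combination of subsets. -/
def deltaOne (q : Finset (Fin 4) × (Fin 1 → Fin 4)) : List (Finset (Fin 4) × ℤ) :=
  [(q.1.erase (q.2 0), 1),
    ((q.1.erase (q.2 0)).image (conjMap (q.1.erase (q.2 0)) (q.2 0)), -1)]

/-- `Δ(L; s, t)` as a linear combination of subsets. -/
def deltaTwo (p : Finset (Fin 4) × (Fin 2 → Fin 4)) : List (Finset (Fin 4) × ℤ) :=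
  deltaOne (p.1.erase (p.2 0), Fin.tail p.2) ++
    (deltaOne (pathStep (p.2 0) (p.1.erase (p.2 0), Fin.tail p.2))).map fun t => (t.1, -t.2)

/-- The value of a linear combination. -/
def combo {α A : Type*} [AddCommGroup A] (v : α → A) (l : List (α × ℤ)) : A :=
  (l.map fun t => t.2 • v t.1).sum

theorem Delta_one (q : Finset (Fin 4) × (Fin 1 → Fin 4)) :
    cs.Delta 1 q = combo cs.e (deltaOne q) := by
  rw [CoxeterSystem.Delta]
  rw [pathAct_eq cs _ (fun k => k.elim0), CoxeterSystem.Delta, CoxeterSystem.Delta]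
  simp [combo, deltaOne, pathStep, sub_eq_add_neg, -zsmul_eq_mul]

theorem combo_append {α A : Type*} [AddCommGroup A] (v : α → A) (l l' : List (α × ℤ)) :
    combo v (l ++ l') = combo v l + combo v l' := by
  simp [combo]

theorem combo_neg {α A : Type*} [AddCommGroup A] (v : α → A) (l : List (α × ℤ)) :
    combo v (l.map fun t => (t.1, -t.2)) = -combo v l := by
  induction l with
  | nil => simp [combo]
  | cons a l ih =>
    simp only [combo, List.map_cons, List.sum_cons] at ih ⊢
    rw [ih, neg_smul, neg_add]

theorem Delta_two {p : Finset (Fin 4) × (Fin 2 → Fin 4)} (h0 : p.2 0 ≠ p.2 1)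
    (h1 : p.2 1 ∈ p.1) : cs.Delta 2 p = combo cs.e (deltaTwo p) := by
  rw [CoxeterSystem.Delta]
  rw [pathAct_eq cs, Delta_one, Delta_one, deltaTwo, combo_append, combo_neg, sub_eq_add_neg]
  intro k
  rw [Subsingleton.elim k 0]
  exact Finset.mem_erase.2 ⟨h0.symm, h1⟩

end TypeH4

/-! ## The generators of the descent algebra and their products -/

namespace TypeH4

/-- The nonzero numbers of `x ∈ X_K` with `L ^ x = P`, `L ⊆ K`, as triples `(L, P, _)`. -/
def countTable : ℕ → List (Fin 16 × Fin 16 × ℕ)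
  | 0 =>
    [(0,0,14400)]
  | 1 =>
    [(0,0,7200), (1,1,120), (1,2,120), (1,4,120), (1,8,120)]
  | 2 =>
    [(0,0,7200), (2,1,120), (2,2,120), (2,4,120), (2,8,120)]
  | 3 =>
    [(0,0,1440), (1,1,60), (1,2,60), (1,4,60), (1,8,60), (2,1,60), (2,2,60), (2,4,60), (2,8,60),
    (3,3,20)]
  | 4 =>
    [(0,0,7200), (4,1,120), (4,2,120), (4,4,120), (4,8,120)]
  | 5 =>
    [(0,0,3600), (1,1,60), (1,2,60), (1,4,60), (1,8,60), (4,1,60), (4,2,60), (4,4,60), (4,8,60),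
    (5,5,8), (5,9,8), (5,10,8)]
  | 6 =>
    [(0,0,2400), (2,1,60), (2,2,60), (2,4,60), (2,8,60), (4,1,60), (4,2,60), (4,4,60), (4,8,60),
    (6,6,12), (6,12,12)]
  | 7 =>
    [(0,0,120), (1,1,12), (1,2,10), (1,4,10), (1,8,10), (2,1,12), (2,2,14), (2,4,12), (2,8,10),
    (3,3,10), (4,1,6), (4,2,6), (4,4,8), (4,8,10), (5,5,4), (5,9,4), (5,10,4), (6,6,6), (6,12,6),
    (7,7,2)]
  | 8 =>
    [(0,0,7200), (8,1,120), (8,2,120), (8,4,120), (8,8,120)]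
  | 9 =>
    [(0,0,3600), (1,1,60), (1,2,60), (1,4,60), (1,8,60), (8,1,60), (8,2,60), (8,4,60), (8,8,60),
    (9,5,8), (9,9,8), (9,10,8)]
  | 10 =>
    [(0,0,3600), (2,1,60), (2,2,60), (2,4,60), (2,8,60), (8,1,60), (8,2,60), (8,4,60), (8,8,60),
    (10,5,8), (10,9,8), (10,10,8)]
  | 11 =>
    [(0,0,720), (1,1,30), (1,2,30), (1,4,30), (1,8,30), (2,1,30), (2,2,30), (2,4,30), (2,8,30),
    (3,3,10), (8,1,12), (8,2,12), (8,4,12), (8,8,12), (9,5,4), (9,9,4), (9,10,4), (10,5,4),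
    (10,9,4), (10,10,4), (11,11,2)]
  | 12 =>
    [(0,0,2400), (4,1,60), (4,2,60), (4,4,60), (4,8,60), (8,1,60), (8,2,60), (8,4,60), (8,8,60),
    (12,6,12), (12,12,12)]
  | 13 =>
    [(0,0,1200), (1,1,20), (1,2,20), (1,4,20), (1,8,20), (4,1,30), (4,2,30), (4,4,30), (4,8,30),
    (5,5,4), (5,9,4), (5,10,4), (8,1,30), (8,2,30), (8,4,30), (8,8,30), (9,5,4), (9,9,4),
    (9,10,4), (12,6,6), (12,12,6), (13,13,2)]
  | 14 =>
    [(0,0,600), (2,1,18), (2,2,18), (2,4,18), (2,8,20), (4,1,24), (4,2,24), (4,4,24), (4,8,20),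
    (6,6,6), (6,12,6), (8,1,18), (8,2,18), (8,4,18), (8,8,20), (10,5,4), (10,9,4), (10,10,4),
    (12,6,6), (12,12,6), (14,14,2)]
  | _ =>
    [(0,0,1), (1,1,1), (2,2,1), (3,3,1), (4,4,1), (5,5,1), (6,6,1), (7,7,1), (8,8,1), (9,9,1),
    (10,10,1), (11,11,1), (12,12,1), (13,13,1), (14,14,1), (15,15,1)]

/-- The vertices and edges of the quiver. -/
abbrev Gen := H4Vertex ⊕ Σ v w : H4Vertex, H4Edge v w

/-- The generators in a fixed order. -/
def genList : List Gen :=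
  [.inl .empty, .inl .A1, .inl .A11, .inl .A2, .inl .H2, .inl .A21, .inl .H21, .inl .A3, .inl .H3,
    .inl .H4, .inr ⟨_, _, .A11_H4_a⟩, .inr ⟨_, _, .A11_H4_b⟩, .inr ⟨_, _, .A2_H4⟩,
    .inr ⟨_, _, .A1_A3⟩, .inr ⟨_, _, .A1_H3_a⟩, .inr ⟨_, _, .A1_H3_b⟩]

theorem mem_genList (p : Gen) : p ∈ genList := by
  rcases p with v | ⟨v, w, e⟩
  · cases v <;> simp [genList]
  · cases e <;> simp [genList]

/-- The generators as linear combinations of the `e_L`. -/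
def genCombo : Gen → List (Fin 16 × ℤ)
  | .inl .empty => [(0, 1)]
  | .inl .A1 => [(1, 1), (2, 1), (4, 1), (8, 1)]
  | .inl .A11 => [(5, 1), (9, 1), (10, 1)]
  | .inl .A2 => [(6, 1), (12, 1)]
  | .inl .H2 => [(3, 1)]
  | .inl .A21 => [(13, 1)]
  | .inl .H21 => [(11, 1)]
  | .inl .A3 => [(14, 1)]
  | .inl .H3 => [(7, 1)]
  | .inl .H4 => [(15, 1)]
  | .inr ⟨_, _, .A11_H4_a⟩ => [(5, -2), (9, 2)]
  | .inr ⟨_, _, .A11_H4_b⟩ => [(9, -2), (10, 2)]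
  | .inr ⟨_, _, .A2_H4⟩ => [(6, -2), (12, 2)]
  | .inr ⟨_, _, .A1_A3⟩ => [(2, 2), (4, -4), (8, 2)]
  | .inr ⟨_, _, .A1_H3_a⟩ => [(2, -2), (4, 2)]
  | .inr ⟨_, _, .A1_H3_b⟩ => [(1, -2), (2, 2)]

/-- The coefficients of the `x_K` with respect to the generators. -/
def coeffTable : ℕ → List ℤ
  -- Trailing zeros are omitted: `xCombo` zips the list with `genList`, which drops the generators
  -- without an entry.
  | 0 => [14400]
  | 1 => [7200, 120, 0, 0, 0, 0, 0, 0, 0, 0, 0, 0, 0, -60, -180, -180]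
  | 2 => [7200, 120, 0, 0, 0, 0, 0, 0, 0, 0, 0, 0, 0, -60, -180, 60]
  | 3 => [1440, 120, 0, 0, 20, 0, 0, 0, 0, 0, 0, 0, 0, -60, -180, -60]
  | 4 => [7200, 120, 0, 0, 0, 0, 0, 0, 0, 0, 0, 0, 0, -60, 60, 60]
  | 5 => [3600, 120, 8, 0, 0, 0, 0, 0, 0, 0, -8, -4, 0, -60, -60, -60]
  | 6 => [2400, 120, 0, 12, 0, 0, 0, 0, 0, 0, 0, 0, -6, -60, -60, 60]
  | 7 => [120, 30, 4, 6, 10, 0, 0, 0, 2, 0, -4, -2, -3, -15, -30, -6]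
  | 8 => [7200, 120, 0, 0, 0, 0, 0, 0, 0, 0, 0, 0, 0, 180, 300, 60]
  | 9 => [3600, 120, 8, 0, 0, 0, 0, 0, 0, 0, 4, -4, 0, 60, 60, -60]
  | 10 => [3600, 120, 8, 0, 0, 0, 0, 0, 0, 0, 4, 8, 0, 60, 60, 60]
  | 11 => [720, 72, 8, 0, 10, 0, 2, 0, 0, 0, 4, 2, 0, -12, -60, -24]
  | 12 => [2400, 120, 0, 12, 0, 0, 0, 0, 0, 0, 0, 0, 6, 60, 180, 60]
  | 13 => [1200, 80, 8, 6, 0, 2, 0, 0, 0, 0, -2, -4, 3, 20, 60]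
  | 14 => [600, 60, 4, 12, 0, 0, 0, 2, 0, 0, 2, 4, 0, 7, 30, 30]
  | _ => [1, 1, 1, 1, 1, 1, 1, 1, 1, 1]

/-- The element `x_K` as a linear combination of the generators. -/
def xCombo (k : Fin 16) : List (Gen × ℤ) := genList.zip (coeffTable k)

/-- The product of two generators. -/
def genMul : Gen → Gen → Option Gen
  | .inl v, .inl w => if v = w then some (.inl v) else none
  | .inl v, .inr e => if v = e.1 then some (.inr e) else none
  | .inr e, .inl w => if e.2.1 = w then some (.inr e) else none
  | .inr _, .inr _ => none

/-- The sixteen subsets of `S`. -/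
def subsets : Fin 16 ≃ Finset (Fin 4) where
  toFun n := Finset.univ.filter fun i => Nat.testBit n i
  invFun J := Fin.ofNat 16 (mask J)
  left_inv := by
    have : ∀ n : Fin 16, Fin.ofNat 16 (mask (Finset.univ.filter fun i : Fin 4 =>
      Nat.testBit n i)) = n := by decide +kernel
    exact this
  right_inv := by
    have : ∀ J : Finset (Fin 4), (Finset.univ.filter fun i : Fin 4 =>
      Nat.testBit (Fin.ofNat 16 (mask J)) i) = J := by decide +kernel
    exact this

theorem mask_subsets : ∀ n : Fin 16, mask (subsets n) = n := by decide +kernel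

/-- The coefficient in a linear combination. -/
def coeff (l : List (Fin 16 × ℤ)) (n : Fin 16) : ℤ :=
  (l.map fun t => if t.1 = n then t.2 else 0).sum

/-- A multiple of a linear combination. -/
def scale {α : Type*} (c : ℤ) (l : List (α × ℤ)) : List (α × ℤ) := l.map fun t => (t.1, c * t.2)

/-- The sum over `L` of `e_L` times the number of `x ∈ X_K` with `L ^ x = P`. -/
def column (k p : Fin 16) : List (Fin 16 × ℤ) :=
  (countTable k).flatMap fun t => if t.2.1 = p then [(t.1, (t.2.2 : ℤ))] else []

/-- The entries of `countTable` are justified here by the tally of signatures; pairs that are not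
listed have count 0. -/
theorem countTable_spec : ∀ k l p : Fin 16,
    (if subsets l ⊆ subsets k ∧ (subsets l).card = (subsets p).card then tableCount k l p else 0) =
      ((countTable k).map fun t => if t.2.1 = p then (if t.1 = l then t.2.2 else 0) else 0).sum := by
  decide +kernel

/-- On the left stands `x_K = ∑_L m_{KL} e_L`. Since the `x_K` span the descent algebra, the
identity shows that the generators do. -/
theorem coeff_xCombo : ∀ k l : Fin 16, coeff ((List.finRange 16).flatMap (column k)) l =
    coeff ((xCombo k).flatMap fun t => scale t.2 (genCombo t.1)) l := by
  decide +kernel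

/-- The left side is the product of a generator and `x_K` by `e_mul_x`, the right side the same
product by the rules of the path algebra. This finite check makes the linear isomorphism
multiplicative. -/
theorem coeff_mul : ∀ p ∈ genList, ∀ k l : Fin 16,
    coeff ((genCombo p).flatMap fun t => scale t.2 (column k t.1)) l =
      coeff ((xCombo k).flatMap fun t =>
        scale t.2 (((genMul p t.1).map genCombo).getD [])) l := by
  decide +kernel

end TypeH4

/-! ## The descent algebra as a path algebra -/

namespace TypeH4

section Combo

variable {α β A : Type*} [AddCommGroup A]

theorem combo_flatMap (v : α → A) (l : List β) (f : β → List (α × ℤ)) :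
    combo v (l.flatMap f) = (l.map fun t => combo v (f t)).sum := by
  induction l with
  | nil => rfl
  | cons t l ih => rw [List.flatMap_cons, combo_append, ih, List.map_cons, List.sum_cons]

theorem combo_scale (v : α → A) (c : ℤ) (l : List (α × ℤ)) :
    combo v (scale c l) = c • combo v l := by
  induction l with
  | nil => simp [combo, scale]
  | cons t l ih =>
    simp only [combo, scale, List.map_cons, List.sum_cons] at ih ⊢
    rw [ih, smul_add, mul_smul]

theorem combo_eq_sum (v : Fin 16 → A) (l : List (Fin 16 × ℤ)) :
    combo v l = ∑ n, coeff l n • v n := by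
  induction l with
  | nil => simp [combo, coeff]
  | cons t l ih =>
    simp only [combo, coeff, List.map_cons, List.sum_cons] at ih ⊢
    simp [ih, add_smul, Finset.sum_add_distrib]

theorem combo_congr (v : Fin 16 → A) {l l' : List (Fin 16 × ℤ)}
    (h : ∀ n, coeff l n = coeff l' n) : combo v l = combo v l' := by
  rw [combo_eq_sum, combo_eq_sum]
  exact Finset.sum_congr rfl fun n _ => by rw [h n]

theorem map_combo {A' F : Type*} [AddCommGroup A'] [FunLike F A A'] [AddMonoidHomClass F A A']
    (f : F) (v : α → A) (l : List (α × ℤ)) : f (combo v l) = combo (fun a => f (v a)) l := by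
  simp [combo, map_list_sum, Function.comp_def]

theorem combo_map (v : α → A) (g : β → α) (l : List (β × ℤ)) :
    combo v (l.map fun t => (g t.1, t.2)) = combo (fun b => v (g b)) l := by
  simp [combo, Function.comp_def]

end Combo

theorem coeff_column (k p l : Fin 16) : coeff (column k p) l =
    (((countTable k).map fun t =>
      if t.2.1 = p then (if t.1 = l then t.2.2 else 0) else 0).sum : ℕ) := by
  unfold column coeff
  induction countTable k with
  | nil => rfl
  | cons t L ih =>
    rw [List.flatMap_cons, List.map_append, List.sum_append, ih]
    simp only [List.map_cons, List.sum_cons]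
    by_cases h1 : t.2.1 = p <;> by_cases h2 : t.1 = l <;> simp [h1, h2]

variable {W : Type*} [Group W] (cs : CoxeterSystem coxeterH4 W)

theorem count_subsets [Fintype W] (k l p : Fin 16) :
    (count cs (subsets k) (subsets l) (subsets p) : ℤ) = coeff (column k p) l := by
  rw [count_eq, mask_subsets, mask_subsets, mask_subsets, countTable_spec, coeff_column]

/-- The elements `e_L`. -/
noncomputable def eFin (n : Fin 16) : cs.descentAlgebra := cs.e (subsets n)

/-- The generators in the descent algebra. -/
noncomputable def gen (p : Gen) : cs.descentAlgebra := combo (eFin cs) (genCombo p)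

theorem sum_count_smul [Fintype W] (k p : Fin 16) :
    ∑ L, (count cs (subsets k) L (subsets p) : ℚ) • cs.e L = combo (eFin cs) (column k p) := by
  refine (Equiv.sum_comp subsets _).symm.trans ?_
  rw [combo_eq_sum]
  refine Finset.sum_congr rfl fun l _ => ?_
  rw [← count_subsets cs, eFin, natCast_zsmul, Nat.cast_smul_eq_nsmul]

theorem x_eq_combo (k : Fin 16) : cs.x (subsets k) = combo (gen cs) (xCombo k) := by
  have := finite cs
  let := Fintype.ofFinite W
  have h1 : cs.x (subsets k) = combo (eFin cs) ((List.finRange 16).flatMap (column k)) := by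
    rw [combo_flatMap, x_eq_sum, ← List.ofFn_eq_map, List.sum_ofFn]
    simp only [mMatrix_eq, Finset.sum_smul]
    rw [Finset.sum_comm]
    refine (Equiv.sum_comp subsets _).symm.trans ?_
    exact Finset.sum_congr rfl fun p _ => sum_count_smul cs k p
  rw [h1, combo_congr _ (coeff_xCombo k), combo_flatMap]
  simp only [combo_scale]
  rfl

theorem gen_mul_x (p : Gen) (k : Fin 16) : gen cs p * cs.x (subsets k) =
    combo (fun q => (genMul p q).elim 0 (gen cs)) (xCombo k) := by
  have := finite cs
  let := Fintype.ofFinite W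
  have h1 : gen cs p * cs.x (subsets k) =
      combo (eFin cs) ((genCombo p).flatMap fun t => scale t.2 (column k t.1)) := by
    rw [combo_flatMap]
    simp only [combo_scale]
    have h := map_combo (AddMonoidHom.mulRight (cs.x (subsets k))) (eFin cs) (genCombo p)
    rw [AddMonoidHom.mulRight_apply] at h
    rw [gen, h, combo]
    congr 1
    refine List.map_congr_left fun t _ => ?_
    rw [AddMonoidHom.mulRight_apply, eFin, e_mul_x, sum_count_smul]
  rw [h1, combo_congr _ (coeff_mul p (mem_genList p) k), combo_flatMap]
  simp only [combo_scale]
  rw [combo]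
  congr 1
  refine List.map_congr_left fun t _ => ?_
  cases genMul p t.1 <;> simp [gen, combo]

/-! ### The paths of the quiver -/

/-- Edges start at `A11`, `A2`, `A1` and end at `H4`, `A3`, `H3`. So vertices and edges are all the
paths there are. -/
theorem not_composable {u v w : H4Vertex} (e : H4Edge u v) (f : H4Edge v w) : False := by
  cases e <;> cases f

/-- The vertices and edges as paths. -/
def genPath : Gen ≃ Σ a b : H4Vertex, Quiver.Path a b where
  toFun
    | .inl v => ⟨v, v, Quiver.Path.nil⟩
    | .inr ⟨v, w, e⟩ => ⟨v, w, Quiver.Hom.toPath (V := H4Vertex) (a := v) (b := w) e⟩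
  invFun
    | ⟨v, _, Quiver.Path.nil⟩ => .inl v
    | ⟨_, _, Quiver.Path.cons (b := b) (c := c) _ e⟩ => .inr ⟨b, c, e⟩
  left_inv := by rintro (v | ⟨v, w, e⟩) <;> rfl
  right_inv := by
    rintro ⟨v, w, (_ | ⟨p, e⟩)⟩
    · rfl
    · rcases p with _ | ⟨p, f⟩
      · rfl
      · exact (not_composable f e).elim

/-- Elements of the path algebra as functions on the set of paths. -/
noncomputable def pathCoeff :
    PathAlgebra ℚ H4Vertex ≃ₗ[ℚ] ((Σ a b : H4Vertex, Quiver.Path a b) →₀ ℚ) where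
  toFun x := x
  invFun x := x
  left_inv _ := rfl
  right_inv _ := rfl
  map_add' _ _ := rfl
  map_smul' _ _ := rfl

/-- The basis of the path algebra. -/
noncomputable def pathBasis : Module.Basis Gen ℚ (PathAlgebra ℚ H4Vertex) :=
  Module.Basis.ofRepr (pathCoeff.trans (Finsupp.domLCongr genPath.symm))

theorem pathBasis_apply (p : Gen) :
    pathBasis p = PathAlgebra.ofPath ℚ (genPath p).2.2 := by
  have h : pathBasis p = pathCoeff.symm (Finsupp.single (genPath p) 1) := by
    simp [pathBasis]
  rw [h]
  rfl

theorem pathBasis_mul (p q : Gen) :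
    pathBasis p * pathBasis q = (genMul p q).elim 0 pathBasis := by
  simp only [pathBasis_apply]
  rcases p with v | ⟨v, w, e⟩ <;> rcases q with v' | ⟨v', w', f⟩
  · by_cases h : v = v'
    · subst h
      simp only [genMul, if_true, Option.elim_some, pathBasis_apply]
      exact PathAlgebra.ofPath_mul_comp _ _
    · simp only [genMul, if_neg h, Option.elim_none]
      exact PathAlgebra.ofPath_mul_ne _ _ h
  · by_cases h : v = v'
    · subst h
      simp only [genMul, if_true, Option.elim_some, pathBasis_apply]
      exact (PathAlgebra.ofPath_mul_comp _ _).trans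
        (congrArg (PathAlgebra.ofPath ℚ) (Quiver.Path.nil_comp _))
    · simp only [genMul, if_neg h, Option.elim_none]
      exact PathAlgebra.ofPath_mul_ne _ _ h
  · by_cases h : w = v'
    · subst h
      simp only [genMul, if_true, Option.elim_some, pathBasis_apply]
      exact PathAlgebra.ofPath_mul_comp _ _
    · simp only [genMul, if_neg h, Option.elim_none]
      exact PathAlgebra.ofPath_mul_ne _ _ h
  · simp only [genMul, Option.elim_none]
    refine PathAlgebra.ofPath_mul_ne _ _ ?_
    cases e <;> cases f <;> simp [genPath]

theorem genMul_xUniv : combo pathBasis (xCombo 15) = 1 := by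
  have h : xCombo 15 = ([.empty, .A1, .A11, .A2, .H2, .A21, .H21, .A3, .H3, .H4] :
      List H4Vertex).map fun v => (.inl v, 1) := rfl
  rw [h, PathAlgebra.one_eq]
  simp only [combo, List.map_map, Function.comp_def, one_smul, pathBasis_apply]
  rfl

/-! ### The isomorphism -/

theorem surjective_genList : Function.Surjective fun i : Fin 16 => genList[i] := by
  intro p
  obtain ⟨i, hi, h⟩ := List.getElem_of_mem (mem_genList p)
  exact ⟨⟨i, hi⟩, h⟩


/-- The inverse of `w_L` occurs in `x_J` exactly if `J` and `L` are disjoint. With `L` the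
complement of `K`, a linear relation says that the coefficients of the subsets of `K` add up to
zero, and induction on `K` applies. -/
theorem linearIndependent_xSum : LinearIndependent ℚ cs.xSum := by
  classical
  have := finite cs
  let := Fintype.ofFinite W
  rw [Fintype.linearIndependent_iff]
  intro a ha
  have hmem : ∀ J L, cs.longestElement L ∈ reps cs J ↔ Disjoint J L := by
    intro J L
    rw [mem_reps, mem_minReps_iff, Finset.disjoint_left]
    refine forall₂_congr fun i _ => ?_
    by_cases hi : i ∈ L
    · rw [act_longestElement_inv cs hi]
      exact iff_of_false (not_pos_neg_simpleRoot _) (by simpa using hi)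
    · refine iff_of_true ?_ hi
      refine (pos_or_neg cs _ i).resolve_right fun hn => ?_
      have h1 := act_apply_of_mem_par cs (inv_mem (longestElement_mem_par cs L)) hi (simpleRoot i)
      have h2 := hn i
      rw [Pi.neg_apply, h1] at h2
      revert h2
      simp only [simpleRoot, Pi.single_eq_same]
      decide
  have h1 : ∀ L, ∑ J, (if Disjoint J L then a J else 0) = 0 := by
    intro L
    have h := congrArg (fun x => x.coeff (cs.longestElement L)⁻¹) ha
    simp only [xSum_eq_sum, MonoidAlgebra.coeff_sum, MonoidAlgebra.coeff_smul,
      MonoidAlgebra.coeff_zero, Finsupp.coe_finsetSum, Finset.sum_apply, Finsupp.smul_apply,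
      MonoidAlgebra.of_apply, Finsupp.zero_apply] at h
    refine Eq.trans ?_ h
    refine Finset.sum_congr rfl fun J _ => ?_
    simp [Finsupp.single_apply, hmem]
  have h2 : a = 0 := by
    funext K
    induction K using Finset.strongInduction with
    | H K ih =>
      have h := h1 Kᶜ
      rw [Finset.sum_eq_single K] at h
      · rwa [if_pos disjoint_compl_right] at h
      · intro J _ hJ
        split_ifs with hd
        · exact ih J (Finset.ssubset_iff_subset_ne.2
            ⟨by simpa using hd.le_compl_right, hJ⟩)
        · rfl
      · intro h; exact absurd (Finset.mem_univ K) h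
  exact fun K => congrFun h2 K

theorem span_x : Submodule.span ℚ (Set.range cs.x) = ⊤ := by
  have := finite cs
  let := Fintype.ofFinite W
  rw [eq_top_iff]
  rintro ⟨y, hy⟩ -
  have hy' : y ∈ Submodule.span ℚ (Set.range cs.xSum) := by
    rw [← toSubmodule_descentAlgebra]; exact hy
  have h : Submodule.map cs.descentAlgebra.val.toLinearMap
      (Submodule.span ℚ (Set.range cs.x)) = Submodule.span ℚ (Set.range cs.xSum) := by
    rw [Submodule.map_span, ← Set.range_comp]
    rfl
  rw [← h] at hy'
  obtain ⟨z, hz, e⟩ := hy'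
  rwa [show (⟨y, hy⟩ : cs.descentAlgebra) = z from Subtype.ext e.symm]

theorem finrank_descentAlgebra : Module.finrank ℚ cs.descentAlgebra = 16 := by
  have h : LinearIndependent ℚ cs.x :=
    LinearIndependent.of_comp cs.descentAlgebra.val.toLinearMap (linearIndependent_xSum cs)
  rw [Module.finrank_eq_card_basis (Module.Basis.mk h (span_x cs).ge), ← Fintype.card_congr subsets,
    Fintype.card_fin]

theorem x_univ : cs.x Finset.univ = 1 := by
  have := finite cs
  let := Fintype.ofFinite W
  exact Subtype.ext (xSum_univ cs)

/-- The linear map from the path algebra. -/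
noncomputable def pathLinear : PathAlgebra ℚ H4Vertex →ₗ[ℚ] cs.descentAlgebra :=
  pathBasis.constr ℚ (gen cs)

theorem pathLinear_basis (p : Gen) : pathLinear cs (pathBasis p) = gen cs p :=
  pathBasis.constr_basis ℚ _ p

theorem pathLinear_xCombo (k : Fin 16) :
    pathLinear cs (combo pathBasis (xCombo k)) = cs.x (subsets k) := by
  rw [map_combo, x_eq_combo]
  simp only [pathLinear_basis]

/-- Every `x_K` is in the image, so the map is onto. The source has dimension at most 16, the number
of generators, and the target has dimension 16. -/
theorem pathLinear_bijective : Function.Bijective (pathLinear cs) := by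
  have hs : Function.Surjective (pathLinear cs) := by
    rw [← LinearMap.range_eq_top, eq_top_iff, ← span_x, Submodule.span_le]
    rintro _ ⟨K, rfl⟩
    refine ⟨_, (pathLinear_xCombo cs (subsets.symm K)).trans ?_⟩
    rw [Equiv.apply_symm_apply]
  have := Finite.of_surjective _ surjective_genList
  have : Module.Finite ℚ (PathAlgebra ℚ H4Vertex) := Module.Finite.of_basis pathBasis
  have : Module.Finite ℚ cs.descentAlgebra := Module.finite_of_finrank_pos (by
    rw [finrank_descentAlgebra]; norm_num)
  refine ⟨(LinearMap.injective_iff_surjective_of_finrank_eq_finrank ?_).2 hs, hs⟩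
  refine le_antisymm ?_ (LinearMap.finrank_le_finrank_of_surjective hs)
  rw [finrank_descentAlgebra, Module.finrank_eq_nat_card_basis pathBasis]
  exact (Nat.card_le_card_of_surjective _ surjective_genList).trans (Nat.card_fin 16).le

/-- A statement about the path algebra alone, but pulled back from `span_x` along the linear
isomorphism. -/
theorem span_xCombo {W : Type*} [Group W] (cs : CoxeterSystem coxeterH4 W) :
    Submodule.span ℚ (Set.range fun k => combo pathBasis (xCombo k)) = ⊤ := by
  refine Submodule.map_injective_of_injective (pathLinear_bijective cs).1 ?_
  rw [Submodule.map_span, ← Set.range_comp, Submodule.map_top,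
    LinearMap.range_eq_top.2 (pathLinear_bijective cs).2, ← span_x]
  congr 1
  rw [← subsets.surjective.range_comp]
  exact congrArg Set.range (funext fun k => pathLinear_xCombo cs k)

/-- By bilinearity the first factor may be a generator and the second the preimage of some `x_K`;
the product is then known from `gen_mul_x`. -/
theorem pathLinear_mul (y z : PathAlgebra ℚ H4Vertex) :
    pathLinear cs (y * z) = pathLinear cs y * pathLinear cs z := by
  have h : (LinearMap.mul ℚ _).compr₂ (pathLinear cs) =
      (LinearMap.mul ℚ _).compl₁₂ (pathLinear cs) (pathLinear cs) := by
    refine pathBasis.ext fun p => ?_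
    refine LinearMap.ext_on_range (span_xCombo cs) fun k => ?_
    rw [LinearMap.compr₂_apply, LinearMap.compl₁₂_apply, LinearMap.mul_apply', LinearMap.mul_apply',
      pathLinear_xCombo, pathLinear_basis, gen_mul_x, ← AddMonoidHom.coe_mulLeft, map_combo,
      map_combo]
    congr 1
    funext q
    rw [AddMonoidHom.coe_mulLeft, pathBasis_mul]
    cases genMul p q
    · exact map_zero _
    · exact pathLinear_basis cs _
  exact congrArg (fun f => f y z) h

/-- The isomorphism from the path algebra to the descent algebra. -/
noncomputable def pathEquiv : PathAlgebra ℚ H4Vertex ≃ₐ[ℚ] cs.descentAlgebra :=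
  AlgEquiv.ofBijective (AlgHom.ofLinearMap (pathLinear cs) (by
    rw [← genMul_xUniv, pathLinear_xCombo, ← x_univ]
    congr 1) (pathLinear_mul cs)) (pathLinear_bijective cs)

theorem pathEquiv_basis (p : Gen) : pathEquiv cs (pathBasis p) = gen cs p :=
  pathLinear_basis cs p

end TypeH4

/-! ## Classes and streets -/

namespace TypeH4

/-- `N` belongs to `[J]` if some `x ∈ X_J` has `J^x = N`, that is, if the count for `J`, `J`, `N` is
nonzero. So the classes can be read off the table. -/
theorem coeff_vertex : ∀ v : H4Vertex, ∀ n : Fin 16, coeff (genCombo (.inl v)) n =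
    if coeff (column (subsets.symm v.rep) n) (subsets.symm v.rep) = 0 then 0 else 1 := by
  decide +kernel

theorem exists_vertex : ∀ j : Fin 16, ∃ v : H4Vertex, ∀ n : Fin 16,
    coeff (column j n) j = 0 ↔ coeff (column (subsets.symm v.rep) n) (subsets.symm v.rep) = 0 := by
  decide +kernel

theorem eq_of_coeff_ne_zero : ∀ v w : H4Vertex,
    coeff (column (subsets.symm w.rep) (subsets.symm v.rep)) (subsets.symm w.rep) ≠ 0 → v = w := by
  decide +kernel

variable {W : Type*} [Group W] (cs : CoxeterSystem coxeterH4 W)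

theorem mem_parabolicClass_iff_coeff {M N : Finset (Fin 4)} : N ∈ cs.parabolicClass M ↔
    coeff (column (subsets.symm M) (subsets.symm N)) (subsets.symm M) ≠ 0 := by
  have := finite cs
  let := Fintype.ofFinite W
  rw [mem_parabolicClass_iff, ← count_subsets cs, Equiv.apply_symm_apply, Equiv.apply_symm_apply,
    Nat.cast_ne_zero]

theorem parabolicClass_injective :
    Function.Injective fun v : H4Vertex => cs.parabolicClass v.rep := by
  have := finite cs
  let := Fintype.ofFinite W
  intro v w h
  refine eq_of_coeff_ne_zero v w ((mem_parabolicClass_iff_coeff cs).1 ?_)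
  rw [← show cs.parabolicClass v.rep = cs.parabolicClass w.rep from h, mem_parabolicClass_iff]
  exact count_self_ne_zero cs _

theorem range_parabolicClass :
    Set.range (fun v : H4Vertex => cs.parabolicClass v.rep) = Set.range cs.parabolicClass := by
  refine Set.Subset.antisymm (Set.range_subset_iff.2 fun v => ⟨_, rfl⟩)
    (Set.range_subset_iff.2 fun J => ?_)
  obtain ⟨v, hv⟩ := exists_vertex (subsets.symm J)
  refine ⟨v, Set.ext fun N => ?_⟩
  rw [mem_parabolicClass_iff_coeff, mem_parabolicClass_iff_coeff, not_iff_not, hv]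

theorem gen_vertex (v : H4Vertex) : gen cs (.inl v) = cs.eClass v.rep := by
  classical
  unfold CoxeterSystem.eClass gen
  rw [combo_eq_sum, Finset.sum_filter, ← Equiv.sum_comp subsets]
  refine Finset.sum_congr rfl fun n _ => ?_
  rw [coeff_vertex, mem_parabolicClass_iff_coeff, Equiv.symm_apply_apply]
  by_cases h : coeff (column (subsets.symm v.rep) n) (subsets.symm v.rep) = 0 <;> simp [h, eFin]

/-- The list `T` is a candidate for the street, confirmed by `street_eq`; what remains is a
comparison of coefficients. -/
theorem deltaStreet_eq_combo {p : Finset (Fin 4) × (Fin 2 → Fin 4)}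
    (T : List (Finset (Fin 4) × (Fin 2 → Fin 4))) {l : List (Fin 16 × ℤ)}
    (hp : T.Nodup ∧ p ∈ T) (hT : ∀ q ∈ T, ((∀ k, q.2 k ∈ q.1) ∧ q.2 0 ≠ q.2 1) ∧
      (∀ r, pathStep r q ∈ T) ∧ (q = p ∨ ∃ r, q = pathStep r p))
    (hl : ∀ n, coeff (T.flatMap fun q => (deltaTwo q).map fun t => (subsets.symm t.1, t.2)) n =
      coeff l n) : combo (eFin cs) l = cs.DeltaStreet p := by
  have hs : cs.street p = T.toFinset := by
    refine street_eq cs (List.mem_toFinset.2 hp.2) fun q hq => ?_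
    obtain ⟨h1, h2, h3⟩ := hT q (List.mem_toFinset.1 hq)
    exact ⟨h1.1, fun r => List.mem_toFinset.2 (h2 r), h3⟩
  rw [deltaStreet_eq cs hs, List.sum_toFinset _ hp.1, ← combo_congr _ hl, combo_flatMap]
  congr 1
  refine List.map_congr_left fun q hq => ?_
  obtain ⟨⟨h1, h2⟩, -⟩ := hT q hq
  rw [Delta_two cs h2 (h1 1), combo_map]
  simp only [eFin, Equiv.apply_symm_apply]

theorem gen_edge {v w : H4Vertex} (e : H4Edge v w) :
    gen cs (.inr ⟨v, w, e⟩) = cs.DeltaStreet e.path := by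
  unfold gen
  cases e
  · exact deltaStreet_eq_combo cs [(Finset.univ, ![1, 2])] (by decide +kernel)
      (by decide +kernel) (by decide +kernel)
  · exact deltaStreet_eq_combo cs [(Finset.univ, ![2, 0])] (by decide +kernel)
      (by decide +kernel) (by decide +kernel)
  · exact deltaStreet_eq_combo cs [(Finset.univ, ![0, 1])] (by decide +kernel)
      (by decide +kernel) (by decide +kernel)
  -- The only street with two paths: `w_L` of type `A₃` exchanges the ends of the diagram while
  -- `w_S` acts as `-1`, so the action of `0` replaces `1` by `3`. For the other edges both longest
  -- elements act as `-1` on `L` and fix the path.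
  · exact deltaStreet_eq_combo cs [({1, 2, 3}, ![1, 2]), ({1, 2, 3}, ![3, 2])]
      (by decide +kernel) (by decide +kernel) (by decide +kernel)
  · exact deltaStreet_eq_combo cs [({0, 1, 2}, ![0, 1])] (by decide +kernel)
      (by decide +kernel) (by decide +kernel)
  · exact deltaStreet_eq_combo cs [({0, 1, 2}, ![2, 0])] (by decide +kernel)
      (by decide +kernel) (by decide +kernel)

theorem hasType_of_injective {C : Type*} {N : CoxeterMatrix C} {J : Finset (Fin 4)}
    (f : C → Fin 4) (hf : Function.Injective f) (hJ : ∀ i, i ∈ J ↔ ∃ c, f c = i)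
    (h : ∀ c c', Nat.beq (N c c') (coxeterH4 (f c) (f c')) = true) : coxeterH4.HasType J N :=
  ⟨(Equiv.ofInjective f hf).trans (Equiv.subtypeEquivRight fun i => (hJ i).symm),
    fun c c' => Nat.eq_of_beq_eq_true (h c c')⟩

theorem hasType_rep (v : H4Vertex) : coxeterH4.HasType v.rep v.type.2 := by
  cases v
  · exact hasType_of_injective (C := Fin 0) ![] (by decide) (by decide) fun c => c.elim0
  · exact hasType_of_injective (C := Fin 1) ![0] (by decide) (by decide) (by decide)
  · exact hasType_of_injective (C := Fin 1 ⊕ Fin 1) (Sum.elim ![0] ![2]) (by decide) (by decide)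
      (by decide)
  · exact hasType_of_injective (C := Fin 2) ![1, 2] (by decide) (by decide) (by decide)
  · exact hasType_of_injective (C := Fin 2) ![0, 1] (by decide) (by decide) (by decide)
  · exact hasType_of_injective (C := Fin 2 ⊕ Fin 1) (Sum.elim ![2, 3] ![0]) (by decide)
      (by decide) (by decide)
  · exact hasType_of_injective (C := Fin 2 ⊕ Fin 1) (Sum.elim ![0, 1] ![3]) (by decide)
      (by decide) (by decide)
  · exact hasType_of_injective (C := Fin 3) ![1, 2, 3] (by decide) (by decide) (by decide)
  -- The standard diagrams `H₃` and `H₄` have the bond 5 at the other end.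
  · exact hasType_of_injective (C := Fin 3) ![2, 1, 0] (by decide) (by decide) (by decide)
  · exact hasType_of_injective (C := Fin 4) ![3, 2, 1, 0] (by decide) (by decide) (by decide)

/-! ### The numbers of edges -/

/-- The indices are exchanged because an arrow `v ⟶ w` gives a copy of the simple module at `v` in
the radical of the projective at `w`. -/
theorem card_edge (v w : H4Vertex) : Nat.card (v ⟶ w) = H4loewy 1 w v := by
  change Nat.card (H4Edge v w) = _
  have h1 : Nat.card (H4Edge .A11 .H4) = 2 := Nat.card_eq_of_equiv_fin
    { toFun := fun | .A11_H4_a => 0 | .A11_H4_b => 1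
      invFun := ![.A11_H4_a, .A11_H4_b]
      left_inv := by rintro (_ | _) <;> rfl
      right_inv := by intro i; fin_cases i <;> rfl }
  have h2 : Nat.card (H4Edge .A2 .H4) = 1 := Nat.card_eq_of_equiv_fin
    { toFun := fun | .A2_H4 => 0
      invFun := ![.A2_H4]
      left_inv := by rintro ⟨⟩; rfl
      right_inv := by intro i; fin_cases i; rfl }
  have h3 : Nat.card (H4Edge .A1 .A3) = 1 := Nat.card_eq_of_equiv_fin
    { toFun := fun | .A1_A3 => 0
      invFun := ![.A1_A3]
      left_inv := by rintro ⟨⟩; rfl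
      right_inv := by intro i; fin_cases i; rfl }
  have h4 : Nat.card (H4Edge .A1 .H3) = 2 := Nat.card_eq_of_equiv_fin
    { toFun := fun | .A1_H3_a => 0 | .A1_H3_b => 1
      invFun := ![.A1_H3_a, .A1_H3_b]
      left_inv := by rintro (_ | _) <;> rfl
      right_inv := by intro i; fin_cases i <;> rfl }
  cases v <;> cases w <;>
    first
      | exact h1
      | exact h2
      | exact h3
      | exact h4
      | exact Nat.card_eq_zero.2 (Or.inl ⟨nofun⟩)

instance finite_edge (v w : H4Vertex) : Finite (v ⟶ w) := by
  have : Finite Gen := Finite.of_surjective _ surjective_genList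
  refine Finite.of_injective (β := Gen) (fun e : H4Edge v w => .inr ⟨v, w, e⟩) fun e f h => ?_
  simpa using h

instance (v : H4Vertex) : Decidable v.IsEven := inferInstanceAs (Decidable (Even v.rep.card))

theorem card_vertex : Nat.card H4Vertex = 10 := by
  rw [Nat.card_eq_fintype_card]
  decide

theorem card_edges : Nat.card (Σ v w : H4Vertex, (v ⟶ w)) = 6 := by
  simp only [Nat.card_sigma, card_edge]
  decide +kernel

theorem card_edges_even :
    Nat.card (Σ v w : {v : H4Vertex // v.IsEven}, (v.1 ⟶ w.1)) = 3 := by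
  simp only [Nat.card_sigma, card_edge]
  decide +kernel

theorem card_edges_odd :
    Nat.card (Σ v w : {v : H4Vertex // ¬ v.IsEven}, (v.1 ⟶ w.1)) = 3 := by
  simp only [Nat.card_sigma, card_edge]
  decide +kernel

/-- An involution that exchanges the even and the odd part of the quiver. -/
def dual : H4Vertex → H4Vertex
  | .H4 => .A1
  | .A1 => .H4
  | .A11 => .H3
  | .H3 => .A11
  | .A2 => .A3
  | .A3 => .A2
  | .empty => .A21
  | .A21 => .empty
  | .H2 => .H21
  | .H21 => .H2

theorem dual_dual (v : H4Vertex) : dual (dual v) = v := by cases v <;> rfl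

theorem isEven_iff_dual : ∀ v : H4Vertex, v.IsEven ↔ ¬ (dual v).IsEven := by decide

theorem loewy_dual : ∀ v w : H4Vertex, v.IsEven → w.IsEven →
    H4loewy 1 w v = H4loewy 1 (dual v) (dual w) := by
  decide +kernel

/-- Exchanging `H4` with `A1`, `A11` with `H3` and `A2` with `A3` reverses the edges. The four other
vertices are isolated, and their pairing is arbitrary. -/
theorem exists_duality :
    ∃ σ : {v : H4Vertex // v.IsEven} ≃ {v : H4Vertex // ¬ v.IsEven},
      ∀ v w, Nonempty ((v.1 ⟶ w.1) ≃ ((σ w).1 ⟶ (σ v).1)) := by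
  refine ⟨(Function.Involutive.toPerm dual dual_dual).subtypeEquiv isEven_iff_dual, fun v w => ?_⟩
  refine Finite.card_eq.1 ?_
  rw [card_edge, card_edge, loewy_dual v w v.2 w.2]
  rfl

end TypeH4

/-! ## Path algebras of quivers without paths of length two -/

open Module

/-- An algebra with a basis of orthogonal idempotents `ε v`, `v ∈ V`, with sum `1`, and elements
`α e`, `e ∈ E`, that are arrows from `src e` to `tgt e ≠ src e` and have the products `0`. -/
structure ArrowBasis (k A V E : Type*) [Field k] [Ring A] [Algebra k A] [DecidableEq V]
    [Fintype V] where
  /-- The basis. -/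
  basis : Basis (V ⊕ E) k A
  /-- The source of an arrow. -/
  src : E → V
  /-- The target of an arrow. -/
  tgt : E → V
  src_ne_tgt : ∀ e, src e ≠ tgt e
  idem_mul_idem : ∀ v w, basis (.inl v) * basis (.inl w) = if v = w then basis (.inl v) else 0
  idem_mul_arrow : ∀ v e, basis (.inl v) * basis (.inr e) =
    if v = src e then basis (.inr e) else 0
  arrow_mul_idem : ∀ e v, basis (.inr e) * basis (.inl v) =
    if tgt e = v then basis (.inr e) else 0
  arrow_mul_arrow : ∀ e f, basis (.inr e) * basis (.inr f) = 0
  sum_idem : ∑ v, basis (.inl v) = 1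

/-- The one-dimensional module given by a character. -/
def CharModule {k A : Type*} [Field k] [Ring A] (_χ : A →+* k) : Type _ := k

namespace CharModule

variable {k A : Type*} [Field k] [Ring A] (χ : A →+* k)

noncomputable instance : AddCommGroup (CharModule χ) := inferInstanceAs (AddCommGroup k)

noncomputable instance : Module A (CharModule χ) := Module.compHom k χ

/-- An element of the field as an element of the module. -/
def of (c : k) : CharModule χ := c

theorem smul_def (a : A) (c : k) : a • of χ c = of χ (χ a * c) := rfl

theorem isSimpleModule (hχ : Function.Surjective χ) : IsSimpleModule A (CharModule χ) := by
  have : Nontrivial (CharModule χ) := inferInstanceAs (Nontrivial k)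
  rw [isSimpleModule_iff_toSpanSingleton_surjective]
  refine ⟨this, fun m hm c => ?_⟩
  obtain ⟨a, ha⟩ := hχ ((show k from c) * (show k from m)⁻¹)
  refine ⟨a, ?_⟩
  change χ a * (show k from m) = (show k from c)
  rw [ha, inv_mul_cancel_right₀ hm]

end CharModule

namespace ArrowBasis

variable {k A V E : Type*} [Field k] [Ring A] [Algebra k A] [DecidableEq V] [Fintype V]
  (B : ArrowBasis k A V E)

/-- The idempotent at a vertex. -/
noncomputable def idem (v : V) : A := B.basis (.inl v)

/-- The starting point of a basis element. -/
def start : V ⊕ E → V := Sum.elim id B.src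

/-- The end point of a basis element. -/
def finish : V ⊕ E → V := Sum.elim id B.tgt

/-- The coordinates. -/
noncomputable def coord (p : V ⊕ E) : A →ₗ[k] k := B.basis.coord p

theorem coord_basis (p q : V ⊕ E) [Decidable (q = p)] :
    B.coord p (B.basis q) = if q = p then 1 else 0 := by
  classical
  rw [coord, Basis.coord_apply, Basis.repr_self, Finsupp.single_apply]

theorem ext_coord {x y : A} (h : ∀ p, B.coord p x = B.coord p y) : x = y :=
  B.basis.ext_elem h

/-- The idempotent at `v` occurs in a product of basis elements only as its own square, so its
coordinate is a character of the algebra. -/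
theorem coord_inl_mul (v : V) (x y : A) :
    B.coord (.inl v) (x * y) = B.coord (.inl v) x * B.coord (.inl v) y := by
  classical
  have h : (LinearMap.mul k A).compr₂ (B.coord (.inl v)) =
      (LinearMap.mul k k).compl₁₂ (B.coord (.inl v)) (B.coord (.inl v)) := by
    refine B.basis.ext fun p => B.basis.ext fun q => ?_
    simp only [LinearMap.compr₂_apply, LinearMap.compl₁₂_apply, LinearMap.mul_apply']
    rcases p with u | e <;> rcases q with u' | f
    · rw [B.idem_mul_idem]
      by_cases h : u = u'
      · subst h; simp [coord_basis]
      · rw [if_neg h, map_zero, coord_basis, coord_basis]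
        by_cases h' : u = v
        · subst h'; simp [Ne.symm h]
        · simp [h']
    · rw [B.idem_mul_arrow]; split_ifs <;> simp [coord_basis]
    · rw [B.arrow_mul_idem]; split_ifs <;> simp [coord_basis]
    · rw [B.arrow_mul_arrow]; simp [coord_basis]
  exact congrArg (fun f => f x y) h

/-- An arrow occurs in a product of basis elements only as source times arrow or arrow times target.
With `coord_inl_mul`, this reduces computations in `A` to coordinates. -/
theorem coord_inr_mul (e : E) (x y : A) : B.coord (.inr e) (x * y) =
    B.coord (.inl (B.src e)) x * B.coord (.inr e) y +
      B.coord (.inr e) x * B.coord (.inl (B.tgt e)) y := by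
  classical
  have h : (LinearMap.mul k A).compr₂ (B.coord (.inr e)) =
      (LinearMap.mul k k).compl₁₂ (B.coord (.inl (B.src e))) (B.coord (.inr e)) +
        (LinearMap.mul k k).compl₁₂ (B.coord (.inr e)) (B.coord (.inl (B.tgt e))) := by
    refine B.basis.ext fun p => B.basis.ext fun q => ?_
    simp only [LinearMap.compr₂_apply, LinearMap.compl₁₂_apply, LinearMap.mul_apply',
      LinearMap.add_apply]
    rcases p with u | f <;> rcases q with u' | f'
    · rw [B.idem_mul_idem]; split_ifs <;> simp [coord_basis]
    · rw [B.idem_mul_arrow]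
      by_cases h : f' = e
      · subst h; by_cases h' : u = B.src f' <;> simp [coord_basis, h']
      · split_ifs <;> simp [coord_basis, h]
    · rw [B.arrow_mul_idem]
      by_cases h : f = e
      · subst h
        by_cases h' : u' = B.tgt f
        · simp [coord_basis, h']
        · simp [coord_basis, h', Ne.symm h']
      · split_ifs <;> simp [coord_basis, h]
    · rw [B.arrow_mul_arrow]; simp [coord_basis]
  exact congrArg (fun f => f x y) h

theorem coord_mul_idem (p : V ⊕ E) (x : A) (v : V) :
    B.coord p (x * B.idem v) = if B.finish p = v then B.coord p x else 0 := by
  classical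
  rcases p with u | e
  · rw [coord_inl_mul, idem, coord_basis]
    by_cases h : u = v
    · simp [finish, h]
    · simp [finish, h, Ne.symm h]
  · rw [coord_inr_mul, idem, coord_basis, coord_basis]
    by_cases h : B.tgt e = v
    · simp [finish, h]
    · simp [finish, h, Ne.symm h]

theorem coord_idem_mul (p : V ⊕ E) (x : A) (v : V) :
    B.coord p (B.idem v * x) = if B.start p = v then B.coord p x else 0 := by
  classical
  rcases p with u | e
  · rw [coord_inl_mul, idem, coord_basis]
    by_cases h : u = v
    · simp [start, h]
    · simp [start, h, Ne.symm h]
  · rw [coord_inr_mul, idem, coord_basis, coord_basis]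
    by_cases h : B.src e = v
    · simp [start, h]
    · simp [start, h, Ne.symm h]

theorem coord_one (v : V) : B.coord (.inl v) 1 = 1 := by
  classical
  rw [← B.sum_idem, map_sum]
  simp [coord_basis]

/-- The character at a vertex. -/
noncomputable def character (v : V) : A →+* k where
  toFun := B.coord (.inl v)
  map_one' := B.coord_one v
  map_mul' := B.coord_inl_mul v
  map_zero' := map_zero _
  map_add' := map_add _

theorem character_apply (v : V) (x : A) : B.character v x = B.coord (.inl v) x := rfl

theorem character_idem (v w : V) : B.character v (B.idem w) = if w = v then 1 else 0 := by
  classical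
  rw [character_apply, idem, coord_basis]
  simp

theorem character_surjective (v : V) : Function.Surjective (B.character v) := fun c =>
  ⟨c • 1, by rw [character_apply, map_smul, coord_one, smul_eq_mul, mul_one]⟩

theorem idem_mul_self (v : V) : B.idem v * B.idem v = B.idem v := by
  rw [idem, idem_mul_idem, if_pos rfl]

/-! ### The radical of the algebra -/

/-- Characters map the radical into that of the field, which is zero. Conversely, the elements
without vertex coordinates form an ideal of square zero. -/
theorem mem_ring_jacobson_iff {x : A} : x ∈ Ring.jacobson A ↔ ∀ v, B.coord (.inl v) x = 0 := by
  constructor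
  · intro hx v
    have : RingHomSurjective (B.character v) := ⟨B.character_surjective v⟩
    have h := Ring.le_comap_jacobson (B.character v) hx
    rw [Ideal.mem_comap, Ring.jacobson, IsSemisimpleModule.jacobson_eq_bot] at h
    exact h
  · intro hx
    have h : Ring.jacobson A = Ideal.jacobson ⊥ := by
      rw [Ring.jacobson_eq_sInf_isMaximal, Ideal.jacobson]
      simp
    rw [h, Ideal.mem_jacobson_iff]
    intro y
    -- The inverse of `1 + y x`, as `(y x)² = 0`.
    refine ⟨1 - y * x, ?_⟩
    have hy : (y * x) * (y * x) = 0 := by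
      refine B.ext_coord fun p => ?_
      rcases p with v | e
      · simp [coord_inl_mul, hx]
      · simp [coord_inr_mul, coord_inl_mul, hx]
    rw [Submodule.mem_bot, show (1 - y * x) * y * x + (1 - y * x) - 1 = -((y * x) * (y * x)) by
      noncomm_ring, hy, neg_zero]

theorem restrictScalars_jacobson : (Ring.jacobson A).restrictScalars k =
    Submodule.span k (B.basis '' Set.range Sum.inr) := by
  refine Submodule.ext fun x => ?_
  rw [Submodule.restrictScalars_mem, B.mem_ring_jacobson_iff, Basis.mem_span_image]
  constructor
  · intro h p hp
    rcases p with v | e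
    · exact absurd (h v) (Finsupp.mem_support_iff.1 hp)
    · exact ⟨e, rfl⟩
  · intro h v
    by_contra hv
    obtain ⟨e, he⟩ := h (Finsupp.mem_support_iff.2 hv)
    cases he

/-- Multiplication by the two idempotents keeps the coordinates of the basis elements from `v` to
`w` and deletes all others. -/
theorem cornerSpace_span (S : Set (V ⊕ E)) (v w : V) :
    cornerSpace (B.idem v) (B.idem w) (Submodule.span k (B.basis '' S)) =
      Submodule.span k (B.basis '' {p | p ∈ S ∧ B.start p = v ∧ B.finish p = w}) := by
  have key : ∀ p x, B.coord p (B.idem v * (x * B.idem w)) =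
      if B.start p = v ∧ B.finish p = w then B.coord p x else 0 := by
    intro p x
    rw [coord_idem_mul, coord_mul_idem]
    split_ifs <;> tauto
  refine Submodule.ext fun x => ?_
  simp only [cornerSpace, Submodule.mem_map, Basis.mem_span_image]
  constructor
  · rintro ⟨y, hy, rfl⟩ p hp
    have hp' : B.coord p (B.idem v * (y * B.idem w)) ≠ 0 := Finsupp.mem_support_iff.1 hp
    rw [key] at hp'
    split_ifs at hp' with h
    · exact ⟨hy (Finsupp.mem_support_iff.2 hp'), h⟩
    · exact absurd rfl hp'
  · intro h
    refine ⟨x, fun p hp => (h hp).1, B.ext_coord fun p => (key p x).trans ?_⟩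
    split_ifs with hp
    · rfl
    · by_contra hc
      exact hp (h (Finsupp.mem_support_iff.2 (Ne.symm hc))).2

theorem finrank_span_basis (S : Set (V ⊕ E)) :
    finrank k (Submodule.span k (B.basis '' S)) = Nat.card S := by
  have h : LinearIndependent k fun p : S => B.basis p :=
    B.basis.linearIndependent.comp _ Subtype.val_injective
  rw [Set.image_eq_range, finrank_eq_nat_card_basis (Basis.span h)]

theorem gabrielArrows_eq (v w : V) : gabrielArrows k (B.idem v) (B.idem w) =
    Nat.card {e // B.src e = v ∧ B.tgt e = w} := by
  have h0 : (Ring.jacobson A).restrictScalars k * (Ring.jacobson A).restrictScalars k = ⊥ := by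
    rw [eq_bot_iff, Submodule.mul_le]
    intro x hx y hy
    rw [Submodule.restrictScalars_mem, B.mem_ring_jacobson_iff] at hx hy
    refine B.ext_coord fun p => ?_
    rcases p with v | e
    · simp [coord_inl_mul, hx]
    · simp [coord_inr_mul, hx, hy]
  unfold gabrielArrows
  dsimp only
  have h1 : (cornerSpace (B.idem v) (B.idem w) (⊥ : Submodule k A)) = ⊥ := Submodule.map_bot _
  rw [h0, h1, (Submodule.quotEquivOfEqBot _ (Submodule.ker_subtype _)).finrank_eq, B.restrictScalars_jacobson,
    cornerSpace_span, finrank_span_basis]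
  refine (Nat.card_congr (Equiv.ofBijective
    (fun e => (⟨.inr e.1, ⟨e.1, rfl⟩, e.2⟩ : {p | p ∈ Set.range Sum.inr ∧
      B.start p = v ∧ B.finish p = w})) ⟨fun e f h => ?_, ?_⟩)).symm
  · exact Subtype.ext (Sum.inr_injective (congrArg Subtype.val h))
  · rintro ⟨_, ⟨e, rfl⟩, h⟩
    exact ⟨⟨e, h⟩, rfl⟩

theorem finrank_cornerSpace_top (v w : V) :
    finrank k (cornerSpace (B.idem v) (B.idem w) (⊤ : Submodule k A)) =
      Nat.card {p // B.start p = v ∧ B.finish p = w} := by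
  rw [← B.basis.span_eq, ← Set.image_univ, cornerSpace_span, finrank_span_basis]
  simp only [Set.mem_univ, true_and]
  rfl

/-! ### The indecomposable projective modules -/

/-- The left ideal generated by an idempotent. -/
noncomputable abbrev proj (v : V) : Submodule A A := principalLeftIdeal (B.idem v)

theorem mem_proj_iff {v : V} {x : A} : x ∈ B.proj v ↔ x * B.idem v = x := by
  unfold proj principalLeftIdeal
  rw [Submodule.mem_span_singleton]
  constructor
  · rintro ⟨a, rfl⟩
    rw [smul_eq_mul, mul_assoc, idem_mul_self]
  · intro h
    exact ⟨x, h⟩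

theorem coord_eq_zero_of_mem_proj {v : V} {x : A} (hx : x ∈ B.proj v) {p : V ⊕ E}
    (hp : B.finish p ≠ v) : B.coord p x = 0 := by
  rw [← (B.mem_proj_iff).1 hx, coord_mul_idem, if_neg hp]

theorem mem_proj_of_coord {v : V} {x : A} (h : ∀ p, B.finish p ≠ v → B.coord p x = 0) :
    x ∈ B.proj v := by
  rw [mem_proj_iff]
  refine B.ext_coord fun p => ?_
  rw [coord_mul_idem]
  split_ifs with hp
  · rfl
  · exact (h p hp).symm

theorem idem_mem_proj (v : V) : B.idem v ∈ B.proj v := B.mem_proj_iff.2 (B.idem_mul_self v)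

theorem isInternal_proj : DirectSum.IsInternal B.proj := by
  -- Right multiplication by the idempotent at `w` recovers the component in `B.proj w`, whence
  -- injectivity.
  have hmul : ∀ (x : DirectSum V fun v => B.proj v) (w : V),
      DirectSum.coeAddMonoidHom B.proj x * B.idem w = x w := by
    intro x w
    induction x using DirectSum.induction_on with
    | zero => simp
    | of v y =>
      rw [DirectSum.coeAddMonoidHom_of]
      by_cases h : v = w
      · subst h
        rw [DirectSum.of_eq_same]
        exact B.mem_proj_iff.1 y.2
      · rw [DirectSum.of_eq_of_ne _ _ _ (Ne.symm h)]
        have h2 : (y : A) * B.idem w = 0 := by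
          rw [← B.mem_proj_iff.1 y.2, mul_assoc, idem, idem, idem_mul_idem, if_neg h, mul_zero]
        exact h2
    | add x y hx hy => rw [map_add, add_mul, hx, hy]; rfl
  constructor
  · intro x y h
    refine DFinsupp.ext fun w => Subtype.ext ?_
    rw [← hmul, ← hmul, h]
  · intro x
    refine ⟨∑ v, DirectSum.of (fun v => B.proj v) v
      ⟨x * B.idem v, Submodule.mem_span_singleton.2 ⟨x, rfl⟩⟩, ?_⟩
    rw [map_sum]
    simp only [DirectSum.coeAddMonoidHom_of]
    rw [← Finset.mul_sum]
    exact (congrArg (x * ·) B.sum_idem).trans (mul_one x)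

/-- The map from a projective module to its head. -/
noncomputable def toHead (v : V) : B.proj v →ₗ[A] CharModule (B.character v) where
  toFun x := CharModule.of _ (B.character v x)
  map_add' x y := map_add (B.character v) x.1 y.1
  map_smul' a x := map_mul (B.character v) a x.1

theorem toHead_idem (v : V) :
    B.toHead v ⟨_, B.idem_mem_proj v⟩ = CharModule.of _ 1 := by
  change CharModule.of _ (B.character v (B.idem v)) = _
  rw [character_idem, if_pos rfl]

theorem toHead_surjective (v : V) : Function.Surjective (B.toHead v) := by
  intro c
  obtain ⟨a, ha⟩ := B.character_surjective v c
  refine ⟨a • ⟨_, B.idem_mem_proj v⟩, ?_⟩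
  rw [map_smul, toHead_idem, CharModule.smul_def, mul_one, ha]
  rfl

theorem mem_ker_toHead {v : V} {x : B.proj v} :
    x ∈ LinearMap.ker (B.toHead v) ↔ B.coord (.inl v) (x : A) = 0 := Iff.rfl

/-- If `x ∈ N` has a coordinate `c ≠ 0` at `v`, then multiplying `x` by the idempotent at `v` gives
`c` times this idempotent, because no arrow is a loop; so `N` contains the generator. The kernel is
thus the largest proper submodule, which gives the head and indecomposability. -/
theorem le_ker_toHead {v : V} {N : Submodule A (B.proj v)} (hN : N ≠ ⊤) :
    N ≤ LinearMap.ker (B.toHead v) := by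
  intro x hx
  rw [mem_ker_toHead]
  by_contra hc
  refine hN (eq_top_iff.2 fun y _ => ?_)
  have h1 : B.idem v * (x : A) = B.coord (.inl v) (x : A) • B.idem v := by
    refine B.ext_coord fun p => ?_
    classical
    rw [coord_idem_mul, map_smul, idem, coord_basis, smul_eq_mul]
    by_cases hp : p = .inl v
    · subst hp; simp [start]
    · rw [if_neg (Ne.symm hp), mul_zero]
      split_ifs with hs
      · refine B.coord_eq_zero_of_mem_proj x.2 ?_
        rcases p with u | e
        · exact fun h => hp (congrArg Sum.inl h)
        · exact fun h => B.src_ne_tgt e (hs.trans h.symm)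
      · rfl
  have h2 : (y : A) = (((B.coord (.inl v) (x : A))⁻¹ • (y : A)) * B.idem v) * (x : A) := by
    rw [mul_assoc, h1, mul_smul_comm, smul_mul_assoc, smul_smul, mul_inv_cancel₀ hc, one_smul,
      B.mem_proj_iff.1 y.2]
  have h3 : y = (((B.coord (.inl v) (x : A))⁻¹ • (y : A)) * B.idem v) • x := Subtype.ext h2
  rw [h3]
  exact N.smul_mem _ hx

theorem isSimpleModule_char (v : V) : IsSimpleModule A (CharModule (B.character v)) :=
  CharModule.isSimpleModule _ (B.character_surjective v)

theorem isCoatom_ker_toHead (v : V) : IsCoatom (LinearMap.ker (B.toHead v)) := by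
  have := B.isSimpleModule_char v
  rw [← isSimpleModule_iff_isCoatom]
  exact IsSimpleModule.congr
    ((B.toHead v).quotKerEquivOfSurjective (B.toHead_surjective v))

theorem jacobson_proj (v : V) : Module.jacobson A (B.proj v) = LinearMap.ker (B.toHead v) :=
  le_antisymm (sInf_le (B.isCoatom_ker_toHead v)) (le_sInf fun _ hN =>
    ((hN.le_iff_eq (B.isCoatom_ker_toHead v).1).1 (B.le_ker_toHead hN.1)).le)

/-- The head of a projective module. -/
noncomputable def headEquiv (v : V) :
    ModuleHead A (B.proj v) ≃ₗ[A] CharModule (B.character v) :=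
  (Submodule.quotEquivOfEq _ _ (B.jacobson_proj v)).trans
    ((B.toHead v).quotKerEquivOfSurjective (B.toHead_surjective v))

theorem isIndecomposableModule_proj (v : V) : IsIndecomposableModule A (B.proj v) := by
  constructor
  · have : Nontrivial (CharModule (B.character v)) := inferInstanceAs (Nontrivial k)
    exact (B.toHead_surjective v).nontrivial
  · intro N N' h
    by_cases hN : N = ⊤
    · exact Or.inr (by simpa [hN] using h.disjoint)
    · by_cases hN' : N' = ⊤
      · exact Or.inl (by simpa [hN'] using h.disjoint)
      · refine absurd ?_ (B.isCoatom_ker_toHead v).1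
        rw [eq_top_iff, ← h.sup_eq_top]
        exact sup_le (B.le_ker_toHead hN) (B.le_ker_toHead hN')

theorem isSimpleModule_head (v : V) : IsSimpleModule A (ModuleHead A (B.proj v)) := by
  have := B.isSimpleModule_char v
  exact IsSimpleModule.congr (B.headEquiv v)

/-- The idempotent at `v` acts as the identity on the head at `v` and as zero on the heads at other
vertices. -/
theorem eq_of_headEquiv {v w : V}
    (f : ModuleHead A (B.proj v) ≃ₗ[A] ModuleHead A (B.proj w)) : v = w := by
  let g : CharModule (B.character v) ≃ₗ[A] CharModule (B.character w) :=
    (B.headEquiv v).symm.trans (f.trans (B.headEquiv w))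
  by_contra hvw
  have h1 : B.idem v • CharModule.of (B.character v) 1 = CharModule.of (B.character v) 1 := by
    rw [CharModule.smul_def, character_idem, if_pos rfl, mul_one]
  have h2 := congrArg g h1
  rw [map_smul] at h2
  have h3 : ∀ c : CharModule (B.character w), B.idem v • c = 0 := fun c => by
    change B.character w (B.idem v) * (show k from c) = (0 : k)
    rw [character_idem, if_neg hvw, zero_mul]
  rw [h3, ← map_zero g] at h2
  exact zero_ne_one (α := k) (g.injective h2)

/-! ### The radicals of the projective modules -/

/-- The coordinates of the radical of a projective module. -/
noncomputable def radCoord (v : V) : LinearMap.ker (B.toHead v) →ₗ[A]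
    ((e : {e // B.tgt e = v}) → CharModule (B.character (B.src e))) where
  toFun x e := CharModule.of _ (B.coord (.inr e) (x : A))
  map_add' x y := funext fun e => map_add (B.coord (.inr e.1)) (x : A) (y : A)
  map_smul' a x := funext fun e => by
    -- Elements of the kernel have no coordinate at `v`, so the second term of the product rule
    -- vanishes and `a` acts through the character at the source of `e`.
    refine (B.coord_inr_mul e.1 a (x : A)).trans ?_
    rw [e.2, B.mem_ker_toHead.1 x.2, mul_zero, add_zero]
    rfl

theorem radCoord_bijective [Finite E] (v : V) : Function.Bijective (B.radCoord v) := by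
  classical
  constructor
  · rw [injective_iff_map_eq_zero]
    intro x hx
    refine Subtype.ext (Subtype.ext (B.ext_coord fun p => ?_))
    rw [ZeroMemClass.coe_zero, ZeroMemClass.coe_zero, map_zero]
    by_cases hp : B.finish p = v
    · rcases p with u | e
      · rw [show u = v from hp]
        exact x.2
      · exact congrFun hx ⟨e, hp⟩
    · exact B.coord_eq_zero_of_mem_proj x.1.2 hp
  · intro c
    let f : V ⊕ E → k := Sum.elim 0 fun e => if h : B.tgt e = v then c ⟨e, h⟩ else 0
    have hf : ∀ p, B.coord p (B.basis.equivFun.symm f) = f p := by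
      intro p
      have h := congrFun (B.basis.equivFun.apply_symm_apply f) p
      rwa [Basis.equivFun_apply] at h
    refine ⟨⟨⟨B.basis.equivFun.symm f, B.mem_proj_of_coord fun p hp => ?_⟩, ?_⟩, ?_⟩
    · rw [hf]
      rcases p with u | e
      · rfl
      · exact dif_neg hp
    · rw [mem_ker_toHead, hf]
      rfl
    · funext e
      refine (hf (.inr e.1)).trans ?_
      exact dif_pos e.2

/-- The radical of a projective module is a direct sum of simple modules. -/
noncomputable def radEquiv [Finite E] (v : V) : LinearMap.ker (B.toHead v) ≃ₗ[A]
    ((e : {e // B.tgt e = v}) → CharModule (B.character (B.src e))) :=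
  LinearEquiv.ofBijective (B.radCoord v) (B.radCoord_bijective v)

theorem jacobson_ker_toHead [Finite E] (v : V) :
    Module.jacobson A (LinearMap.ker (B.toHead v)) = ⊥ :=
  Module.jacobson_eq_bot_of_injective (B.radCoord v) (B.radCoord_bijective v).1
    (Module.jacobson_pi_eq_bot _ _ fun e =>
      have := B.isSimpleModule_char (B.src e.1)
      IsSimpleModule.jacobson_eq_bot A _)

theorem radicalSeries_one (v : V) :
    radicalSeries A (B.proj v) 1 = LinearMap.ker (B.toHead v) := by
  have h := Module.map_jacobson_of_bijective
    (f := (Submodule.topEquiv : (⊤ : Submodule A (B.proj v)) ≃ₗ[A] _).toLinearMap)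
    Submodule.topEquiv.bijective
  exact h.trans (B.jacobson_proj v)

theorem radicalSeries_add_two [Finite E] (v : V) (n : ℕ) :
    radicalSeries A (B.proj v) (n + 2) = ⊥ := by
  induction n with
  | zero =>
    rw [zero_add, radicalSeries, B.radicalSeries_one, jacobson_ker_toHead, Submodule.map_bot]
  | succ n ih =>
    rw [radicalSeries, ← le_bot_iff, ← ih]
    exact Submodule.map_subtype_le _ _

/-- A direct sum of one-dimensional modules is determined by its multiplicities. -/
theorem nonempty_equiv_heads {M : Type*} [AddCommGroup M] [Module A M] {I : Type*} [Finite I]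
    {w : I → V} (f : M ≃ₗ[A] ((i : I) → CharModule (B.character (w i)))) {n : V → ℕ}
    (hn : ∀ u, Nat.card {i // w i = u} = n u) :
    Nonempty (M ≃ₗ[A] ((i : Σ u : V, Fin (n u)) → ModuleHead A (B.proj i.1))) := by
  have e : ∀ u, {i // w i = u} ≃ Fin (n u) := fun u => Finite.equivFinOfCardEq (hn u)
  let g : I ≃ Σ u : V, Fin (n u) := (Equiv.sigmaFiberEquiv w).symm.trans (Equiv.sigmaCongrRight e)
  have hg : ∀ i, (g i).1 = w i := fun i => rfl
  exact ⟨f.trans ((LinearEquiv.piCongrLeft A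
    (fun j : Σ u : V, Fin (n u) => CharModule (B.character j.1)) g).trans
      (LinearEquiv.piCongrRight fun j => (B.headEquiv j.1).symm))⟩

theorem nonempty_loewyLayer_equiv [Finite E] (v : V) (m : ℕ) {n : V → ℕ}
    (hn : ∀ u, n u = match m with
      | 0 => if v = u then 1 else 0
      | 1 => Nat.card {e // B.src e = u ∧ B.tgt e = v}
      | _ => 0) :
    Nonempty (LoewyLayer A (B.proj v) m ≃ₗ[A]
      ((i : Σ u : V, Fin (n u)) → ModuleHead A (B.proj i.1))) := by
  match m with
  | 0 =>
    have e1 : LoewyLayer A (B.proj v) 0 ≃ₗ[A] ModuleHead A (B.proj v) :=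
      Submodule.Quotient.equiv _ _ (Submodule.topEquiv : (⊤ : Submodule A (B.proj v)) ≃ₗ[A] _)
        (Module.map_jacobson_of_bijective (Submodule.topEquiv : (⊤ : Submodule A _) ≃ₗ[A] _).bijective)
    refine B.nonempty_equiv_heads (I := Unit) (w := fun _ => v)
      ((e1.trans (B.headEquiv v)).trans (LinearEquiv.funUnique Unit A _).symm) fun u => ?_
    rw [hn]
    by_cases h : v = u <;> simp [h]
  | 1 =>
    have e1 : LoewyLayer A (B.proj v) 1 ≃ₗ[A] LinearMap.ker (B.toHead v) := by
      unfold LoewyLayer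
      rw [B.radicalSeries_one]
      exact Submodule.quotEquivOfEqBot _ (B.jacobson_ker_toHead v)
    refine B.nonempty_equiv_heads (e1.trans (B.radEquiv v)) fun u => ?_
    rw [hn]
    refine Nat.card_congr ((Equiv.subtypeSubtypeEquivSubtypeInter
      (fun e => B.tgt e = v) (fun e => B.src e = u)).trans
      (Equiv.subtypeEquivRight fun e => and_comm))
  | m + 2 =>
    have hs : Subsingleton (LoewyLayer A (B.proj v) (m + 2)) := by
      have : Subsingleton (radicalSeries A (B.proj v) (m + 2)) := by
        rw [B.radicalSeries_add_two]
        infer_instance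
      infer_instance
    refine B.nonempty_equiv_heads (I := Empty) (w := Empty.elim) ?_ fun u => ?_
    · exact LinearEquiv.ofBijective 0
        ⟨Function.injective_of_subsingleton _, Function.surjective_to_subsingleton _⟩
    · rw [hn]
      simp

end ArrowBasis

/-! ## The main theorem -/

namespace TypeH4

variable {W : Type*} [Group W] (cs : CoxeterSystem coxeterH4 W)

/-- The basis of the descent algebra. -/
noncomputable def arrowBasis :
    ArrowBasis ℚ cs.descentAlgebra H4Vertex (Σ v w : H4Vertex, H4Edge v w) :=
  have hmul : ∀ p q : Gen, pathEquiv cs (pathBasis p) * pathEquiv cs (pathBasis q) =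
      (genMul p q).elim 0 fun r => pathEquiv cs (pathBasis r) := fun p q => by
    rw [← map_mul, pathBasis_mul]
    cases genMul p q
    · exact map_zero _
    · rfl
  { basis := pathBasis.map (pathEquiv cs).toLinearEquiv
    src := fun e => e.1
    tgt := fun e => e.2.1
    src_ne_tgt := by rintro ⟨_, _, ⟨⟩⟩ <;> simp
    idem_mul_idem := fun v w => by
      refine (hmul _ _).trans ?_
      by_cases h : v = w <;> simp only [genMul, h, if_true, if_false] <;> rfl
    idem_mul_arrow := fun v e => by
      refine (hmul _ _).trans ?_
      by_cases h : v = e.1 <;> simp only [genMul, h, if_true, if_false] <;> rfl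
    arrow_mul_idem := fun e v => by
      refine (hmul _ _).trans ?_
      by_cases h : e.2.1 = v <;> simp only [genMul, h, if_true, if_false] <;> rfl
    arrow_mul_arrow := fun e f => hmul _ _
    sum_idem := by
      refine (map_sum (pathEquiv cs) (fun v => pathBasis (.inl v)) _).symm.trans ?_
      rw [← map_one (pathEquiv cs), PathAlgebra.one_eq]
      simp only [pathBasis_apply]
      rfl }

theorem idem_arrowBasis (v : H4Vertex) : (arrowBasis cs).idem v = cs.eClass v.rep :=
  (pathEquiv_basis cs (.inl v)).trans (gen_vertex cs v)

theorem card_arrows (v w : H4Vertex) :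
    Nat.card {e : Σ v w : H4Vertex, H4Edge v w // e.1 = v ∧ e.2.1 = w} = Nat.card (v ⟶ w) :=
  (Nat.card_congr (Equiv.ofBijective
    (fun e : H4Edge v w => (⟨⟨v, w, e⟩, rfl, rfl⟩ :
      {e : Σ v w : H4Vertex, H4Edge v w // e.1 = v ∧ e.2.1 = w}))
    ⟨fun e f h => by simpa using h, by rintro ⟨⟨_, _, e⟩, rfl, rfl⟩; exact ⟨e, rfl⟩⟩)).symm

instance : Finite (Σ v w : H4Vertex, H4Edge v w) :=
  inferInstanceAs (Finite (Σ v w : H4Vertex, (v ⟶ w)))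

/-- Row `v` and column `w` count the paths from `w` to `v`: the trivial path if `v = w`, and the
edges. -/
theorem card_paths (v w : H4Vertex) : Nat.card {p : Gen // (arrowBasis cs).start p = w ∧
    (arrowBasis cs).finish p = v} = H4cartan v w := by
  rw [Nat.card_congr (Equiv.subtypeSum), Nat.card_sum]
  have h1 : Nat.card {u : H4Vertex // (arrowBasis cs).start (.inl u) = w ∧
      (arrowBasis cs).finish (.inl u) = v} = if v = w then 1 else 0 := by
    change Nat.card {u : H4Vertex // u = w ∧ u = v} = _
    rw [Nat.card_eq_fintype_card]
    revert v w
    decide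
  have h2 : Nat.card {e : Σ v w : H4Vertex, H4Edge v w // (arrowBasis cs).start (.inr e) = w ∧
      (arrowBasis cs).finish (.inr e) = v} = H4loewy 1 v w :=
    (card_arrows w v).trans (card_edge w v)
  rw [h1, h2]
  clear h1 h2
  revert v w
  decide

theorem loewy_eq (v u : H4Vertex) (m : ℕ) : H4loewy m v u = match m with
    | 0 => if v = u then 1 else 0
    | 1 => Nat.card {e : Σ v w : H4Vertex, H4Edge v w // e.1 = u ∧ e.2.1 = v}
    | _ => 0 := by
  match m with
  | 0 => rfl
  | 1 => exact ((card_arrows u v).trans (card_edge u v)).symm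
  | m + 2 => cases v <;> rfl

end TypeH4

open TypeH4 in
theorem mainTheorem4 {W : Type*} [Group W] (cs : CoxeterSystem coxeterH4 W) :
    -- `W` is finite and its longest element is central
    Finite W ∧
    ((∀ w, cs.length w ≤ cs.length (cs.longestElement Finset.univ)) ∧
      cs.longestElement Finset.univ ∈ Subgroup.center W) ∧
    -- the descent algebra is the linear span of the `x_J`, and the `e_L` are well defined
    (Subalgebra.toSubmodule cs.descentAlgebra = Submodule.span ℚ (Set.range cs.xSum) ∧
      ∀ K, cs.x K = ∑ L, cs.mMatrix K L • cs.e L) ∧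
    -- the ten vertices: representatives of the classes of subsets of `S`, and their types
    (Function.Injective (fun v : H4Vertex => cs.parabolicClass v.rep) ∧
      Set.range (fun v : H4Vertex => cs.parabolicClass v.rep) = Set.range cs.parabolicClass ∧
      ∀ v : H4Vertex, coxeterH4.HasType v.rep v.type.2) ∧
    -- the number of vertices and edges; the even part and the odd part, dual to each other
    (Nat.card H4Vertex = 10 ∧
      Nat.card (Σ v w : H4Vertex, (v ⟶ w)) = 6 ∧
      Nat.card (Σ v w : {v : H4Vertex // v.IsEven}, (v.1 ⟶ w.1)) = 3 ∧
      Nat.card (Σ v w : {v : H4Vertex // ¬ v.IsEven}, (v.1 ⟶ w.1)) = 3 ∧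
      ∃ σ : {v : H4Vertex // v.IsEven} ≃ {v : H4Vertex // ¬ v.IsEven},
        ∀ v w, Nonempty ((v.1 ⟶ w.1) ≃ ((σ w).1 ⟶ (σ v).1))) ∧
    -- it is the quiver of the descent algebra
    (∀ v w : H4Vertex,
      gabrielArrows ℚ (cs.eClass v.rep) (cs.eClass w.rep) = Nat.card (v ⟶ w)) ∧
    -- the descent algebra is the path algebra of the quiver (there are no relations)
    (∃ φ : PathAlgebra ℚ H4Vertex ≃ₐ[ℚ] cs.descentAlgebra,
      (∀ v : H4Vertex, φ (PathAlgebra.ofPath ℚ (Quiver.Path.nil : Quiver.Path v v)) =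
        cs.eClass v.rep) ∧
      ∀ (v w : H4Vertex) (α : v ⟶ w), φ (PathAlgebra.ofPath ℚ α.toPath) =
        cs.DeltaStreet (H4Edge.path α)) ∧
    -- the indecomposable projectives, the simple modules and the Loewy series
    (DirectSum.IsInternal (fun v : H4Vertex => cs.projective v.rep) ∧
      (∀ v : H4Vertex, IsIndecomposableModule cs.descentAlgebra (cs.projective v.rep)) ∧
      (∀ v : H4Vertex, IsSimpleModule cs.descentAlgebra (cs.simpleHead v.rep)) ∧
      (∀ v w : H4Vertex,
        Nonempty (cs.simpleHead v.rep ≃ₗ[cs.descentAlgebra] cs.simpleHead w.rep) → v = w) ∧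
      (∀ v : H4Vertex, radicalSeries cs.descentAlgebra (cs.projective v.rep) 2 = ⊥) ∧
      ∀ (v : H4Vertex) (n : ℕ),
        Nonempty (LoewyLayer cs.descentAlgebra (cs.projective v.rep) n ≃ₗ[cs.descentAlgebra]
          ((i : Σ w : H4Vertex, Fin (H4loewy n v w)) → cs.simpleHead i.1.rep))) ∧
    -- the Cartan matrix: the entry at `(v, w)` is the dimension of `e_w Σ(W) e_v`
    (∀ v w : H4Vertex,
      Module.finrank ℚ (cornerSpace (cs.eClass w.rep) (cs.eClass v.rep)
        (⊤ : Submodule ℚ cs.descentAlgebra)) = H4cartan v w) := by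
  have hi := idem_arrowBasis cs
  have hp : ∀ v : H4Vertex, (arrowBasis cs).proj v = cs.projective v.rep := fun v => by
    unfold ArrowBasis.proj CoxeterSystem.projective
    rw [hi]
  have := finite cs
  let := Fintype.ofFinite W
  refine ⟨finite cs, ⟨length_le_longestElement cs, longestElement_mem_center cs⟩,
    ⟨toSubmodule_descentAlgebra cs, x_eq_sum cs⟩,
    ⟨parabolicClass_injective cs, range_parabolicClass cs, hasType_rep⟩,
    ⟨card_vertex, card_edges, card_edges_even, card_edges_odd, exists_duality⟩,
    fun v w => ?_, ⟨pathEquiv cs, fun v => ?_, fun v w α => ?_⟩,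
    ⟨?_, fun v => ?_, fun v => ?_, fun v w => ?_, fun v => ?_, fun v n => ?_⟩, fun v w => ?_⟩
  · rw [← hi, ← hi, (arrowBasis cs).gabrielArrows_eq]
    exact card_arrows v w
  · have h := pathEquiv_basis cs (.inl v)
    rw [gen_vertex, pathBasis_apply] at h
    exact h
  · have h := pathEquiv_basis cs (.inr ⟨v, w, α⟩)
    rw [gen_edge, pathBasis_apply] at h
    exact h
  · have h := (arrowBasis cs).isInternal_proj
    rwa [funext hp] at h
  · rw [← hp]
    exact (arrowBasis cs).isIndecomposableModule_proj v
  · unfold CoxeterSystem.simpleHead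
    rw [← hp]
    exact (arrowBasis cs).isSimpleModule_head v
  · unfold CoxeterSystem.simpleHead
    rw [← hp, ← hp]
    exact fun ⟨f⟩ => (arrowBasis cs).eq_of_headEquiv f
  · rw [← hp]
    exact (arrowBasis cs).radicalSeries_add_two v 0
  · have h := (arrowBasis cs).nonempty_loewyLayer_equiv v n (n := H4loewy n v)
      fun u => loewy_eq v u n
    rw [funext hp] at h
    exact h
  · rw [← hi, ← hi, (arrowBasis cs).finrank_cornerSpace_top]
    exact card_paths cs v w
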